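/- Let $n\ge 1$, $D=\{(x,y): x>0,\ y\in\mathbb R^{n-1}\}\subset\mathbb R^n$, let $F:\mathbb R\to\mathbb R$ and $h:D\to\mathbb R$, and let $u=u(x,y,t)$ be a classical solution of $$u_t-\Delta u=-F\Big(\frac1t\int_0^t u_x(0,y,s)\,ds\Big)\quad(x>0,\ y\in\mathbb R^{n-1},\ t>0),$$ $$u(0,y,t)=0\quad(y\in\mathbb R^{n-1},\ t>0),\qquad u(x,y,0)=h(x,y)\quad(x>0,\ y\in\mathbb R^{n-1}),$$ that is: $u$ is continuous on $\{x\ge0,\ t>0\}$ and $C^2$ in $(x,y)$ and $C^1$ in $t$ (with jointly continuous derivatives) on $\{x>0,\ t>0\}$; the one-sided derivative $V(y,t)=u_x(0,y,t)$ exists for $t>0$ and $V(y,\cdot)$ is integrable on $(0,t)$ for every $t>0$; the equation and the boundary condition hold; and $u(x,y,t)\to u(x,y,0)=h(x,y)$ as $t\to0^+$ for each $(x,y)\in D$. Put $f(y,t)=F\big(\frac1t\int_0^tV(y,s)\,ds\big)$, and assume that $u$ and $f$ grow more slowly than every Gaussian: for all $T,a>0$ there are a constant $A$ and a function $g\in L^1(0,T)$,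 bounded above on $[s,T]$ for every $s\in(0,T)$, such that for $0<t\le T$, $x>0$, $y\in\mathbb R^{n-1}$ $$|u(x,y,t)|\le A\,e^{a(x^2+|y|^2)},\qquad |f(y,t)|\le g(t)\,e^{a|y|^2}.$$ Let $\operatorname{erf}(\zeta)=\frac{2}{\sqrt\pi}\int_0^\zeta e^{-X^2}\,dX$ and let $$G_1(x,y,t;\xi,\eta,\tau)=\frac{e^{-|y-\eta|^2/4(t-\tau)}}{(2\sqrt{\pi(t-\tau)})^{n-1}}\cdot\frac{e^{-(x-\xi)^2/4(t-\tau)}-e^{-(x+\xi)^2/4(t-\tau)}}{2\sqrt{\pi(t-\tau)}}\qquad(t>\tau)$$ be the Green's function of the heat equation in $D$ with homogeneous Dirichlet condition. Then for all $x\ge0$, $y\in\mathbb R^{n-1}$, $t>0$ $$u(x,y,t)=u_0(x,y,t)-\int_0^t\frac{\operatorname{erf}\big(\frac{x}{2\sqrt{t-\tau}}\big)}{(2\sqrt{\pi(t-\tau)})^{n-1}}\left[\int_{\mathbb R^{n-1}}e^{-\frac{|y-\eta|^2}{4(t-\tau)}}F\Big(\frac1\tau\int_0^\tau V(\eta,s)\,ds\Big)d\eta\right]d\tau,$$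 where $u_0(x,y,t)=\int_D G_1(x,y,t;\xi,\eta,0)\,h(\xi,\eta)\,d\xi\,d\eta$, and for all $y\in\mathbb R^{n-1}$ the flux $V(y,\cdot)$ satisfies, for $t>0$, the Volterra integral equation of the second kind $$V(y,t)=V_0(y,t)-2\int_0^t\frac{1}{(2\sqrt{\pi(t-\tau)})^{n}}\left[\int_{\mathbb R^{n-1}}e^{-\frac{|y-\eta|^2}{4(t-\tau)}}F\Big(\frac1\tau\int_0^\tau V(\eta,s)\,ds\Big)d\eta\right]d\tau,$$ where $V_0(y,t)=\int_D \partial_xG_1(0,y,t;\xi,\eta,0)\,h(\xi,\eta)\,d\xi\,d\eta$. All these integrals over $D$, over $\mathbb R^{n-1}$ and over $(0,t)$ converge absolutely. -/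

import Mathlib

open MeasureTheory Set Filter Topology

noncomputable section

namespace HalfSpaceHeat

/-- The tangential space `ℝ^{n-1}`, with `m = n - 1`. -/
abbrev Tangent (m : ℕ) : Type := EuclideanSpace ℝ (Fin m)

/-- The half-space `D = {(x, y) : x > 0, y ∈ ℝ^m}` of `ℝ^n`, `n = m + 1`. -/
def halfSpace (m : ℕ) : Set (ℝ × Tangent m) := Ioi 0 ×ˢ univ

/-- The error function. -/
def erf (z : ℝ) : ℝ := 2 / √Real.pi * ∫ X in (0 : ℝ)..z, Real.exp (-X ^ 2)

/-- Green's function of the one-dimensional heat equation on the half-line with homogeneous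
Dirichlet condition (meaningful for `τ < t`). -/
def greenLine (x t ξ τ : ℝ) : ℝ :=
  (Real.exp (-(x - ξ) ^ 2 / (4 * (t - τ))) - Real.exp (-(x + ξ) ^ 2 / (4 * (t - τ)))) /
    (2 * √(Real.pi * (t - τ)))

/-- Green's function `G₁(x, y, t; ξ, η, τ)` of the heat equation in the half-space with
homogeneous Dirichlet condition (meaningful for `τ < t`). -/
def green {m : ℕ} (x : ℝ) (y : Tangent m) (t ξ : ℝ) (η : Tangent m) (τ : ℝ) : ℝ :=
  Real.exp (-‖y - η‖ ^ 2 / (4 * (t - τ))) / (2 * √(Real.pi * (t - τ))) ^ m * greenLine x t ξ τ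

/-- The derivative `G_{1,x}` of the Green's function in its first variable. -/
def greenX {m : ℕ} (x : ℝ) (y : Tangent m) (t ξ : ℝ) (η : Tangent m) (τ : ℝ) : ℝ :=
  deriv (fun x' : ℝ => green x' y t ξ η τ) x

/-- `u₀(x, y, t) = ∫_D G₁(x, y, t; ξ, η, 0) h(ξ, η) dξ dη`. -/
def initialPart {m : ℕ} (h : ℝ → Tangent m → ℝ) (x : ℝ) (y : Tangent m) (t : ℝ) : ℝ :=
  ∫ p in halfSpace m, green x y t p.1 p.2 0 * h p.1 p.2

/-- `V₀(y, t) = ∫_D G_{1,x}(0, y, t; ξ, η, 0) h(ξ, η) dξ dη`. -/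
def initialFlux {m : ℕ} (h : ℝ → Tangent m → ℝ) (y : Tangent m) (t : ℝ) : ℝ :=
  ∫ p in halfSpace m, greenX 0 y t p.1 p.2 0 * h p.1 p.2

/-- The boundary heat flux `V(y, t) = u_x(0, y, t)`, a one-sided derivative. -/
def boundaryFlux {m : ℕ} (u : ℝ → Tangent m → ℝ → ℝ) (y : Tangent m) (t : ℝ) : ℝ :=
  derivWithin (fun x : ℝ => u x y t) (Ici 0) 0

/-- The source `F ((1/t) ∫_0^t V(y, s) ds)` for a flux `V`. -/
def source {m : ℕ} (F : ℝ → ℝ) (V : Tangent m → ℝ → ℝ) (y : Tangent m) (t : ℝ) : ℝ :=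
  F (1 / t * ∫ s in (0 : ℝ)..t, V y s)

/-- The Laplacian of `ℝ^n` in the space variables `(x, y)`: `u_xx + Δ_y u`. -/
def spaceLaplacian {m : ℕ} (u : ℝ → Tangent m → ℝ → ℝ) (x : ℝ) (y : Tangent m) (t : ℝ) : ℝ :=
  iteratedDeriv 2 (fun x' : ℝ => u x' y t) x +
    Laplacian.laplacian (fun y' : Tangent m => u x y' t) y

/-- `u` is a classical solution of the problem
`u_t - Δu = -F ((1/t) ∫_0^t u_x(0, y, s) ds)` for `x > 0`, `t > 0`, with `u(0, y, t) = 0` for `t > 0`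
and `u(x, y, 0) = h(x, y)` for `x > 0`. No compatibility of `h` with the boundary condition is
required: `u` need not be continuous at `x = 0`, `t = 0`. -/
structure IsClassicalSolution {m : ℕ} (F : ℝ → ℝ) (h : ℝ → Tangent m → ℝ)
    (u : ℝ → Tangent m → ℝ → ℝ) : Prop where
  /-- `u` is continuous up to the boundary `x = 0` for positive times. -/
  continuousOn : ContinuousOn (fun q : ℝ × Tangent m × ℝ => u q.1 q.2.1 q.2.2)
    {q | 0 ≤ q.1 ∧ 0 < q.2.2}
  /-- `u` is `C²` in space and `C¹` in time in the interior, with jointly continuous derivatives. -/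
  contDiffOn_space : ∀ t : ℝ, 0 < t →
    ContDiffOn ℝ 2 (fun p : ℝ × Tangent m => u p.1 p.2 t) (halfSpace m)
  continuousOn_space_deriv : ∀ k : ℕ, k ≤ 2 →
    ContinuousOn (fun q : ℝ × Tangent m × ℝ =>
      iteratedFDeriv ℝ k (fun p : ℝ × Tangent m => u p.1 p.2 q.2.2) (q.1, q.2.1))
      {q | 0 < q.1 ∧ 0 < q.2.2}
  differentiableAt_time : ∀ (x : ℝ) (y : Tangent m) (t : ℝ), 0 < x → 0 < t →
    DifferentiableAt ℝ (fun t' : ℝ => u x y t') t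
  continuousOn_time_deriv :
    ContinuousOn (fun q : ℝ × Tangent m × ℝ => deriv (fun t' : ℝ => u q.1 q.2.1 t') q.2.2)
      {q | 0 < q.1 ∧ 0 < q.2.2}
  /-- The boundary flux exists and is integrable in time down to `t = 0`, so that its time
  average is defined. -/
  differentiable_boundary : ∀ (y : Tangent m) (t : ℝ), 0 < t →
    DifferentiableWithinAt ℝ (fun x : ℝ => u x y t) (Ici 0) 0
  flux_integrable : ∀ (y : Tangent m) (t : ℝ), 0 < t →
    IntervalIntegrable (fun s : ℝ => boundaryFlux u y s) volume 0 t
  /-- The heat equation. -/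
  equation : ∀ (x : ℝ) (y : Tangent m) (t : ℝ), 0 < x → 0 < t →
    deriv (fun t' : ℝ => u x y t') t - spaceLaplacian u x y t = -source F (boundaryFlux u) y t
  /-- The boundary condition. -/
  boundary : ∀ (y : Tangent m) (t : ℝ), 0 < t → u 0 y t = 0
  /-- The initial condition, attained in the limit `t → 0⁺`. -/
  initial : ∀ (x : ℝ) (y : Tangent m), 0 < x → u x y 0 = h x y
  initial_tendsto : ∀ (x : ℝ) (y : Tangent m), 0 < x →
    Tendsto (fun t : ℝ => u x y t) (𝓝[>] 0) (𝓝 (h x y))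

/-- The growth class in which the half-space problem is considered: on bounded time intervals `u`
and the source grow at infinity more slowly than every Gaussian `exp (a |·|²)`, `a > 0`; the source
may be singular at `t = 0`, but integrably so. -/
structure HasSubGaussianGrowth {m : ℕ} (F : ℝ → ℝ) (u : ℝ → Tangent m → ℝ → ℝ) : Prop where
  solution_bound : ∀ T > (0 : ℝ), ∀ a > (0 : ℝ), ∃ A : ℝ,
    ∀ (x : ℝ) (y : Tangent m) (t : ℝ), 0 < x → 0 < t → t ≤ T →
      |u x y t| ≤ A * Real.exp (a * (x ^ 2 + ‖y‖ ^ 2))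
  source_bound : ∀ T > (0 : ℝ), ∀ a > (0 : ℝ), ∃ g : ℝ → ℝ,
    IntegrableOn g (Ioc 0 T) ∧ (∀ s > (0 : ℝ), BddAbove (g '' Icc s T)) ∧
    ∀ (y : Tangent m) (t : ℝ), 0 < t → t ≤ T →
      |source F (boundaryFlux u) y t| ≤ g t * Real.exp (a * ‖y‖ ^ 2)

/-- The Gaussian integral `∫_{ℝ^m} exp (-|y - η|² / (4 (t - τ))) F ((1/τ) ∫_0^τ V(η, s) ds) dη`. -/
def sourceIntegral {m : ℕ} (F : ℝ → ℝ) (V : Tangent m → ℝ → ℝ) (y : Tangent m) (t τ : ℝ) : ℝ :=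
  ∫ η : Tangent m, Real.exp (-‖y - η‖ ^ 2 / (4 * (t - τ))) * source F V η τ

end HalfSpaceHeat

end

open MeasureTheory Set Filter Topology

noncomputable section

namespace HalfSpaceHeat

/-! ### Calculus of the Laplacian: product rule and Green's second identity. -/

section Laplacian

variable {E : Type*} [NormedAddCommGroup E] [InnerProductSpace ℝ E] [FiniteDimensional ℝ E]

/-! Fix `(x, y, t)`. In its source variables `(ξ, η, τ)` the Green's function `G` solves the
backward heat equation and vanishes at `ξ = 0`. Pairing it with the equation for `u` over `D × (s,
r)`, with `0 < s ≤ r < t`, gives `I(r) - I(s) = -∫∫ G f`, where `I(τ) = ∫_D G u(·, τ)` and `f` is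
the source. The nonlinearity and the time average play no role here: `f` is treated as a given
function. It does not depend on `x`, and the equation on the plane `x = 1` shows that it is
continuous.

Two obstacles stand in the way of this pairing. The second derivatives of `u` are not controlled at
`x = 0`, so Green's identity (`IsClassicalSolution.green_identity`) is applied to `u(ξ + ε, η, τ)`;
as `ε → 0` the boundary term `G_ξ(0) u(ε)` disappears because `u` is continuous up to the boundary
and vanishes there. The domain is unbounded, so `G` is multiplied by cutoffs in `ξ` and in `η`,
whose derivatives are `O(1/n)`; the Gaussian decay of `G` beats the growth of `u` and of `f`. Both
limits are taken together in `IsClassicalSolution.green_representation_interior`.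

Since `f` is independent of `ξ`, integrating `G` over `ξ > 0` produces the error function
(`integral_greenLine`). Then `s → 0` by dominated convergence, which gives `u₀`. As `r → t` the
kernel is an approximate identity (`tendsto_integral_kernel`), applied to the extension of `u` by
zero: the direct kernel yields `u(x, y, t)` and the reflected one yields the value of the extension
at `-x`, which is zero.

The Volterra equation is the `x`-derivative of the representation at `x = 0`. Differentiating `erf(x
/ (2√(t - τ)))` gives twice the one-dimensional heat kernel, which is at most a multiple of `(t -
τ)^(-1/2)`, uniformly in `x`. This singularity is integrable at `τ = t`, where the smoothed source
is bounded; near `τ = 0` the kernel is bounded and the source is integrable. -/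

lemma differentiableAt_fderiv_apply {E : Type*} [NormedAddCommGroup E] [NormedSpace ℝ E]
    {f : E → ℝ} {x : E} (hf : ContDiffAt ℝ 2 f x) (w : E) :
    DifferentiableAt ℝ (fun z => fderiv ℝ f z w) x :=
  ((hf.fderiv_right (m := 1) (by norm_num)).differentiableAt (by norm_num)).clm_apply
    (differentiableAt_const w)

lemma iteratedFDeriv_two_eq_fderiv_fderiv {E : Type*} [NormedAddCommGroup E] [NormedSpace ℝ E]
    {f : E → ℝ} {x : E} (hf : ContDiffAt ℝ 2 f x) (v w : E) :
    iteratedFDeriv ℝ 2 f x ![v, w] = fderiv ℝ (fun z => fderiv ℝ f z w) x v := by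
  rw [iteratedFDeriv_two_apply]
  have h1 : DifferentiableAt ℝ (fderiv ℝ f) x :=
    (hf.fderiv_right (m := 1) (by norm_num)).differentiableAt (by norm_num)
  rw [fderiv_clm_apply h1 (differentiableAt_const w)]
  simp

lemma laplacian_eq_sum_fderiv {ι : Type*} [Fintype ι] (e : OrthonormalBasis ι ℝ E) {f : E → ℝ}
    {x : E} (hf : ContDiffAt ℝ 2 f x) :
    Laplacian.laplacian f x = ∑ i, fderiv ℝ (fun z => fderiv ℝ f z (e i)) x (e i) := by
  rw [InnerProductSpace.laplacian_eq_iteratedFDeriv_orthonormalBasis f e]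
  exact Finset.sum_congr rfl fun i _ => iteratedFDeriv_two_eq_fderiv_fderiv hf _ _

lemma fderiv_fderiv_mul {E : Type*} [NormedAddCommGroup E] [NormedSpace ℝ E] {f g : E → ℝ}
    (hf : ContDiff ℝ 2 f) (hg : ContDiff ℝ 2 g) (x w : E) :
    fderiv ℝ (fun z => fderiv ℝ (fun z' => f z' * g z') z w) x w =
      fderiv ℝ (fun z => fderiv ℝ f z w) x w * g x + 2 * (fderiv ℝ f x w * fderiv ℝ g x w) +
        f x * fderiv ℝ (fun z => fderiv ℝ g z w) x w := by
  have df : Differentiable ℝ f := hf.differentiable (by norm_num)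
  have dg : Differentiable ℝ g := hg.differentiable (by norm_num)
  have h1 : (fun z => fderiv ℝ (fun z' => f z' * g z') z w) =
      fun z => f z * fderiv ℝ g z w + g z * fderiv ℝ f z w := by
    ext z
    rw [fderiv_fun_mul (df z) (dg z)]
    simp
  have d2f := differentiableAt_fderiv_apply (hf.contDiffAt (x := x)) w
  have d2g := differentiableAt_fderiv_apply (hg.contDiffAt (x := x)) w
  rw [h1, fderiv_fun_add ((df x).fun_mul d2g) ((dg x).fun_mul d2f), fderiv_fun_mul (df x) d2g,
    fderiv_fun_mul (dg x) d2f]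
  simp only [add_apply, smul_apply, smul_eq_mul]
  ring

lemma laplacian_mul {ι : Type*} [Fintype ι] (e : OrthonormalBasis ι ℝ E) {f g : E → ℝ}
    (hf : ContDiff ℝ 2 f) (hg : ContDiff ℝ 2 g) (x : E) :
    Laplacian.laplacian (fun z => f z * g z) x =
      Laplacian.laplacian f x * g x + 2 * ∑ i, fderiv ℝ f x (e i) * fderiv ℝ g x (e i) +
        f x * Laplacian.laplacian g x := by
  rw [laplacian_eq_sum_fderiv e (hf.mul hg).contDiffAt, laplacian_eq_sum_fderiv e hf.contDiffAt,
    laplacian_eq_sum_fderiv e hg.contDiffAt, Finset.sum_mul, Finset.mul_sum, Finset.mul_sum,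
    ← Finset.sum_add_distrib, ← Finset.sum_add_distrib]
  exact Finset.sum_congr rfl fun i _ => fderiv_fderiv_mul hf hg x (e i)

lemma continuous_fderiv_fderiv {E : Type*} [NormedAddCommGroup E] [NormedSpace ℝ E] {f : E → ℝ}
    (hf : ContDiff ℝ 2 f) (w : E) :
    Continuous (fun x => fderiv ℝ (fun z => fderiv ℝ f z w) x w) := by
  have h1 : ContDiff ℝ 1 (fun z => fderiv ℝ f z w) :=
    (hf.fderiv_right (m := 1) (by norm_num)).clm_apply contDiff_const
  exact (h1.continuous_fderiv (by norm_num)).clm_apply continuous_const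

lemma continuous_fderiv_apply {E : Type*} [NormedAddCommGroup E] [NormedSpace ℝ E] {f : E → ℝ}
    (hf : ContDiff ℝ 2 f) (w : E) : Continuous (fun x => fderiv ℝ f x w) :=
  (hf.continuous_fderiv (by norm_num)).clm_apply continuous_const

/-- Green's second identity for a compactly supported test function. -/
lemma integral_mul_laplacian [MeasurableSpace E] [BorelSpace E] {b v : E → ℝ}
    (hb : ContDiff ℝ 2 b) (hbc : HasCompactSupport b) (hv : ContDiff ℝ 2 v) :
    ∫ x, b x * Laplacian.laplacian v x = ∫ x, Laplacian.laplacian b x * v x := by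
  set e := stdOrthonormalBasis ℝ E
  have db : Differentiable ℝ b := hb.differentiable (by norm_num)
  have dv : Differentiable ℝ v := hv.differentiable (by norm_num)
  have hbc1 : ∀ w, HasCompactSupport (fun x => fderiv ℝ b x w) := fun w => hbc.fderiv_apply ℝ w
  have hbc2 : ∀ w, HasCompactSupport (fun x => fderiv ℝ (fun z => fderiv ℝ b z w) x w) :=
    fun w => (hbc1 w).fderiv_apply ℝ w
  have i0 : ∀ w, Integrable (fun x => b x * fderiv ℝ (fun z => fderiv ℝ v z w) x w) := fun w =>
    (hb.continuous.mul (continuous_fderiv_fderiv hv w)).integrable_of_hasCompactSupport hbc.mul_right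
  have i1 : ∀ w, Integrable (fun x => fderiv ℝ b x w * fderiv ℝ v x w) := fun w =>
    ((continuous_fderiv_apply hb w).mul (continuous_fderiv_apply hv
      w)).integrable_of_hasCompactSupport (hbc1 w).mul_right
  have i2 : ∀ w, Integrable (fun x => fderiv ℝ (fun z => fderiv ℝ b z w) x w * v x) := fun w =>
    ((continuous_fderiv_fderiv hb w).mul hv.continuous).integrable_of_hasCompactSupport
      (hbc2 w).mul_right
  -- Two integrations by parts in the direction `w`. Every product contains `b` or one of its
  -- derivatives, so it has compact support and `v` needs no decay.
  have key : ∀ w, ∫ x, b x * fderiv ℝ (fun z => fderiv ℝ v z w) x w =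
      ∫ x, fderiv ℝ (fun z => fderiv ℝ b z w) x w * v x := by
    intro w
    rw [integral_mul_fderiv_eq_neg_fderiv_mul_of_integrable (i1 w) (i0 w)
      ((hb.continuous.mul (continuous_fderiv_apply hv w)).integrable_of_hasCompactSupport
        hbc.mul_right) (fun x _ => db x)
      (fun x _ => differentiableAt_fderiv_apply hv.contDiffAt w),
      integral_mul_fderiv_eq_neg_fderiv_mul_of_integrable (i2 w) (i1 w)
      (((continuous_fderiv_apply hb w).mul hv.continuous).integrable_of_hasCompactSupport
        (hbc1 w).mul_right) (fun x _ => differentiableAt_fderiv_apply hb.contDiffAt w)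
      (fun x _ => dv x), neg_neg]
  simp_rw [laplacian_eq_sum_fderiv e hv.contDiffAt, laplacian_eq_sum_fderiv e hb.contDiffAt,
    Finset.mul_sum, Finset.sum_mul]
  rw [integral_finsetSum _ (fun i _ => i0 (e i)), integral_finsetSum _ (fun i _ => i2 (e i))]
  exact Finset.sum_congr rfl fun i _ => key (e i)

end Laplacian

/-! ### Heat kernels and their derivatives. -/

section Kernels

/-- The one-dimensional heat kernel at time `σ`. -/
def lineKernel (z σ : ℝ) : ℝ := Real.exp (-z ^ 2 / (4 * σ)) / (2 * √(Real.pi * σ))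

/-- The heat kernel of the tangential space at time `σ`. -/
def tangentKernel {m : ℕ} (z : Tangent m) (σ : ℝ) : ℝ :=
  Real.exp (-‖z‖ ^ 2 / (4 * σ)) / (2 * √(Real.pi * σ)) ^ m

lemma greenLine_eq (x t ξ τ : ℝ) :
    greenLine x t ξ τ = lineKernel (x - ξ) (t - τ) - lineKernel (x + ξ) (t - τ) := by
  simp only [greenLine, lineKernel, sub_div]

lemma green_eq {m : ℕ} (x : ℝ) (y : Tangent m) (t ξ : ℝ) (η : Tangent m) (τ : ℝ) :
    green x y t ξ η τ = tangentKernel (y - η) (t - τ) * greenLine x t ξ τ := rfl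

/-- No sign condition on `σ` is needed: for `σ ≤ 0` the square root is zero and the kernel vanishes
identically. -/
lemma hasDerivAt_lineKernel (z σ : ℝ) :
    HasDerivAt (fun z => lineKernel z σ) (-(z / (2 * σ)) * lineKernel z σ) z := by
  unfold lineKernel
  have h : HasDerivAt (fun z : ℝ => -z ^ 2 / (4 * σ)) (-(2 * z) / (4 * σ)) z := by
    simpa using ((hasDerivAt_pow 2 z).neg).div_const (4 * σ)
  refine (h.exp.div_const (2 * √(Real.pi * σ))).congr_deriv ?_
  rw [show -(2 * z) / (4 * σ) = -(z / (2 * σ)) by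
    rw [show 4 * σ = 2 * (2 * σ) by ring, ← mul_neg, mul_div_mul_left _ _ two_ne_zero, neg_div]]
  ring

lemma hasDerivAt_deriv_lineKernel (z σ : ℝ) :
    HasDerivAt (fun z => -(z / (2 * σ)) * lineKernel z σ)
      ((z ^ 2 / (4 * σ ^ 2) - 1 / (2 * σ)) * lineKernel z σ) z := by
  have h : HasDerivAt (fun z : ℝ => -(z / (2 * σ))) (-(1 / (2 * σ))) z :=
    ((hasDerivAt_id z).div_const _).neg
  refine (h.fun_mul (hasDerivAt_lineKernel z σ)).congr_deriv ?_
  ring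

lemma hasDerivAt_two_mul_sqrt_pi_mul {σ : ℝ} (hσ : 0 < σ) :
    HasDerivAt (fun σ => 2 * √(Real.pi * σ)) ((2 * √(Real.pi * σ)) / (2 * σ)) σ := by
  have hp : 0 < Real.pi * σ := mul_pos Real.pi_pos hσ
  have h1 : HasDerivAt (fun σ : ℝ => Real.pi * σ) Real.pi σ := by
    simpa using (hasDerivAt_id σ).const_mul Real.pi
  refine ((h1.sqrt hp.ne').const_mul 2).congr_deriv ?_
  have := Real.sqrt_pos.2 hp
  field_simp
  rw [Real.sq_sqrt hp.le]

lemma hasDerivAt_neg_div_four_mul (c : ℝ) {σ : ℝ} (hσ : 0 < σ) :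
    HasDerivAt (fun σ : ℝ => -c / (4 * σ)) (c / (4 * σ ^ 2)) σ := by
  have h1 : HasDerivAt (fun σ : ℝ => 4 * σ) 4 σ := by
    simpa using (hasDerivAt_id σ).const_mul 4
  refine ((hasDerivAt_const σ (-c)).fun_div h1 (by positivity)).congr_deriv ?_
  field_simp
  ring

/-- The factor is the one in `hasDerivAt_deriv_lineKernel`: this is the heat equation for the
kernel. -/
lemma hasDerivAt_lineKernel_time (z : ℝ) {σ : ℝ} (hσ : 0 < σ) :
    HasDerivAt (fun σ => lineKernel z σ) ((z ^ 2 / (4 * σ ^ 2) - 1 / (2 * σ)) * lineKernel z σ)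
      σ := by
  unfold lineKernel
  have hp : 0 < 2 * √(Real.pi * σ) := by have := Real.pi_pos; positivity
  refine ((hasDerivAt_neg_div_four_mul (z ^ 2) hσ).exp.fun_div (hasDerivAt_two_mul_sqrt_pi_mul hσ)
    hp.ne').congr_deriv ?_
  field_simp

lemma hasDerivAt_tangentKernel_time {m : ℕ} (z : Tangent m) {σ : ℝ} (hσ : 0 < σ) :
    HasDerivAt (fun σ => tangentKernel z σ)
      ((‖z‖ ^ 2 / (4 * σ ^ 2) - m / (2 * σ)) * tangentKernel z σ) σ := by
  unfold tangentKernel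
  have hp : 0 < 2 * √(Real.pi * σ) := by have := Real.pi_pos; positivity
  refine ((hasDerivAt_neg_div_four_mul (‖z‖ ^ 2) hσ).exp.fun_div
    ((hasDerivAt_two_mul_sqrt_pi_mul hσ).fun_pow m) (pow_pos hp m).ne').congr_deriv ?_
  -- The power rule produces the exponent `m - 1`, a truncated subtraction when `m = 0`.
  rcases m with _ | k
  · simp; ring
  · simp only [Nat.add_sub_cancel]
    set S := 2 * √(Real.pi * σ)
    push_cast
    field_simp
    ring

lemma hasFDerivAt_tangentKernel {m : ℕ} (y η : Tangent m) (σ : ℝ) :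
    HasFDerivAt (fun η => tangentKernel (y - η) σ)
      ((tangentKernel (y - η) σ / (2 * σ)) • innerSL ℝ (y - η)) η := by
  unfold tangentKernel
  have h0 : HasFDerivAt (fun η : Tangent m => y - η) (-(ContinuousLinearMap.id ℝ _)) η :=
    (hasFDerivAt_id η).const_sub y
  have h1 := (h0.norm_sq.neg.mul_const (4 * σ)⁻¹).exp.mul_const (((2 * √(Real.pi * σ)) ^ m)⁻¹)
  simp only [← div_eq_mul_inv] at h1
  refine h1.congr_fderiv ?_
  ext w
  simp
  ring

lemma contDiff_tangentKernel {m : ℕ} (y : Tangent m) (σ : ℝ) :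
    ContDiff ℝ 2 (fun η => tangentKernel (y - η) σ) := by
  unfold tangentKernel
  exact ((((contDiff_const.sub contDiff_id).norm_sq ℝ).neg.div_const _).exp).div_const _

lemma fderiv_tangentKernel {m : ℕ} (y η w : Tangent m) (σ : ℝ) :
    fderiv ℝ (fun η => tangentKernel (y - η) σ) η w =
      tangentKernel (y - η) σ / (2 * σ) * inner ℝ (y - η) w := by
  rw [(hasFDerivAt_tangentKernel y η σ).fderiv]
  rfl

/-- By Parseval the squared components of `y - η` sum to `‖y - η‖ ^ 2`, and each of the `m`
directions contributes `-1 / (2σ)`. The result agrees with `hasDerivAt_tangentKernel_time`, as the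
heat equation requires. -/
lemma laplacian_tangentKernel {m : ℕ} (y η : Tangent m) {σ : ℝ} (hσ : 0 < σ) :
    Laplacian.laplacian (fun η : Tangent m => tangentKernel (y - η) σ) η =
      (‖y - η‖ ^ 2 / (4 * σ ^ 2) - m / (2 * σ)) * tangentKernel (y - η) σ := by
  set e := EuclideanSpace.basisFun (Fin m) ℝ
  rw [laplacian_eq_sum_fderiv e (contDiff_tangentKernel y σ).contDiffAt]
  have key : ∀ i, fderiv ℝ (fun z => fderiv ℝ (fun η : Tangent m => tangentKernel (y - η) σ) z (e i)) η
      (e i) =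
      tangentKernel (y - η) σ / (4 * σ ^ 2) * ‖inner ℝ (y - η) (e i)‖ ^ 2 -
        tangentKernel (y - η) σ / (2 * σ) := by
    intro i
    simp_rw [fderiv_tangentKernel]
    have h0 : HasFDerivAt (fun η : Tangent m => y - η) (-(ContinuousLinearMap.id ℝ _)) η :=
      (hasFDerivAt_id η).const_sub y
    have h1 := h0.inner ℝ (hasFDerivAt_const (e i) η)
    have h2 := ((hasFDerivAt_tangentKernel y η σ).mul_const (2 * σ)⁻¹).fun_mul h1
    simp only [← div_eq_mul_inv] at h2
    rw [HasFDerivAt.fderiv h2]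
    have he : ‖e i‖ = 1 := e.norm_eq_one i
    simp [he, inner_sub_left]
    field_simp
    ring
  simp_rw [key]
  rw [Finset.sum_sub_distrib, ← Finset.mul_sum, e.sum_sq_norm_inner_left]
  simp
  ring

end Kernels

/-! ### Joint regularity of a classical solution and of its source. -/

section Regularity

variable {m : ℕ} {F : ℝ → ℝ} {h : ℝ → Tangent m → ℝ} {u : ℝ → Tangent m → ℝ → ℝ}

lemma isOpen_halfSpace (m : ℕ) : IsOpen (halfSpace m) := isOpen_Ioi.prod isOpen_univ

lemma IsClassicalSolution.contDiffAt (hu : IsClassicalSolution F h u) {x t : ℝ} (hx : 0 < x)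
    (y : Tangent m) (ht : 0 < t) :
    ContDiffAt ℝ 2 (fun p : ℝ × Tangent m => u p.1 p.2 t) (x, y) :=
  (hu.contDiffOn_space t ht).contDiffAt ((isOpen_halfSpace m).mem_nhds ⟨hx, mem_univ _⟩)

lemma IsClassicalSolution.hasDerivAt_normal (hu : IsClassicalSolution F h u) {x t : ℝ}
    (hx : 0 < x) (y : Tangent m) (ht : 0 < t) :
    HasDerivAt (fun x' => u x' y t)
      (fderiv ℝ (fun p : ℝ × Tangent m => u p.1 p.2 t) (x, y) (1, 0)) x := by
  have h1 := ((hu.contDiffAt hx y ht).differentiableAt (by norm_num)).hasFDerivAt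
  exact h1.comp_hasDerivAt x ((hasDerivAt_id x).prodMk (hasDerivAt_const x y))

lemma IsClassicalSolution.hasDerivAt_normal_normal (hu : IsClassicalSolution F h u) {x t : ℝ}
    (hx : 0 < x) (y : Tangent m) (ht : 0 < t) :
    HasDerivAt (fun x' => fderiv ℝ (fun p : ℝ × Tangent m => u p.1 p.2 t) (x', y) (1, 0))
      (iteratedDeriv 2 (fun x' => u x' y t) x) x := by
  have h1 := (differentiableAt_fderiv_apply (hu.contDiffAt hx y ht) (1, 0)).hasFDerivAt
  have h2 := h1.comp_hasDerivAt x ((hasDerivAt_id x).prodMk (hasDerivAt_const x y))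
  refine h2.congr_deriv ?_
  rw [iteratedDeriv_succ, iteratedDeriv_one]
  refine (h2.deriv.symm.trans (Filter.EventuallyEq.deriv_eq ?_))
  filter_upwards [Ioi_mem_nhds hx] with x' hx'
  exact (hu.hasDerivAt_normal hx' y ht).deriv.symm

/-- The joint continuity that is assumed concerns the full second derivative in `(x, y)`; writing a
partial derivative as one of its values transfers that continuity.
`IsClassicalSolution.laplacian_tangential` does the same for the tangential directions. -/
lemma IsClassicalSolution.iteratedDeriv_normal (hu : IsClassicalSolution F h u) {x t : ℝ}
    (hx : 0 < x) (y : Tangent m) (ht : 0 < t) :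
    iteratedDeriv 2 (fun x' => u x' y t) x =
      iteratedFDeriv ℝ 2 (fun p : ℝ × Tangent m => u p.1 p.2 t) (x, y) ![(1, 0), (1, 0)] := by
  have h1 := (differentiableAt_fderiv_apply (hu.contDiffAt hx y ht) (1, 0)).hasFDerivAt
  have h2 := h1.comp_hasDerivAt x ((hasDerivAt_id x).prodMk (hasDerivAt_const x y))
  rw [iteratedFDeriv_two_eq_fderiv_fderiv (hu.contDiffAt hx y ht)]
  exact (hu.hasDerivAt_normal_normal hx y ht).unique h2

lemma IsClassicalSolution.contDiff_tangential (hu : IsClassicalSolution F h u) {x t : ℝ}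
    (hx : 0 < x) (ht : 0 < t) : ContDiff ℝ 2 (fun y : Tangent m => u x y t) := by
  rw [contDiff_iff_contDiffAt]
  intro y
  exact (hu.contDiffAt hx y ht).comp y (contDiffAt_const.prodMk contDiffAt_id)

lemma IsClassicalSolution.laplacian_tangential (hu : IsClassicalSolution F h u) {x t : ℝ}
    (hx : 0 < x) (y : Tangent m) (ht : 0 < t) :
    Laplacian.laplacian (fun y' : Tangent m => u x y' t) y =
      ∑ i, iteratedFDeriv ℝ 2 (fun p : ℝ × Tangent m => u p.1 p.2 t) (x, y)
        ![(0, EuclideanSpace.basisFun (Fin m) ℝ i), (0, EuclideanSpace.basisFun (Fin m) ℝ i)] := by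
  rw [laplacian_eq_sum_fderiv (EuclideanSpace.basisFun (Fin m) ℝ)
    (hu.contDiff_tangential hx ht).contDiffAt]
  refine Finset.sum_congr rfl fun i _ => ?_
  set w : Tangent m := EuclideanSpace.basisFun (Fin m) ℝ i
  rw [iteratedFDeriv_two_eq_fderiv_fderiv (hu.contDiffAt hx y ht)]
  have hι : ∀ z : Tangent m, HasFDerivAt (fun z : Tangent m => (x, z))
      (ContinuousLinearMap.inr ℝ ℝ (Tangent m)) z := fun z => hasFDerivAt_prodMk_right x z
  have e1 : (fun z => fderiv ℝ (fun y' : Tangent m => u x y' t) z w) =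
      fun z => fderiv ℝ (fun p : ℝ × Tangent m => u p.1 p.2 t) (x, z) (0, w) := by
    ext z
    have h1 := ((hu.contDiffAt hx z ht).differentiableAt (by norm_num)).hasFDerivAt
    have h3 : HasFDerivAt (fun y' : Tangent m => u x y' t) _ z := h1.comp z (hι z)
    rw [h3.fderiv]
    simp
  rw [e1]
  have h2 := (differentiableAt_fderiv_apply (hu.contDiffAt hx y ht) (0, w)).hasFDerivAt
  have h3 : HasFDerivAt
      (fun z => fderiv ℝ (fun p : ℝ × Tangent m => u p.1 p.2 t) (x, z) (0, w)) _ y :=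
    h2.comp y (hι y)
  rw [h3.fderiv]
  simp

lemma IsClassicalSolution.continuousOn_iteratedDeriv_normal (hu : IsClassicalSolution F h u) :
    ContinuousOn (fun q : ℝ × Tangent m × ℝ => iteratedDeriv 2 (fun x' => u x' q.2.1 q.2.2) q.1)
      {q | 0 < q.1 ∧ 0 < q.2.2} := by
  have h1 := (ContinuousMultilinearMap.apply ℝ (fun _ : Fin 2 => ℝ × Tangent m) ℝ
    ![(1, 0), (1, 0)]).continuous.comp_continuousOn (hu.continuousOn_space_deriv 2 le_rfl)
  exact h1.congr fun q hq => hu.iteratedDeriv_normal hq.1 q.2.1 hq.2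

lemma IsClassicalSolution.continuousOn_laplacian (hu : IsClassicalSolution F h u) :
    ContinuousOn (fun q : ℝ × Tangent m × ℝ =>
      Laplacian.laplacian (fun y' : Tangent m => u q.1 y' q.2.2) q.2.1)
      {q | 0 < q.1 ∧ 0 < q.2.2} := by
  have h1 : ∀ i, ContinuousOn (fun q : ℝ × Tangent m × ℝ =>
      iteratedFDeriv ℝ 2 (fun p : ℝ × Tangent m => u p.1 p.2 q.2.2) (q.1, q.2.1)
        ![(0, EuclideanSpace.basisFun (Fin m) ℝ i), (0, EuclideanSpace.basisFun (Fin m) ℝ i)])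
      {q | 0 < q.1 ∧ 0 < q.2.2} := fun i =>
    (ContinuousMultilinearMap.apply ℝ (fun _ : Fin 2 => ℝ × Tangent m) ℝ
      ![(0, EuclideanSpace.basisFun (Fin m) ℝ i),
        (0, EuclideanSpace.basisFun (Fin m) ℝ i)]).continuous.comp_continuousOn
        (hu.continuousOn_space_deriv 2 le_rfl)
  exact (continuousOn_finsetSum _ fun i _ => h1 i).congr fun q hq =>
    hu.laplacian_tangential hq.1 q.2.1 hq.2

/-- Nothing is known about `F` or about the dependence of the flux on `y`. But the source is
independent of `x`, so the equation on the plane `x = 1` expresses it through continuous derivatives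
of `u`. -/
lemma IsClassicalSolution.continuousOn_source (hu : IsClassicalSolution F h u) :
    ContinuousOn (fun w : Tangent m × ℝ => source F (boundaryFlux u) w.1 w.2) {w | 0 < w.2} := by
  have hι : ContinuousOn (fun w : Tangent m × ℝ => ((1 : ℝ), w)) {w | 0 < w.2} :=
    (continuous_const.prodMk continuous_id).continuousOn
  have hm : MapsTo (fun w : Tangent m × ℝ => ((1 : ℝ), w)) {w | 0 < w.2}
      {q | 0 < q.1 ∧ 0 < q.2.2} := fun w hw => ⟨one_pos, hw⟩
  have h1 := ((hu.continuousOn_iteratedDeriv_normal.add hu.continuousOn_laplacian).sub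
    hu.continuousOn_time_deriv).comp hι hm
  refine h1.congr fun w hw => ?_
  have := hu.equation 1 w.1 w.2 one_pos hw
  simp only [spaceLaplacian] at this
  simp only [Function.comp, Pi.add_apply, Pi.sub_apply]
  linarith

lemma IsClassicalSolution.hasDerivAt_time (hu : IsClassicalSolution F h u) {x t : ℝ} (hx : 0 < x)
    (y : Tangent m) (ht : 0 < t) :
    HasDerivAt (fun t' => u x y t') (iteratedDeriv 2 (fun x' => u x' y t) x +
      Laplacian.laplacian (fun y' : Tangent m => u x y' t) y - source F (boundaryFlux u) y t)
      t := by
  refine (hu.differentiableAt_time x y t hx ht).hasDerivAt.congr_deriv ?_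
  have := hu.equation x y t hx ht
  simp only [spaceLaplacian] at this
  linarith

end Regularity

/-! ### Green's identity for the heat operator with product test functions. -/

section GreenIdentity

/-- Two integrations by parts on `[0, N]`. Everything vanishes at `N`, and `a 0 = 0` removes the
unknown `v₁ 0`, so that only the boundary value of `v` remains. -/
lemma integral_Ioi_mul_deriv_deriv {a a₁ a₂ v v₁ v₂ : ℝ → ℝ} {N : ℝ} (hN : 0 ≤ N)
    (ha : ∀ ξ ∈ Icc 0 N, HasDerivAt a (a₁ ξ) ξ) (ha₁ : ∀ ξ ∈ Icc 0 N, HasDerivAt a₁ (a₂ ξ) ξ)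
    (hv : ∀ ξ ∈ Icc 0 N, HasDerivAt v (v₁ ξ) ξ) (hv₁ : ∀ ξ ∈ Icc 0 N, HasDerivAt v₁ (v₂ ξ) ξ)
    (ca₂ : ContinuousOn a₂ (Icc 0 N)) (cv₂ : ContinuousOn v₂ (Icc 0 N))
    (a0 : a 0 = 0) (aN : ∀ ξ ≥ N, a ξ = 0) (a₁N : a₁ N = 0) (a₂N : ∀ ξ ≥ N, a₂ ξ = 0) :
    ∫ ξ in Ioi 0, a ξ * v₂ ξ = (∫ ξ in Ioi 0, a₂ ξ * v ξ) + a₁ 0 * v 0 := by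
  have hu : uIcc 0 N = Icc 0 N := uIcc_of_le hN
  have red : ∀ f : ℝ → ℝ, (∀ ξ ≥ N, f ξ = 0) → ∫ ξ in Ioi 0, f ξ = ∫ ξ in (0 : ℝ)..N, f ξ := by
    intro f hf
    rw [intervalIntegral.integral_of_le hN]
    have hsub : Ioc 0 N ⊆ Ioi (0 : ℝ) := fun ξ hξ => hξ.1
    refine setIntegral_eq_of_subset_of_forall_sdiff_eq_zero measurableSet_Ioi hsub
      fun ξ hξ => hf ξ ?_
    by_contra hlt
    exact hξ.2 ⟨hξ.1, (not_le.1 hlt).le⟩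
  have ca₁ : ContinuousOn a₁ (Icc 0 N) := fun ξ hξ => (ha₁ ξ hξ).continuousAt.continuousWithinAt
  have cv₁ : ContinuousOn v₁ (Icc 0 N) := fun ξ hξ => (hv₁ ξ hξ).continuousAt.continuousWithinAt
  have ii : ∀ f : ℝ → ℝ, ContinuousOn f (Icc 0 N) → IntervalIntegrable f volume 0 N :=
    fun f hf => (hf.mono hu.le).intervalIntegrable
  rw [red _ (fun ξ hξ => by rw [aN ξ hξ, zero_mul]), red _ (fun ξ hξ => by rw [a₂N ξ hξ, zero_mul]),
    intervalIntegral.integral_mul_deriv_eq_deriv_mul (by rwa [hu]) (by rwa [hu]) (ii _ ca₁)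
      (ii _ cv₂),
    intervalIntegral.integral_mul_deriv_eq_deriv_mul (by rwa [hu]) (by rwa [hu]) (ii _ ca₂)
      (ii _ cv₁), aN N le_rfl, a₁N, a0]
  ring

/-- The measure `dξ dη dτ` on `(0, ∞) × ℝ^m × (s, r]`. -/
def slab (m : ℕ) (s r : ℝ) : Measure (ℝ × Tangent m × ℝ) :=
  (volume.restrict (Ioi 0)).prod (volume.prod (volume.restrict (Ioc s r)))

lemma slab_eq_restrict (m : ℕ) (s r : ℝ) :
    slab m s r = volume.restrict (Ioi 0 ×ˢ (univ ×ˢ Ioc s r)) := by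
  rw [slab, Measure.volume_eq_prod, Measure.volume_eq_prod, ← Measure.prod_restrict,
    ← Measure.prod_restrict, Measure.restrict_univ]

/-- Continuity is required only on a compact box; outside it the function vanishes, and it may be
undefined or irregular for times outside `[s, r]`. -/
lemma integrable_slab {m : ℕ} {s r N M : ℝ} {H : ℝ × Tangent m × ℝ → ℝ}
    (hH : ContinuousOn H (Icc 0 N ×ˢ (Metric.closedBall 0 M ×ˢ Icc s r)))
    (hz : ∀ (ξ : ℝ) (η : Tangent m) (τ : ℝ), τ ∈ Icc s r → (N ≤ ξ ∨ M ≤ ‖η‖) → H (ξ, η, τ) = 0) :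
    Integrable H (slab m s r) := by
  rw [slab_eq_restrict]
  have h1 : IntegrableOn H (Icc 0 N ×ˢ (Metric.closedBall 0 M ×ˢ Icc s r)) :=
    hH.integrableOn_compact (isCompact_Icc.prod ((isCompact_closedBall 0 M).prod isCompact_Icc))
  refine h1.of_forall_sdiff_eq_zero
    (measurableSet_Ioi.prod (MeasurableSet.univ.prod measurableSet_Ioc)) ?_
  rintro ⟨ξ, η, τ⟩ ⟨⟨h0, -, hτ⟩, hn⟩
  have hτr : τ ∈ Icc s r := Ioc_subset_Icc_self hτ
  refine hz ξ η τ hτr ?_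
  by_contra hc
  push Not at hc
  exact hn ⟨⟨le_of_lt h0, hc.1.le⟩, by simpa using hc.2.le, hτr⟩

/-- The normal factor of a test function: `a` vanishes at `ξ = 0` and for large `ξ`; `a₁`, `a₂` are
its derivatives in `ξ` and `aₜ` is its derivative in time. -/
structure IsNormalTest (s r : ℝ) (a a₁ a₂ aₜ : ℝ → ℝ → ℝ) : Prop where
  hasDerivAt : ∀ τ ∈ Icc s r, ∀ ξ, HasDerivAt (fun ξ => a ξ τ) (a₁ ξ τ) ξ
  hasDerivAt_deriv : ∀ τ ∈ Icc s r, ∀ ξ, HasDerivAt (fun ξ => a₁ ξ τ) (a₂ ξ τ) ξ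
  hasDerivAt_time : ∀ τ ∈ Icc s r, ∀ ξ, HasDerivAt (fun τ => a ξ τ) (aₜ ξ τ) τ
  continuousOn : ContinuousOn (fun w : ℝ × ℝ => a w.1 w.2) (univ ×ˢ Icc s r)
  continuousOn_deriv : ContinuousOn (fun w : ℝ × ℝ => a₁ w.1 w.2) (univ ×ˢ Icc s r)
  continuousOn_deriv_deriv : ContinuousOn (fun w : ℝ × ℝ => a₂ w.1 w.2) (univ ×ˢ Icc s r)
  continuousOn_time : ContinuousOn (fun w : ℝ × ℝ => aₜ w.1 w.2) (univ ×ˢ Icc s r)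
  zero : ∀ τ ∈ Icc s r, a 0 τ = 0
  support : ∃ N ≥ 0, ∀ τ ∈ Icc s r, ∀ ξ ≥ N, a ξ τ = 0 ∧ a₁ ξ τ = 0 ∧ a₂ ξ τ = 0 ∧ aₜ ξ τ = 0

/-- The tangential factor of a test function: `b` vanishes for large `η`, and `b'` is its derivative
in time. -/
structure IsTangentTest {m : ℕ} (s r : ℝ) (b b' : Tangent m → ℝ → ℝ) : Prop where
  contDiff : ∀ τ ∈ Icc s r, ContDiff ℝ 2 (fun η => b η τ)
  hasDerivAt_time : ∀ τ ∈ Icc s r, ∀ η, HasDerivAt (fun τ => b η τ) (b' η τ) τ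
  continuousOn : ContinuousOn (fun w : Tangent m × ℝ => b w.1 w.2) (univ ×ˢ Icc s r)
  continuousOn_laplacian : ContinuousOn (fun w : Tangent m × ℝ =>
    Laplacian.laplacian (fun η : Tangent m => b η w.2) w.1) (univ ×ˢ Icc s r)
  continuousOn_time : ContinuousOn (fun w : Tangent m × ℝ => b' w.1 w.2) (univ ×ˢ Icc s r)
  support : ∃ M ≥ 0, ∀ τ ∈ Icc s r, ∀ η, M ≤ ‖η‖ → b η τ = 0 ∧ b' η τ = 0 ∧
    Laplacian.laplacian (fun η : Tangent m => b η τ) η = 0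

variable {m : ℕ} {F : ℝ → ℝ} {h : ℝ → Tangent m → ℝ} {u : ℝ → Tangent m → ℝ → ℝ}
  {ε s r : ℝ} {a a₁ a₂ a' : ℝ → ℝ → ℝ} {b b' : Tangent m → ℝ → ℝ}

lemma IsTangentTest.hasCompactSupport (hb : IsTangentTest s r b b') {τ : ℝ} (hτ : τ ∈ Icc s r) :
    HasCompactSupport (fun η => b η τ) := by
  obtain ⟨M, hM, hs⟩ := hb.support
  refine HasCompactSupport.intro (isCompact_closedBall 0 M) fun η hη => (hs τ hτ η ?_).1
  simpa using (not_le.1 fun h' => hη (by simpa using h')).le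

set_option maxHeartbeats 400000 in
/-- Green's identity for the heat operator, for a solution shifted into the interior. -/
theorem IsClassicalSolution.green_identity (hu : IsClassicalSolution F h u) (hε : 0 < ε)
    (hs : 0 < s) (hsr : s ≤ r) (ha : IsNormalTest s r a a₁ a₂ a') (hb : IsTangentTest s r b b') :
    ∫ p : ℝ × Tangent m, (a p.1 r * b p.2 r * u (p.1 + ε) p.2 r -
        a p.1 s * b p.2 s * u (p.1 + ε) p.2 s) ∂((volume.restrict (Ioi 0)).prod volume) =
      (∫ q, ((a' q.1 q.2.2 + a₂ q.1 q.2.2) * b q.2.1 q.2.2 +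
          a q.1 q.2.2 * (b' q.2.1 q.2.2 +
            Laplacian.laplacian (fun η : Tangent m => b η q.2.2) q.2.1)) *
          u (q.1 + ε) q.2.1 q.2.2 ∂(slab m s r)) +
        (∫ w : Tangent m × ℝ, a₁ 0 w.2 * b w.1 w.2 * u ε w.1 w.2
          ∂(volume.prod (volume.restrict (Ioc s r)))) -
        ∫ q, a q.1 q.2.2 * b q.2.1 q.2.2 * source F (boundaryFlux u) q.2.1 q.2.2 ∂(slab m s r) := by
  obtain ⟨N, hN, aN⟩ := ha.support
  obtain ⟨M, hM, bM⟩ := hb.support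
  set K : Set (ℝ × Tangent m × ℝ) := Icc 0 N ×ˢ (Metric.closedBall 0 M ×ˢ Icc s r) with hK
  -- continuity of the factors on `K`
  have mA : MapsTo (fun q : ℝ × Tangent m × ℝ => (q.1, q.2.2)) K (univ ×ˢ Icc s r) :=
    fun q hq => ⟨mem_univ _, hq.2.2⟩
  have cA : Continuous (fun q : ℝ × Tangent m × ℝ => (q.1, q.2.2)) := by fun_prop
  have mB : MapsTo (fun q : ℝ × Tangent m × ℝ => q.2) K (univ ×ˢ Icc s r) :=
    fun q hq => ⟨mem_univ _, hq.2.2⟩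
  have mU : MapsTo (fun q : ℝ × Tangent m × ℝ => (q.1 + ε, q.2)) K {q | 0 < q.1 ∧ 0 < q.2.2} :=
    fun q hq => ⟨by have := hq.1.1; simp only; linarith, hs.trans_le hq.2.2.1⟩
  have cU : Continuous (fun q : ℝ × Tangent m × ℝ => (q.1 + ε, q.2)) := by fun_prop
  have ka : ContinuousOn (fun q : ℝ × Tangent m × ℝ => a q.1 q.2.2) K :=
    ha.continuousOn.comp cA.continuousOn mA
  have ka₂ : ContinuousOn (fun q : ℝ × Tangent m × ℝ => a₂ q.1 q.2.2) K :=
    ha.continuousOn_deriv_deriv.comp cA.continuousOn mA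
  have ka' : ContinuousOn (fun q : ℝ × Tangent m × ℝ => a' q.1 q.2.2) K :=
    ha.continuousOn_time.comp cA.continuousOn mA
  have kb : ContinuousOn (fun q : ℝ × Tangent m × ℝ => b q.2.1 q.2.2) K :=
    hb.continuousOn.comp continuous_snd.continuousOn mB
  have kb' : ContinuousOn (fun q : ℝ × Tangent m × ℝ => b' q.2.1 q.2.2) K :=
    hb.continuousOn_time.comp continuous_snd.continuousOn mB
  have kbL : ContinuousOn (fun q : ℝ × Tangent m × ℝ =>
      Laplacian.laplacian (fun η : Tangent m => b η q.2.2) q.2.1) K := by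
    simpa only [Function.comp_def] using
      hb.continuousOn_laplacian.comp continuous_snd.continuousOn mB
  have ku : ContinuousOn (fun q : ℝ × Tangent m × ℝ => u (q.1 + ε) q.2.1 q.2.2) K :=
    hu.continuousOn.comp cU.continuousOn fun q hq => ⟨(mU hq).1.le, (mU hq).2⟩
  have kuxx : ContinuousOn (fun q : ℝ × Tangent m × ℝ =>
      iteratedDeriv 2 (fun x' => u x' q.2.1 q.2.2) (q.1 + ε)) K := by
    simpa only [Function.comp_def] using
      hu.continuousOn_iteratedDeriv_normal.comp cU.continuousOn mU
  have kuL : ContinuousOn (fun q : ℝ × Tangent m × ℝ =>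
      Laplacian.laplacian (fun y' : Tangent m => u (q.1 + ε) y' q.2.2) q.2.1) K := by
    simpa only [Function.comp_def] using hu.continuousOn_laplacian.comp cU.continuousOn mU
  have kf : ContinuousOn (fun q : ℝ × Tangent m × ℝ =>
      source F (boundaryFlux u) q.2.1 q.2.2) K :=
    hu.continuousOn_source.comp continuous_snd.continuousOn fun q hq => hs.trans_le hq.2.2.1
  -- integrability of the products
  have J1 : Integrable (fun q : ℝ × Tangent m × ℝ => ((a' q.1 q.2.2 * b q.2.1 q.2.2 +
      a q.1 q.2.2 * b' q.2.1 q.2.2) * u (q.1 + ε) q.2.1 q.2.2)) (slab m s r) := by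
    refine integrable_slab (((ka'.mul kb).add (ka.mul kb')).mul ku) ?_
    rintro ξ η τ hτ (h' | h')
    · simp [aN τ hτ ξ h']
    · simp [bM τ hτ η h']
  have J2 : Integrable (fun q : ℝ × Tangent m × ℝ => a q.1 q.2.2 * b q.2.1 q.2.2 *
      iteratedDeriv 2 (fun x' => u x' q.2.1 q.2.2) (q.1 + ε)) (slab m s r) := by
    refine integrable_slab ((ka.mul kb).mul kuxx) ?_
    rintro ξ η τ hτ (h' | h')
    · simp [aN τ hτ ξ h']
    · simp [bM τ hτ η h']
  have J3 : Integrable (fun q : ℝ × Tangent m × ℝ => a q.1 q.2.2 * b q.2.1 q.2.2 *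
      Laplacian.laplacian (fun y' : Tangent m => u (q.1 + ε) y' q.2.2) q.2.1) (slab m s r) := by
    refine integrable_slab ((ka.mul kb).mul kuL) ?_
    rintro ξ η τ hτ (h' | h')
    · simp [aN τ hτ ξ h']
    · simp [bM τ hτ η h']
  have J4 : Integrable (fun q : ℝ × Tangent m × ℝ => a q.1 q.2.2 * b q.2.1 q.2.2 *
      source F (boundaryFlux u) q.2.1 q.2.2) (slab m s r) := by
    refine integrable_slab ((ka.mul kb).mul kf) ?_
    rintro ξ η τ hτ (h' | h')
    · simp [aN τ hτ ξ h']
    · simp [bM τ hτ η h']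
  have J5 : Integrable (fun q : ℝ × Tangent m × ℝ => a₂ q.1 q.2.2 * b q.2.1 q.2.2 *
      u (q.1 + ε) q.2.1 q.2.2) (slab m s r) := by
    refine integrable_slab ((ka₂.mul kb).mul ku) ?_
    rintro ξ η τ hτ (h' | h')
    · simp [aN τ hτ ξ h']
    · simp [bM τ hτ η h']
  have J6 : Integrable (fun q : ℝ × Tangent m × ℝ => a q.1 q.2.2 *
      Laplacian.laplacian (fun η : Tangent m => b η q.2.2) q.2.1 *
      u (q.1 + ε) q.2.1 q.2.2) (slab m s r) := by
    refine integrable_slab ((ka.mul kbL).mul ku) ?_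
    rintro ξ η τ hτ (h' | h')
    · simp [aN τ hτ ξ h']
    · simp [bM τ hτ η h']
  -- With `(η, τ)` fixed, integrate by parts along the normal line; this is where the boundary term
  -- arises. The shift by `ε` supplies two-sided derivatives at `ξ = 0`.
  have normal : (∫ q : ℝ × Tangent m × ℝ, a q.1 q.2.2 * b q.2.1 q.2.2 *
      iteratedDeriv 2 (fun x' => u x' q.2.1 q.2.2) (q.1 + ε) ∂(slab m s r)) =
      (∫ q : ℝ × Tangent m × ℝ, a₂ q.1 q.2.2 * b q.2.1 q.2.2 *
        u (q.1 + ε) q.2.1 q.2.2 ∂(slab m s r)) +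
      ∫ w : Tangent m × ℝ, a₁ 0 w.2 * b w.1 w.2 * u ε w.1 w.2
          ∂(volume.prod (volume.restrict (Ioc s r))) := by
    rw [← sub_eq_iff_eq_add']
    unfold slab at J2 J5 ⊢
    rw [integral_prod_symm _ J2, integral_prod_symm _ J5,
      ← integral_sub J2.integral_prod_right J5.integral_prod_right]
    refine integral_congr_ae ?_
    have hτ : ∀ᵐ w : Tangent m × ℝ ∂(volume.prod (volume.restrict (Ioc s r))), w.2 ∈ Ioc s r :=
      Measure.quasiMeasurePreserving_snd.ae (ae_restrict_mem measurableSet_Ioc)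
    filter_upwards [hτ] with w hw
    have hw' : w.2 ∈ Icc s r := Ioc_subset_Icc_self hw
    have h2 : 0 < w.2 := hs.trans_le hw'.1
    have cw : ContinuousOn (fun ξ => iteratedDeriv 2 (fun x' => u x' w.1 w.2) (ξ + ε))
        (Icc 0 N) := by
      simpa only [Function.comp_def] using hu.continuousOn_iteratedDeriv_normal.comp
        (f := fun ξ : ℝ => (ξ + ε, w)) (by fun_prop)
        fun ξ hξ => ⟨by have := hξ.1; simp only; linarith, h2⟩
    have ibp := integral_Ioi_mul_deriv_deriv (a := fun ξ => a ξ w.2) (a₁ := fun ξ => a₁ ξ w.2)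
      (a₂ := fun ξ => a₂ ξ w.2) (v := fun ξ => u (ξ + ε) w.1 w.2)
      (v₁ := fun ξ => fderiv ℝ (fun p : ℝ × Tangent m => u p.1 p.2 w.2) (ξ + ε, w.1) (1, 0))
      (v₂ := fun ξ => iteratedDeriv 2 (fun x' => u x' w.1 w.2) (ξ + ε)) hN
      (fun ξ _ => ha.hasDerivAt _ hw' ξ) (fun ξ _ => ha.hasDerivAt_deriv _ hw' ξ)
      (fun ξ hξ => (hu.hasDerivAt_normal (x := ξ + ε) (by linarith [hξ.1]) w.1
        h2).comp_add_const ξ ε)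
      (fun ξ hξ => (hu.hasDerivAt_normal_normal (x := ξ + ε) (by linarith [hξ.1]) w.1
        h2).comp_add_const ξ ε)
      (ha.continuousOn_deriv_deriv.comp (f := fun ξ : ℝ => (ξ, w.2)) (by fun_prop)
        fun ξ _ => ⟨mem_univ _, hw'⟩)
      cw
      (ha.zero _ hw') (fun ξ hξ => (aN _ hw' ξ hξ).1) (aN _ hw' N le_rfl).2.1
      (fun ξ hξ => (aN _ hw' ξ hξ).2.2.1)
    have e1 : ∀ ξ, a ξ w.2 * b w.1 w.2 * iteratedDeriv 2 (fun x' => u x' w.1 w.2) (ξ + ε) =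
        b w.1 w.2 * (a ξ w.2 * iteratedDeriv 2 (fun x' => u x' w.1 w.2) (ξ + ε)) :=
      fun ξ => by ring
    have e2 : ∀ ξ, a₂ ξ w.2 * b w.1 w.2 * u (ξ + ε) w.1 w.2 =
        b w.1 w.2 * (a₂ ξ w.2 * u (ξ + ε) w.1 w.2) := fun ξ => by ring
    simp only [e1, e2, integral_const_mul, ibp, zero_add]
    ring
  -- With `(ξ, τ)` fixed, apply Green's second identity in `η`; the compact support of `b` excludes
  -- boundary terms.
  have tangential : (∫ q : ℝ × Tangent m × ℝ, a q.1 q.2.2 * b q.2.1 q.2.2 *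
      Laplacian.laplacian (fun y' : Tangent m => u (q.1 + ε) y' q.2.2) q.2.1 ∂(slab m s r)) =
      ∫ q : ℝ × Tangent m × ℝ, a q.1 q.2.2 *
      Laplacian.laplacian (fun η : Tangent m => b η q.2.2) q.2.1 *
      u (q.1 + ε) q.2.1 q.2.2 ∂(slab m s r) := by
    unfold slab at J3 J6 ⊢
    rw [integral_prod _ J3, integral_prod _ J6]
    refine integral_congr_ae ?_
    filter_upwards [J3.prod_right_ae, J6.prod_right_ae, ae_restrict_mem measurableSet_Ioi]
      with ξ i3 i6 hξ
    rw [integral_prod_symm _ i3, integral_prod_symm _ i6]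
    refine setIntegral_congr_fun measurableSet_Ioc fun τ hτ => ?_
    have hτ' : τ ∈ Icc s r := Ioc_subset_Icc_self hτ
    simp only [mul_assoc, integral_const_mul]
    congr 1
    exact integral_mul_laplacian (hb.contDiff τ hτ') (hb.hasCompactSupport hτ')
      (hu.contDiff_tangential (by have : 0 < ξ := hξ; linarith) (hs.trans_le hτ'.1))
  have time : ∫ p : ℝ × Tangent m, (a p.1 r * b p.2 r * u (p.1 + ε) p.2 r -
        a p.1 s * b p.2 s * u (p.1 + ε) p.2 s) ∂((volume.restrict (Ioi 0)).prod volume) =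
      ∫ q : ℝ × Tangent m × ℝ, ((a' q.1 q.2.2 * b q.2.1 q.2.2 + a q.1 q.2.2 * b' q.2.1 q.2.2) *
        u (q.1 + ε) q.2.1 q.2.2 + a q.1 q.2.2 * b q.2.1 q.2.2 *
          (iteratedDeriv 2 (fun x' => u x' q.2.1 q.2.2) (q.1 + ε) +
      Laplacian.laplacian (fun y' : Tangent m => u (q.1 + ε) y' q.2.2) q.2.1 -
        source F (boundaryFlux u) q.2.1 q.2.2)) ∂(slab m s r) := by
    have J : Integrable (fun q : ℝ × Tangent m × ℝ => ((a' q.1 q.2.2 * b q.2.1 q.2.2 +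
        a q.1 q.2.2 * b' q.2.1 q.2.2) * u (q.1 + ε) q.2.1 q.2.2 + a q.1 q.2.2 * b q.2.1 q.2.2 *
        (iteratedDeriv 2 (fun x' => u x' q.2.1 q.2.2) (q.1 + ε) +
        Laplacian.laplacian (fun y' : Tangent m => u (q.1 + ε) y' q.2.2) q.2.1 -
        source F (boundaryFlux u) q.2.1 q.2.2))) (slab m s r) := by
      refine (J1.add ((J2.add J3).sub J4)).congr (Eventually.of_forall fun q => ?_)
      simp only [Pi.add_apply, Pi.sub_apply]
      ring
    -- Regrouping the variables as `((ξ, η), τ)` makes `τ` the inner one, to which the fundamental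
    -- theorem of calculus applies.
    have mp := measurePreserving_prodAssoc (volume.restrict (Ioi (0 : ℝ)))
      (volume : Measure (Tangent m)) (volume.restrict (Ioc s r))
    have J' := mp.integrable_comp_of_integrable J
    simp only [Function.comp_def] at J'
    rw [slab, ← mp.integral_comp' (f := MeasurableEquiv.prodAssoc), integral_prod _ J']
    have h0 : ∀ᵐ p : ℝ × Tangent m ∂((volume.restrict (Ioi 0)).prod volume), p.1 ∈ Ioi (0 : ℝ) :=
      Measure.quasiMeasurePreserving_fst.ae (ae_restrict_mem measurableSet_Ioi)
    refine integral_congr_ae ?_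
    filter_upwards [h0, J'.prod_right_ae] with p hp hi
    have hp' : 0 < p.1 + ε := add_pos hp hε
    simp only [MeasurableEquiv.prodAssoc, MeasurableEquiv.coe_mk, Equiv.prodAssoc_apply] at hi ⊢
    rw [← intervalIntegral.integral_of_le hsr]
    rw [intervalIntegral.integral_eq_sub_of_hasDerivAt
      (f := fun τ => a p.1 τ * b p.2 τ * u (p.1 + ε) p.2 τ)]
    · intro τ hτ
      rw [uIcc_of_le hsr] at hτ
      refine (((ha.hasDerivAt_time τ hτ p.1).fun_mul (hb.hasDerivAt_time τ hτ p.2)).fun_mul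
        (hu.hasDerivAt_time hp' p.2 (hs.trans_le hτ.1)))
    · rw [intervalIntegrable_iff_integrableOn_Ioc_of_le hsr]
      exact hi
  rw [time]
  calc _ = (∫ q : ℝ × Tangent m × ℝ, (a' q.1 q.2.2 * b q.2.1 q.2.2 +
      a q.1 q.2.2 * b' q.2.1 q.2.2) * u (q.1 + ε) q.2.1 q.2.2 ∂(slab m s r)) +
      (((∫ q : ℝ × Tangent m × ℝ, a q.1 q.2.2 * b q.2.1 q.2.2 *
      iteratedDeriv 2 (fun x' => u x' q.2.1 q.2.2) (q.1 + ε) ∂(slab m s r)) +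
      ∫ q : ℝ × Tangent m × ℝ, a q.1 q.2.2 * b q.2.1 q.2.2 *
      Laplacian.laplacian (fun y' : Tangent m => u (q.1 + ε) y' q.2.2) q.2.1 ∂(slab m s r)) -
      ∫ q : ℝ × Tangent m × ℝ, a q.1 q.2.2 * b q.2.1 q.2.2 *
      source F (boundaryFlux u) q.2.1 q.2.2 ∂(slab m s r)) := by
        rw [← integral_add' J2 J3, ← integral_sub' (J2.add J3) J4,
          ← integral_add' J1 ((J2.add J3).sub J4)]
        refine integral_congr_ae (Eventually.of_forall fun q => ?_)
        simp only [Pi.add_apply, Pi.sub_apply]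
        ring
    _ = _ := by
        rw [normal, tangential]
        have : (∫ q, ((a' q.1 q.2.2 + a₂ q.1 q.2.2) * b q.2.1 q.2.2 +
          a q.1 q.2.2 * (b' q.2.1 q.2.2 +
            Laplacian.laplacian (fun η : Tangent m => b η q.2.2) q.2.1)) *
          u (q.1 + ε) q.2.1 q.2.2 ∂(slab m s r)) =
          (∫ q : ℝ × Tangent m × ℝ, (a' q.1 q.2.2 * b q.2.1 q.2.2 +
            a q.1 q.2.2 * b' q.2.1 q.2.2) * u (q.1 + ε) q.2.1 q.2.2 ∂(slab m s r)) +
          ((∫ q : ℝ × Tangent m × ℝ, a₂ q.1 q.2.2 * b q.2.1 q.2.2 *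
            u (q.1 + ε) q.2.1 q.2.2 ∂(slab m s r)) +
          ∫ q : ℝ × Tangent m × ℝ, a q.1 q.2.2 *
            Laplacian.laplacian (fun η : Tangent m => b η q.2.2) q.2.1 *
            u (q.1 + ε) q.2.1 q.2.2 ∂(slab m s r)) := by
          rw [← integral_add' J5 J6, ← integral_add' J1 (J5.add J6)]
          refine integral_congr_ae (Eventually.of_forall fun q => ?_)
          simp only [Pi.add_apply]
          ring
        rw [this]
        ring

end GreenIdentity

/-! ### Gaussian bounds for the kernels, and cutoff functions. -/

section Bounds

/-- The weight `1 + ρ` makes one estimate serve the kernel and its gradient. Half of the exponent at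
time `t` pays for the weight, through `ρ ≤ ρ² / (8t) + 2t`, which is `(ρ - 4t)² ≥ 0`. -/
lemma one_add_mul_exp_le {t σ ρ : ℝ} (ht : 0 < t) (hσ : 0 < σ) (hσt : σ ≤ t) (hρ : 0 ≤ ρ) :
    (1 + ρ) * Real.exp (-ρ ^ 2 / (4 * σ)) ≤ (2 + 2 * t) * Real.exp (-ρ ^ 2 / (8 * t)) := by
  have h1 : Real.exp (-ρ ^ 2 / (4 * σ)) ≤ Real.exp (-ρ ^ 2 / (4 * t)) := by
    apply Real.exp_le_exp.2
    rw [neg_div, neg_div, neg_le_neg_iff]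
    gcongr
  have h2 : Real.exp (-ρ ^ 2 / (4 * t)) =
      Real.exp (-(ρ ^ 2 / (8 * t))) * Real.exp (-ρ ^ 2 / (8 * t)) := by
    rw [← Real.exp_add]
    congr 1
    field_simp
    ring
  have h3 : ρ ≤ ρ ^ 2 / (8 * t) + 2 * t := by
    have : 0 ≤ (ρ - 4 * t) ^ 2 / (8 * t) := by positivity
    have e : (ρ - 4 * t) ^ 2 / (8 * t) = ρ ^ 2 / (8 * t) - ρ + 2 * t := by field_simp; ring
    linarith
  set w := ρ ^ 2 / (8 * t) with hw
  have hw0 : 0 ≤ w := by positivity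
  have h4 : 1 + ρ ≤ (2 + 2 * t) * Real.exp w := by
    have := Real.add_one_le_exp w
    nlinarith [mul_nonneg ht.le hw0]
  have h5 : (1 + ρ) * Real.exp (-w) ≤ 2 + 2 * t := by
    rw [Real.exp_neg, ← div_eq_mul_inv, div_le_iff₀ (Real.exp_pos _)]
    exact h4
  calc (1 + ρ) * Real.exp (-ρ ^ 2 / (4 * σ)) ≤ (1 + ρ) * Real.exp (-ρ ^ 2 / (4 * t)) := by gcongr
    _ = ((1 + ρ) * Real.exp (-w)) * Real.exp (-ρ ^ 2 / (8 * t)) := by rw [h2]; ring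
    _ ≤ _ := by gcongr

/-- Recentres the Gaussian at the origin by `‖η‖² ≤ 2‖y‖² + 2‖y - η‖²`, at the cost of halving the
rate of decay. -/
lemma exp_neg_sq_sub_le {E : Type*} [NormedAddCommGroup E] (y η : E) {t : ℝ} (ht : 0 < t) :
    Real.exp (-‖y - η‖ ^ 2 / (8 * t)) ≤
      Real.exp (‖y‖ ^ 2 / (8 * t)) * Real.exp (-(1 / (16 * t)) * ‖η‖ ^ 2) := by
  rw [← Real.exp_add]
  apply Real.exp_le_exp.2
  have h1 : ‖η‖ ≤ ‖y‖ + ‖y - η‖ := by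
    have := norm_sub_le y (y - η)
    simpa using this
  have h2 : ‖η‖ ^ 2 ≤ 2 * ‖y‖ ^ 2 + 2 * ‖y - η‖ ^ 2 := by
    have h3 : ‖η‖ ^ 2 ≤ (‖y‖ + ‖y - η‖) ^ 2 := by gcongr
    nlinarith [sq_nonneg (‖y‖ - ‖y - η‖)]
  have e : ‖y‖ ^ 2 / (8 * t) + -(1 / (16 * t)) * ‖η‖ ^ 2 - -‖y - η‖ ^ 2 / (8 * t) =
      (2 * ‖y‖ ^ 2 + 2 * ‖y - η‖ ^ 2 - ‖η‖ ^ 2) / (16 * t) := by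
    field_simp
    ring
  have : 0 ≤ (2 * ‖y‖ ^ 2 + 2 * ‖y - η‖ ^ 2 - ‖η‖ ^ 2) / (16 * t) :=
    div_nonneg (by linarith) (by positivity)
  linarith

lemma two_mul_sqrt_pi_mul_pos {σ : ℝ} (hσ : 0 < σ) : 0 < 2 * √(Real.pi * σ) := by
  have := Real.pi_pos
  positivity

lemma lineKernel_nonneg (z σ : ℝ) : 0 ≤ lineKernel z σ := by unfold lineKernel; positivity

lemma tangentKernel_nonneg {m : ℕ} (z : Tangent m) (σ : ℝ) : 0 ≤ tangentKernel z σ := by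
  unfold tangentKernel; positivity

/-- A common Gaussian bound for the heat kernel and its gradient, at times bounded away
from `0`, uniformly for bounded `y`. -/
lemma exists_tangentKernel_bound (m : ℕ) {t δ : ℝ} (ht : 0 < t) (hδ : 0 < δ) (R : ℝ) :
    ∃ C : ℝ, 0 ≤ C ∧ ∀ σ ∈ Icc δ t, ∀ y : Tangent m, ‖y‖ ≤ R → ∀ η : Tangent m,
      tangentKernel (y - η) σ ≤ C * Real.exp (-(1 / (16 * t)) * ‖η‖ ^ 2) ∧
      ‖y - η‖ / (2 * σ) * tangentKernel (y - η) σ ≤ C * Real.exp (-(1 / (16 * t)) * ‖η‖ ^ 2) := by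
  have hS := two_mul_sqrt_pi_mul_pos hδ
  set Y := Real.exp (R ^ 2 / (8 * t))
  set P := (2 + 2 * t) * Y / (2 * √(Real.pi * δ)) ^ m with hP
  have hP0 : 0 ≤ P := by positivity
  refine ⟨(1 + 1 / (2 * δ)) * P, by positivity, fun σ hσ y hy η => ?_⟩
  have hσ0 : 0 < σ := hδ.trans_le hσ.1
  have hY : Real.exp (‖y‖ ^ 2 / (8 * t)) ≤ Y := by
    have := norm_nonneg y
    apply Real.exp_le_exp.2
    gcongr
  have key : (1 + ‖y - η‖) * tangentKernel (y - η) σ ≤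
      P * Real.exp (-(1 / (16 * t)) * ‖η‖ ^ 2) := by
    unfold tangentKernel
    rw [← mul_div_assoc]
    have h1 := one_add_mul_exp_le ht hσ0 hσ.2 (norm_nonneg (y - η))
    have h2 := (exp_neg_sq_sub_le y η ht).trans
      (mul_le_mul_of_nonneg_right hY (Real.exp_pos _).le)
    have h3 : (2 * √(Real.pi * δ)) ^ m ≤ (2 * √(Real.pi * σ)) ^ m := by
      have := Real.pi_pos.le
      gcongr
      exact hσ.1
    calc _ ≤ ((2 + 2 * t) * (Y * Real.exp (-(1 / (16 * t)) * ‖η‖ ^ 2))) /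
          (2 * √(Real.pi * δ)) ^ m := by
          refine div_le_div₀ (by positivity) ?_ (by positivity) h3
          exact h1.trans (mul_le_mul_of_nonneg_left h2 (by positivity))
      _ = _ := by rw [hP]; ring
  have hk := tangentKernel_nonneg (y - η) σ
  set X := P * Real.exp (-(1 / (16 * t)) * ‖η‖ ^ 2)
  have hX : 0 ≤ X := by positivity
  have k1 : tangentKernel (y - η) σ ≤ X := by nlinarith [mul_nonneg (norm_nonneg (y - η)) hk]
  have k2 : ‖y - η‖ * tangentKernel (y - η) σ ≤ X := by nlinarith
  have hd : 0 ≤ 1 / (2 * δ) := by positivity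
  constructor
  · calc _ ≤ X := k1
      _ ≤ X + 1 / (2 * δ) * X := by nlinarith [mul_nonneg hd hX]
      _ = _ := by ring
  · calc _ = 1 / (2 * σ) * (‖y - η‖ * tangentKernel (y - η) σ) := by ring
      _ ≤ 1 / (2 * δ) * X := by
        have := hσ.1
        gcongr
      _ ≤ X + 1 / (2 * δ) * X := by linarith
      _ = _ := by ring

/-- The derivative of `greenLine` in `ξ`. -/
def greenLineDeriv (x t ξ τ : ℝ) : ℝ :=
  (x - ξ) / (2 * (t - τ)) * lineKernel (x - ξ) (t - τ) +
    (x + ξ) / (2 * (t - τ)) * lineKernel (x + ξ) (t - τ)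

/-- The second derivative of `greenLine` in `ξ`. -/
def greenLineDerivDeriv (x t ξ τ : ℝ) : ℝ :=
  ((x - ξ) ^ 2 / (4 * (t - τ) ^ 2) - 1 / (2 * (t - τ))) * lineKernel (x - ξ) (t - τ) -
    ((x + ξ) ^ 2 / (4 * (t - τ) ^ 2) - 1 / (2 * (t - τ))) * lineKernel (x + ξ) (t - τ)

lemma hasDerivAt_greenLine (x t ξ τ : ℝ) :
    HasDerivAt (fun ξ => greenLine x t ξ τ) (greenLineDeriv x t ξ τ) ξ := by
  simp_rw [greenLine_eq]
  refine (((hasDerivAt_lineKernel (x - ξ) (t - τ)).comp_const_sub x ξ).fun_sub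
    ((hasDerivAt_lineKernel (x + ξ) (t - τ)).comp_const_add x ξ)).congr_deriv ?_
  unfold greenLineDeriv
  ring

lemma hasDerivAt_greenLineDeriv (x t ξ τ : ℝ) :
    HasDerivAt (fun ξ => greenLineDeriv x t ξ τ) (greenLineDerivDeriv x t ξ τ) ξ := by
  unfold greenLineDeriv
  have := (((hasDerivAt_deriv_lineKernel (x - ξ) (t - τ)).comp_const_sub x ξ).fun_neg.fun_sub
    ((hasDerivAt_deriv_lineKernel (x + ξ) (t - τ)).comp_const_add x ξ))
  simp only [neg_mul, neg_neg, sub_neg_eq_add] at this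
  exact this

/-- The kernel depends on `τ` through `t - τ`, whence the minus sign: in the source variables the
heat equation runs backwards. -/
lemma hasDerivAt_greenLine_time (x ξ : ℝ) {t τ : ℝ} (hτ : τ < t) :
    HasDerivAt (fun τ => greenLine x t ξ τ) (-greenLineDerivDeriv x t ξ τ) τ := by
  simp_rw [greenLine_eq]
  refine (((hasDerivAt_lineKernel_time (x - ξ) (sub_pos.2 hτ)).comp_const_sub t τ).fun_sub
    ((hasDerivAt_lineKernel_time (x + ξ) (sub_pos.2 hτ)).comp_const_sub t τ)).congr_deriv ?_
  unfold greenLineDerivDeriv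
  ring

/-- This is the tangential bound for `m = 1`, with the line embedded as `EuclideanSpace ℝ (Fin 1)`.
-/
lemma exists_lineKernel_bound {t δ : ℝ} (ht : 0 < t) (hδ : 0 < δ) (R : ℝ) :
    ∃ C : ℝ, 0 ≤ C ∧ ∀ σ ∈ Icc δ t, ∀ x : ℝ, |x| ≤ R → ∀ ξ : ℝ,
      lineKernel (x - ξ) σ ≤ C * Real.exp (-(1 / (16 * t)) * ξ ^ 2) ∧
      |x - ξ| / (2 * σ) * lineKernel (x - ξ) σ ≤ C * Real.exp (-(1 / (16 * t)) * ξ ^ 2) := by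
  obtain ⟨C, hC, hb⟩ := exists_tangentKernel_bound 1 ht hδ R
  refine ⟨C, hC, fun σ hσ x hx ξ => ?_⟩
  have h1 := hb σ hσ (EuclideanSpace.single (0 : Fin 1) x) (by simpa using hx)
    (EuclideanSpace.single (0 : Fin 1) ξ)
  have e1 : ‖EuclideanSpace.single (0 : Fin 1) x - EuclideanSpace.single (0 : Fin 1) ξ‖ =
      |x - ξ| := by
    simp [EuclideanSpace.norm_eq, Real.sqrt_sq_eq_abs]
  have e2 : ‖EuclideanSpace.single (0 : Fin 1) ξ‖ = |ξ| := by
    simp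
  simp only [tangentKernel, e1, e2, sq_abs, pow_one] at h1
  simpa only [lineKernel] using h1

lemma exists_greenLine_bound {t r : ℝ} (hr : r < t) (ht : 0 < t) (x : ℝ) :
    ∃ C : ℝ, 0 ≤ C ∧ ∀ τ ∈ Icc 0 r, ∀ ξ : ℝ,
      |greenLine x t ξ τ| ≤ C * Real.exp (-(1 / (16 * t)) * ξ ^ 2) ∧
      |greenLineDeriv x t ξ τ| ≤ C * Real.exp (-(1 / (16 * t)) * ξ ^ 2) := by
  obtain ⟨C, hC, hb⟩ := exists_lineKernel_bound ht (sub_pos.2 hr) |x|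
  refine ⟨2 * C, by positivity, fun τ hτ ξ => ?_⟩
  have hσ : t - τ ∈ Icc (t - r) t := ⟨by linarith [hτ.2], by linarith [hτ.1]⟩
  have hσ0 : 0 < t - τ := (sub_pos.2 hr).trans_le hσ.1
  have h1 := hb _ hσ x le_rfl ξ
  have h2 := hb _ hσ x le_rfl (-ξ)
  simp only [sub_neg_eq_add, even_two, Even.neg_pow] at h2
  constructor
  · rw [greenLine_eq]
    refine (abs_sub _ _).trans ?_
    rw [abs_of_nonneg (lineKernel_nonneg _ _), abs_of_nonneg (lineKernel_nonneg _ _)]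
    linarith [h1.1, h2.1]
  · unfold greenLineDeriv
    refine (abs_add_le _ _).trans ?_
    rw [abs_mul, abs_mul, abs_div, abs_div, abs_of_nonneg (lineKernel_nonneg _ _),
      abs_of_nonneg (lineKernel_nonneg _ _), abs_of_pos (by positivity : 0 < 2 * (t - τ))]
    linarith [h1.2, h2.2]

/-- Rescale one bump: `θ n z = θ (z / (n + 1))` with `θ 0 = 1`. Each derivative brings a factor `1 /
(n + 1)`; for the second derivative one of the two factors is simply bounded by `1`. -/
lemma exists_cutoff (E : Type*) [NormedAddCommGroup E] [NormedSpace ℝ E] [FiniteDimensional ℝ E] :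
    ∃ (θ : ℕ → E → ℝ) (C : ℝ), 0 ≤ C ∧ (∀ n, ContDiff ℝ 2 (θ n)) ∧ (∀ n, HasCompactSupport (θ n)) ∧
      (∀ n z, |θ n z| ≤ 1) ∧ (∀ z, Tendsto (fun n => θ n z) atTop (𝓝 1)) ∧
      (∀ n z w, ‖w‖ ≤ 1 → |fderiv ℝ (θ n) z w| ≤ C / (n + 1)) ∧
      ∀ n z w, ‖w‖ ≤ 1 → |fderiv ℝ (fun z => fderiv ℝ (θ n) z w) z w| ≤ C / (n + 1) := by
  obtain ⟨θ, -, hc, hd, hr, h0⟩ := exists_contDiff_tsupport_subset (E := E) (n := 2)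
    (univ_mem : (univ : Set E) ∈ 𝓝 0)
  replace hd : ContDiff ℝ 2 θ := by exact_mod_cast hd
  have d0 : Differentiable ℝ θ := hd.differentiable (by norm_num)
  have cd1 : ContDiff ℝ 1 (fderiv ℝ θ) := hd.fderiv_right (by norm_num)
  obtain ⟨C₁, hC₁⟩ : ∃ C, ∀ z, ‖fderiv ℝ θ z‖ ≤ C :=
    (hc.fderiv ℝ).exists_bound_of_continuous cd1.continuous
  obtain ⟨C₂, hC₂⟩ : ∃ C, ∀ z, ‖iteratedFDeriv ℝ 2 θ z‖ ≤ C :=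
    (hc.iteratedFDeriv 2).exists_bound_of_continuous (hd.continuous_iteratedFDeriv le_rfl)
  have hC₁0 : 0 ≤ C₁ := (norm_nonneg _).trans (hC₁ 0)
  have hC₂0 : 0 ≤ C₂ := (norm_nonneg _).trans (hC₂ 0)
  obtain ⟨c, hcdef⟩ : ∃ c : ℕ → ℝ, ∀ n, c n = 1 / ((n : ℝ) + 1) := ⟨_, fun n => rfl⟩
  have hc0 : ∀ n, 0 < c n := fun n => by rw [hcdef]; positivity
  have hc1 : ∀ n, c n ≤ 1 := fun n => by
    rw [hcdef, div_le_one (by positivity)]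
    linarith [n.cast_nonneg (α := ℝ)]
  have hct : Tendsto c atTop (𝓝 0) := by
    simpa only [← hcdef] using tendsto_one_div_add_atTop_nhds_zero_nat (𝕜 := ℝ)
  have f1 : ∀ n z, HasFDerivAt (fun z => θ (c n • z)) (c n • fderiv ℝ θ (c n • z)) z := by
    intro n z
    have h1 : HasFDerivAt (fun z : E => c n • z) (c n • ContinuousLinearMap.id ℝ E) z :=
      (hasFDerivAt_id z).const_smul (c n)
    refine ((d0 (c n • z)).hasFDerivAt.comp z h1).congr_fderiv ?_
    ext w; simp
  have f2 : ∀ n z w, HasFDerivAt (fun z => c n * fderiv ℝ θ (c n • z) w)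
      (c n • c n • fderiv ℝ (fun z => fderiv ℝ θ z w) (c n • z)) z := by
    intro n z w
    have h1 : HasFDerivAt (fun z : E => c n • z) (c n • ContinuousLinearMap.id ℝ E) z :=
      (hasFDerivAt_id z).const_smul (c n)
    have h2 := (differentiableAt_fderiv_apply (hd.contDiffAt (x := c n • z)) w).hasFDerivAt
    refine ((h2.comp z h1).const_mul (c n)).congr_fderiv ?_
    ext v; simp
  refine ⟨fun n z => θ (c n • z), C₁ + C₂, by positivity, fun n => ?_, fun n => ?_, fun n z => ?_,
    fun z => ?_, fun n z w hw => ?_, fun n z w hw => ?_⟩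
  · exact hd.comp (contDiff_const_smul (c n))
  · exact hc.comp_smul (hc0 n).ne'
  · have := hr (mem_range_self (c n • z))
    rw [abs_of_nonneg this.1]
    exact this.2
  · have h1 : Tendsto (fun n => c n • z) atTop (𝓝 ((0 : ℝ) • z)) :=
      hct.smul_const z
    rw [zero_smul] at h1
    have := (hd.continuous.tendsto 0).comp h1
    rwa [h0] at this
  · rw [(f1 n z).fderiv]
    simp only [smul_apply, smul_eq_mul, abs_mul, abs_of_pos (hc0 n)]
    have h1 : |fderiv ℝ θ (c n • z) w| ≤ C₁ + C₂ := by
      calc |fderiv ℝ θ (c n • z) w| ≤ ‖fderiv ℝ θ (c n • z)‖ * ‖w‖ :=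
            (fderiv ℝ θ (c n • z)).le_opNorm w
        _ ≤ C₁ * 1 := by gcongr; exact hC₁ _
        _ ≤ _ := by linarith
    calc _ ≤ c n * (C₁ + C₂) := by gcongr; exact (hc0 n).le
      _ = _ := by simp only [hcdef]; ring
  · have e : (fun z => fderiv ℝ (fun z => θ (c n • z)) z w) =
        fun z => c n * fderiv ℝ θ (c n • z) w := by
      ext z
      rw [(f1 n z).fderiv]
      simp
    rw [e, (f2 n z w).fderiv]
    simp only [smul_apply, smul_eq_mul, abs_mul, abs_of_pos (hc0 n)]
    have h1 : |fderiv ℝ (fun z => fderiv ℝ θ z w) (c n • z) w| ≤ C₁ + C₂ := by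
      rw [← iteratedFDeriv_two_eq_fderiv_fderiv hd.contDiffAt]
      calc _ ≤ ‖iteratedFDeriv ℝ 2 θ (c n • z)‖ * ∏ i, ‖(![w, w] : Fin 2 → E) i‖ :=
            (iteratedFDeriv ℝ 2 θ (c n • z)).le_opNorm _
        _ = ‖iteratedFDeriv ℝ 2 θ (c n • z)‖ * (‖w‖ * ‖w‖) := by simp [Fin.prod_univ_two]
        _ ≤ C₂ * (1 * 1) := by gcongr; exact hC₂ _
        _ ≤ _ := by linarith
    calc c n * (c n * _) ≤ 1 * (c n * (C₁ + C₂)) := by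
          have := hc1 n
          have := (hc0 n).le
          gcongr
      _ = _ := by simp only [hcdef]; ring

end Bounds

/-! ### Truncated kernels as test functions. -/

section TestFunctions

lemma continuousOn_lineKernel :
    ContinuousOn (fun w : ℝ × ℝ => lineKernel w.1 w.2) {w | 0 < w.2} := by
  unfold lineKernel
  refine ContinuousOn.div ?_ (by fun_prop) fun w hw => (two_mul_sqrt_pi_mul_pos hw).ne'
  refine Real.continuous_exp.comp_continuousOn (ContinuousOn.div (by fun_prop) (by fun_prop) ?_)
  intro w hw
  have : 0 < w.2 := hw
  positivity

lemma continuousOn_tangentKernel {m : ℕ} :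
    ContinuousOn (fun w : Tangent m × ℝ => tangentKernel w.1 w.2) {w | 0 < w.2} := by
  unfold tangentKernel
  refine ContinuousOn.div ?_ (by fun_prop) fun w hw => (pow_pos (two_mul_sqrt_pi_mul_pos hw) m).ne'
  refine Real.continuous_exp.comp_continuousOn (ContinuousOn.div (by fun_prop) (by fun_prop) ?_)
  intro w hw
  have : 0 < w.2 := hw
  positivity

lemma continuousOn_lineKernel_sub (x t : ℝ) :
    ContinuousOn (fun w : ℝ × ℝ => lineKernel (x - w.1) (t - w.2)) {w | w.2 < t} :=
  continuousOn_lineKernel.comp (f := fun w : ℝ × ℝ => (x - w.1, t - w.2)) (by fun_prop)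
    fun w (hw : w.2 < t) => show 0 < t - w.2 from sub_pos.2 hw

lemma continuousOn_lineKernel_add (x t : ℝ) :
    ContinuousOn (fun w : ℝ × ℝ => lineKernel (x + w.1) (t - w.2)) {w | w.2 < t} :=
  continuousOn_lineKernel.comp (f := fun w : ℝ × ℝ => (x + w.1, t - w.2)) (by fun_prop)
    fun w (hw : w.2 < t) => show 0 < t - w.2 from sub_pos.2 hw

lemma continuousOn_greenLine (x t : ℝ) :
    ContinuousOn (fun w : ℝ × ℝ => greenLine x t w.1 w.2) {w | w.2 < t} := by
  simp_rw [greenLine_eq]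
  exact (continuousOn_lineKernel_sub x t).sub (continuousOn_lineKernel_add x t)

lemma continuousOn_greenLineDeriv (x t : ℝ) :
    ContinuousOn (fun w : ℝ × ℝ => greenLineDeriv x t w.1 w.2) {w | w.2 < t} := by
  unfold greenLineDeriv
  have h0 : ∀ w : ℝ × ℝ, w ∈ {w : ℝ × ℝ | w.2 < t} → 2 * (t - w.2) ≠ 0 := fun w hw => by
    have : 0 < t - w.2 := sub_pos.2 hw
    positivity
  exact ((ContinuousOn.div (by fun_prop) (by fun_prop) h0).mul
    (continuousOn_lineKernel_sub x t)).add ((ContinuousOn.div (by fun_prop) (by fun_prop) h0).mul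
    (continuousOn_lineKernel_add x t))

lemma continuousOn_greenLineDerivDeriv (x t : ℝ) :
    ContinuousOn (fun w : ℝ × ℝ => greenLineDerivDeriv x t w.1 w.2) {w | w.2 < t} := by
  unfold greenLineDerivDeriv
  have h0 : ∀ w : ℝ × ℝ, w ∈ {w : ℝ × ℝ | w.2 < t} → 2 * (t - w.2) ≠ 0 := fun w hw => by
    have : 0 < t - w.2 := sub_pos.2 hw
    positivity
  have h1 : ∀ w : ℝ × ℝ, w ∈ {w : ℝ × ℝ | w.2 < t} → 4 * (t - w.2) ^ 2 ≠ 0 := fun w hw => by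
    have : 0 < t - w.2 := sub_pos.2 hw
    positivity
  exact (((ContinuousOn.div (by fun_prop) (by fun_prop) h1).sub
    (ContinuousOn.div (by fun_prop) (by fun_prop) h0)).mul (continuousOn_lineKernel_sub x t)).sub
    (((ContinuousOn.div (by fun_prop) (by fun_prop) h1).sub
    (ContinuousOn.div (by fun_prop) (by fun_prop) h0)).mul (continuousOn_lineKernel_add x t))

lemma continuousOn_tangentKernel_sub {m : ℕ} (y : Tangent m) (t : ℝ) :
    ContinuousOn (fun w : Tangent m × ℝ => tangentKernel (y - w.1) (t - w.2)) {w | w.2 < t} :=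
  continuousOn_tangentKernel.comp (f := fun w : Tangent m × ℝ => (y - w.1, t - w.2)) (by fun_prop)
    fun w (hw : w.2 < t) => show 0 < t - w.2 from sub_pos.2 hw

lemma greenLine_zero_right (x t τ : ℝ) : greenLine x t 0 τ = 0 := by simp [greenLine]

/-- Vanishing on a neighbourhood, and not only at the point, makes all derivatives vanish as well.
-/
lemma exists_eventuallyEq_zero {E : Type*} [NormedAddCommGroup E] {f : E → ℝ}
    (hf : HasCompactSupport f) : ∃ M ≥ 0, ∀ z, M ≤ ‖z‖ → f =ᶠ[𝓝 z] 0 := by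
  obtain ⟨M, hM⟩ := hf.isCompact.isBounded.subset_closedBall 0
  -- The added `1` keeps `z` strictly outside the ball that contains the support.
  refine ⟨|M| + 1, by positivity, fun z hz => ?_⟩
  rw [← notMem_tsupport_iff_eventuallyEq]
  intro hz'
  have := hM hz'
  rw [mem_closedBall_zero_iff] at this
  linarith [le_abs_self M]

/-- In the sum of the time derivative and the second derivative the terms with `greenLineDerivDeriv`
cancel; each remaining term carries a derivative of the cutoff. -/
lemma isNormalTest_greenLine {s r t : ℝ} (hr : r < t) (x : ℝ) {ψ : ℝ → ℝ} (hψ : ContDiff ℝ 2 ψ)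
    (hc : HasCompactSupport ψ) :
    IsNormalTest s r (fun ξ τ => greenLine x t ξ τ * ψ ξ)
      (fun ξ τ => greenLineDeriv x t ξ τ * ψ ξ + greenLine x t ξ τ * deriv ψ ξ)
      (fun ξ τ => greenLineDerivDeriv x t ξ τ * ψ ξ + 2 * (greenLineDeriv x t ξ τ * deriv ψ ξ) +
        greenLine x t ξ τ * deriv (deriv ψ) ξ)
      (fun ξ τ => -greenLineDerivDeriv x t ξ τ * ψ ξ) := by
  have hψ' : ContDiff ℝ 1 (deriv ψ) := ((contDiff_succ_iff_deriv (n := 1)).1 hψ).2.2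
  have d0 : ∀ ξ, HasDerivAt ψ (deriv ψ ξ) ξ := fun ξ =>
    (hψ.differentiable (by norm_num) ξ).hasDerivAt
  have d1 : ∀ ξ, HasDerivAt (deriv ψ) (deriv (deriv ψ) ξ) ξ := fun ξ =>
    (hψ'.differentiable (by norm_num) ξ).hasDerivAt
  have c2 : Continuous (deriv (deriv ψ)) := hψ'.continuous_deriv le_rfl
  have sub : (univ ×ˢ Icc s r : Set (ℝ × ℝ)) ⊆ {w | w.2 < t} := fun w hw => hw.2.2.trans_lt hr
  have k0 := (continuousOn_greenLine x t).mono sub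
  have k1 := (continuousOn_greenLineDeriv x t).mono sub
  have k2 := (continuousOn_greenLineDerivDeriv x t).mono sub
  have p0 : ContinuousOn (fun w : ℝ × ℝ => ψ w.1) (univ ×ˢ Icc s r) :=
    (hψ.continuous.comp continuous_fst).continuousOn
  have p1 : ContinuousOn (fun w : ℝ × ℝ => deriv ψ w.1) (univ ×ˢ Icc s r) :=
    (hψ'.continuous.comp continuous_fst).continuousOn
  have p2 : ContinuousOn (fun w : ℝ × ℝ => deriv (deriv ψ) w.1) (univ ×ˢ Icc s r) :=
    (c2.comp continuous_fst).continuousOn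
  refine ⟨fun τ _ ξ => (hasDerivAt_greenLine x t ξ τ).fun_mul (d0 ξ), fun τ _ ξ => ?_,
    fun τ hτ ξ => (hasDerivAt_greenLine_time x ξ (hτ.2.trans_lt hr)).mul_const _, k0.mul p0,
    (k1.mul p0).add (k0.mul p1), ((k2.mul p0).add (continuousOn_const.mul (k1.mul p1))).add
    (k0.mul p2), k2.neg.mul p0, fun τ _ => by simp [greenLine_zero_right], ?_⟩
  · refine (((hasDerivAt_greenLineDeriv x t ξ τ).fun_mul (d0 ξ)).fun_add
      ((hasDerivAt_greenLine x t ξ τ).fun_mul (d1 ξ))).congr_deriv ?_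
    ring
  · obtain ⟨N, hN, h0⟩ := exists_eventuallyEq_zero hc
    refine ⟨N, hN, fun τ _ ξ hξ => ?_⟩
    have e := h0 ξ (hξ.le.trans (le_abs_self ξ))
    have e0 : ψ ξ = 0 := e.eq_of_nhds
    have e1 : deriv ψ =ᶠ[𝓝 ξ] 0 := by simpa using e.deriv
    have e3 : deriv ψ ξ = 0 := e1.eq_of_nhds
    have e2 : deriv (deriv ψ) ξ = 0 := by simpa using e1.deriv_eq
    simp [e0, e3, e2]

/-- The result of applying `∂_τ + Δ` to the tangential heat kernel times a cutoff. -/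
def tangentResidual {m : ℕ} (θ : Tangent m → ℝ) (z : Tangent m) (σ : ℝ) (η : Tangent m) : ℝ :=
  2 * ∑ i, tangentKernel z σ / (2 * σ) * inner ℝ z (EuclideanSpace.basisFun (Fin m) ℝ i) *
    fderiv ℝ θ η (EuclideanSpace.basisFun (Fin m) ℝ i) +
    tangentKernel z σ * Laplacian.laplacian θ η

/-- The first summand is what the time derivative cancels, so the backward heat operator leaves only
`tangentResidual`, in which `θ` is always differentiated. -/
lemma laplacian_tangentKernel_mul {m : ℕ} {θ : Tangent m → ℝ} (hθ : ContDiff ℝ 2 θ)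
    (y η : Tangent m) {σ : ℝ} (hσ : 0 < σ) :
    Laplacian.laplacian (fun η : Tangent m => tangentKernel (y - η) σ * θ η) η =
      (‖y - η‖ ^ 2 / (4 * σ ^ 2) - m / (2 * σ)) * tangentKernel (y - η) σ * θ η +
        tangentResidual θ (y - η) σ η := by
  rw [laplacian_mul (EuclideanSpace.basisFun (Fin m) ℝ) (contDiff_tangentKernel y σ) hθ,
    laplacian_tangentKernel y η hσ, tangentResidual]
  simp_rw [fderiv_tangentKernel]
  ring

lemma continuous_laplacian {m : ℕ} {θ : Tangent m → ℝ} (hθ : ContDiff ℝ 2 θ) :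
    Continuous (fun η : Tangent m => Laplacian.laplacian θ η) := by
  simp_rw [laplacian_eq_sum_fderiv (EuclideanSpace.basisFun (Fin m) ℝ) hθ.contDiffAt]
  exact continuous_finsetSum _ fun i _ => continuous_fderiv_fderiv hθ _

lemma isTangentTest_tangentKernel {m : ℕ} {s r t : ℝ} (hr : r < t) (y : Tangent m)
    {θ : Tangent m → ℝ} (hθ : ContDiff ℝ 2 θ) (hc : HasCompactSupport θ) :
    IsTangentTest s r (fun η τ => tangentKernel (y - η) (t - τ) * θ η)
      (fun η τ => -((‖y - η‖ ^ 2 / (4 * (t - τ) ^ 2) - m / (2 * (t - τ))) *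
        tangentKernel (y - η) (t - τ)) * θ η) := by
  have sub : (univ ×ˢ Icc s r : Set (Tangent m × ℝ)) ⊆ {w | w.2 < t} :=
    fun w hw => hw.2.2.trans_lt hr
  have k0 := (continuousOn_tangentKernel_sub y t).mono sub
  have n0 : ∀ w ∈ (univ ×ˢ Icc s r : Set (Tangent m × ℝ)), 2 * (t - w.2) ≠ 0 := fun w hw => by
    have : 0 < t - w.2 := sub_pos.2 (sub hw)
    positivity
  have n1 : ∀ w ∈ (univ ×ˢ Icc s r : Set (Tangent m × ℝ)), 4 * (t - w.2) ^ 2 ≠ 0 := fun w hw => by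
    have : 0 < t - w.2 := sub_pos.2 (sub hw)
    positivity
  have p0 : ContinuousOn (fun w : Tangent m × ℝ => θ w.1) (univ ×ˢ Icc s r) :=
    (hθ.continuous.comp continuous_fst).continuousOn
  have p2 : ContinuousOn (fun w : Tangent m × ℝ => Laplacian.laplacian θ w.1) (univ ×ˢ Icc s r) :=
    ((continuous_laplacian hθ).comp continuous_fst).continuousOn
  have kt : ContinuousOn (fun w : Tangent m × ℝ =>
      (‖y - w.1‖ ^ 2 / (4 * (t - w.2) ^ 2) - m / (2 * (t - w.2))) *
        tangentKernel (y - w.1) (t - w.2)) (univ ×ˢ Icc s r) :=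
    ((ContinuousOn.div (by fun_prop) (by fun_prop) n1).sub
      (ContinuousOn.div (by fun_prop) (by fun_prop) n0)).mul k0
  refine ⟨fun τ _ => (contDiff_tangentKernel y _).mul hθ, fun τ hτ η => ?_, k0.mul p0, ?_,
    kt.neg.mul p0, ?_⟩
  · refine (((hasDerivAt_tangentKernel_time (y - η)
      (sub_pos.2 (hτ.2.trans_lt hr))).comp_const_sub t τ).mul_const _)
  · have h1 : ContinuousOn (fun w : Tangent m × ℝ =>
        (‖y - w.1‖ ^ 2 / (4 * (t - w.2) ^ 2) - m / (2 * (t - w.2))) *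
          tangentKernel (y - w.1) (t - w.2) * θ w.1 + tangentResidual θ (y - w.1) (t - w.2) w.1)
        (univ ×ˢ Icc s r) := by
      unfold tangentResidual
      refine (kt.mul p0).add (ContinuousOn.add (continuousOn_const.mul
        (continuousOn_finsetSum _ fun i _ => ?_)) (k0.mul p2))
      exact ((k0.div (by fun_prop) n0).mul (by fun_prop)).mul
        ((continuous_fderiv_apply hθ _).comp continuous_fst).continuousOn
    exact h1.congr fun w hw => laplacian_tangentKernel_mul hθ y w.1 (sub_pos.2 (sub hw))
  · obtain ⟨M, hM, h0⟩ := exists_eventuallyEq_zero hc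
    refine ⟨M, hM, fun τ _ η hη => ?_⟩
    have e := h0 η hη
    have e0 : θ η = 0 := e.eq_of_nhds
    refine ⟨by simp [e0], by simp [e0], ?_⟩
    have e1 : (fun η : Tangent m => tangentKernel (y - η) (t - τ) * θ η) =ᶠ[𝓝 η]
        fun _ => (0 : ℝ) := by
      filter_upwards [e] with z hz
      simp [hz]
    rw [(InnerProductSpace.laplacian_congr_nhds e1).eq_of_nhds,
      InnerProductSpace.laplacian_const]
    rfl

end TestFunctions

/-! ### The Green representation between two positive times before `t`. -/

section InteriorRepresentation

variable {m : ℕ} {F : ℝ → ℝ} {h : ℝ → Tangent m → ℝ} {u : ℝ → Tangent m → ℝ → ℝ}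

lemma integrable_exp_neg_mul_norm_sq (m : ℕ) {κ : ℝ} (hκ : 0 < κ) :
    Integrable (fun η : Tangent m => Real.exp (-κ * ‖η‖ ^ 2)) := by
  have h1 := (GaussianFourier.integrable_cexp_neg_mul_sq_norm_add (b := (κ : ℂ)) (V := Tangent m)
    (by simpa using hκ) 0 0).norm
  refine h1.congr (Eventually.of_forall fun η => ?_)
  simp only [Complex.norm_exp, zero_mul, add_zero]
  congr 1
  norm_cast

lemma integrable_gaussian_halfSpace (m : ℕ) {κ : ℝ} (hκ : 0 < κ) :
    Integrable (fun p : ℝ × Tangent m => Real.exp (-κ * p.1 ^ 2) * Real.exp (-κ * ‖p.2‖ ^ 2))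
      (volume.restrict (halfSpace m)) :=
  ((integrable_exp_neg_mul_sq hκ).mul_prod (integrable_exp_neg_mul_norm_sq m hκ)).integrableOn

lemma integrable_gaussian_slab (m : ℕ) {κ s r : ℝ} (hκ : 0 < κ) {G : ℝ → ℝ}
    (hG : IntegrableOn G (Ioc s r)) :
    Integrable (fun q : ℝ × Tangent m × ℝ =>
      Real.exp (-κ * q.1 ^ 2) * (Real.exp (-κ * ‖q.2.1‖ ^ 2) * G q.2.2)) (slab m s r) :=
  (integrable_exp_neg_mul_sq hκ).integrableOn.mul_prod
    ((integrable_exp_neg_mul_norm_sq m hκ).mul_prod hG)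

lemma prod_eq_restrict_halfSpace (m : ℕ) :
    (volume.restrict (Ioi (0 : ℝ))).prod (volume : Measure (Tangent m)) =
      volume.restrict (halfSpace m) := by
  rw [halfSpace, Measure.volume_eq_prod, ← Measure.prod_restrict, Measure.restrict_univ]

/-- The budget of exponents: the kernels decay at rate `1 / (16t)`, the solution and the source are
allowed to grow at rate `1 / (32t)`, and an integrable Gaussian of rate `1 / (32t)` is left. -/
lemma gaussian_mul_le {t ξ ρ p k v C₁ C₂ B : ℝ} (hp : 0 ≤ p) (hk : 0 ≤ k) (hv : 0 ≤ v)
    (h₁ : p ≤ C₁ * Real.exp (-(1 / (16 * t)) * ξ ^ 2))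
    (h₂ : k ≤ C₂ * Real.exp (-(1 / (16 * t)) * ρ ^ 2))
    (h₃ : v ≤ B * (Real.exp (1 / (32 * t) * ξ ^ 2) * Real.exp (1 / (32 * t) * ρ ^ 2))) :
    p * k * v ≤ C₁ * C₂ * B *
      (Real.exp (-(1 / (32 * t)) * ξ ^ 2) * Real.exp (-(1 / (32 * t)) * ρ ^ 2)) := by
  have e : ∀ z : ℝ, Real.exp (-(1 / (32 * t)) * z ^ 2) =
      Real.exp (-(1 / (16 * t)) * z ^ 2) * Real.exp (1 / (32 * t) * z ^ 2) := by
    intro z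
    rw [← Real.exp_add]
    congr 1
    rw [show 32 * t = 2 * (16 * t) by ring, one_div, one_div, mul_inv]
    ring
  rw [e, e]
  calc p * k * v ≤ (C₁ * Real.exp (-(1 / (16 * t)) * ξ ^ 2)) *
        (C₂ * Real.exp (-(1 / (16 * t)) * ρ ^ 2)) *
        (B * (Real.exp (1 / (32 * t) * ξ ^ 2) * Real.exp (1 / (32 * t) * ρ ^ 2))) := by
        have := hp.trans h₁
        have := hk.trans h₂
        gcongr
    _ = _ := by ring

/-- The growth hypothesis is used with `a = 1 / (64t)`, since `(ξ + ε)² ≤ 2ξ² + 2` doubles the rate.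
Asking for `0 < ξ + ε` rather than `0 < ξ` admits `ξ = 0`, which the boundary term needs. -/
lemma HasSubGaussianGrowth.exists_shift_bound (hg : HasSubGaussianGrowth F u) {t : ℝ}
    (ht : 0 < t) : ∃ B : ℝ, 0 ≤ B ∧ ∀ (ξ ε : ℝ) (η : Tangent m) (τ : ℝ), 0 < ξ + ε → 0 ≤ ε → ε ≤ 1 →
      0 < τ → τ ≤ t → |u (ξ + ε) η τ| ≤
        B * (Real.exp (1 / (32 * t) * ξ ^ 2) * Real.exp (1 / (32 * t) * ‖η‖ ^ 2)) := by
  obtain ⟨A, hA⟩ := hg.solution_bound t ht (1 / (64 * t)) (by positivity)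
  have hA0 : 0 ≤ A := by
    have h1 := (abs_nonneg _).trans (hA 1 0 t one_pos ht le_rfl)
    exact nonneg_of_mul_nonneg_left h1 (Real.exp_pos _)
  refine ⟨A * Real.exp (1 / (32 * t)), by positivity, fun ξ ε η τ h0 hε hε1 hτ hτt => ?_⟩
  refine (hA _ η τ h0 hτ hτt).trans ?_
  rw [mul_assoc, ← Real.exp_add, ← Real.exp_add]
  refine mul_le_mul_of_nonneg_left (Real.exp_le_exp.2 ?_) hA0
  have e : 1 / (32 * t) + (1 / (32 * t) * ξ ^ 2 + 1 / (32 * t) * ‖η‖ ^ 2) =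
      1 / (64 * t) * (2 + 2 * ξ ^ 2 + 2 * ‖η‖ ^ 2) := by
    field_simp
    ring
  rw [e]
  gcongr
  · nlinarith [sq_nonneg (ξ - ε)]
  · nlinarith [sq_nonneg ‖η‖]

lemma abs_mul_cutoff_le {g p k q v : ℝ} (hk : 0 ≤ k) (hp : |p| ≤ 1) (hq : |q| ≤ 1) :
    |g * p * (k * q) * v| ≤ |g| * k * |v| := by
  rw [abs_mul, abs_mul, abs_mul, abs_mul, abs_of_nonneg hk]
  have h1 : |g| * |p| ≤ |g| * 1 := by gcongr
  have h2 : k * |q| ≤ k * 1 := by gcongr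
  rw [mul_one] at h1 h2
  gcongr

lemma ae_slab (m : ℕ) (s r : ℝ) : ∀ᵐ q ∂(slab m s r), 0 < q.1 ∧ q.2.2 ∈ Ioc s r := by
  rw [slab_eq_restrict]
  filter_upwards [ae_restrict_mem (measurableSet_Ioi.prod
    (MeasurableSet.univ.prod measurableSet_Ioc))] with q hq
  exact ⟨hq.1, hq.2.2⟩

lemma continuous_greenLine (x t τ : ℝ) : Continuous (fun ξ => greenLine x t ξ τ) :=
  continuous_iff_continuousAt.2 fun ξ => (hasDerivAt_greenLine x t ξ τ).continuousAt

lemma measurableSet_halfSpace (m : ℕ) : MeasurableSet (halfSpace m) :=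
  (isOpen_halfSpace m).measurableSet

lemma IsClassicalSolution.continuousOn_shift (hu : IsClassicalSolution F h u) {ε τ : ℝ}
    (hε : 0 ≤ ε) (hτ : 0 < τ) :
    ContinuousOn (fun p : ℝ × Tangent m => u (p.1 + ε) p.2 τ) (halfSpace m) :=
  hu.continuousOn.comp (f := fun p : ℝ × Tangent m => (p.1 + ε, p.2, τ)) (by fun_prop)
    fun p hp => ⟨add_nonneg (le_of_lt hp.1) hε, hτ⟩

lemma IsClassicalSolution.tendsto_shift (hu : IsClassicalSolution F h u) {ε : ℕ → ℝ}
    (hε : ∀ n, 0 < ε n) (hε0 : Tendsto ε atTop (𝓝 0)) {ξ τ : ℝ} (hξ : 0 ≤ ξ) (η : Tangent m)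
    (hτ : 0 < τ) : Tendsto (fun n => u (ξ + ε n) η τ) atTop (𝓝 (u ξ η τ)) := by
  have h1 := hu.continuousOn (ξ, η, τ) ⟨hξ, hτ⟩
  refine h1.tendsto.comp (g := fun q : ℝ × Tangent m × ℝ => u q.1 q.2.1 q.2.2)
    (f := fun n => (ξ + ε n, η, τ)) (tendsto_nhdsWithin_iff.2 ⟨?_, ?_⟩)
  · have h2 : Tendsto (fun n => ξ + ε n) atTop (𝓝 ξ) := by simpa using hε0.const_add ξ
    exact h2.prodMk_nhds tendsto_const_nhds
  · exact Eventually.of_forall fun n => ⟨add_nonneg hξ (hε n).le, hτ⟩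

/-- Of the constant `3m`, `2m` comes from the gradient term and `m` from the Laplacian of the
cutoff. -/
lemma abs_tangentResidual_le {θ : Tangent m → ℝ} (hθ : ContDiff ℝ 2 θ) {z η : Tangent m}
    {σ X c : ℝ} (hσ : 0 < σ) (hX : 0 ≤ X)
    (h₁ : tangentKernel z σ ≤ X) (h₂ : ‖z‖ / (2 * σ) * tangentKernel z σ ≤ X)
    (d₁ : ∀ w, ‖w‖ ≤ 1 → |fderiv ℝ θ η w| ≤ c)
    (d₂ : ∀ w, ‖w‖ ≤ 1 → |fderiv ℝ (fun z => fderiv ℝ θ z w) η w| ≤ c) :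
    |tangentResidual θ z σ η| ≤ 3 * m * X * c := by
  set e := EuclideanSpace.basisFun (Fin m) ℝ with he
  have hk := tangentKernel_nonneg z σ
  have ne : ∀ i, ‖e i‖ ≤ 1 := fun i => (e.norm_eq_one i).le
  have t1 : ∀ i, |tangentKernel z σ / (2 * σ) * inner ℝ z (e i) * fderiv ℝ θ η (e i)| ≤ X * c := by
    intro i
    rw [abs_mul]
    refine mul_le_mul ?_ (d₁ _ (ne i)) (abs_nonneg _) hX
    rw [abs_mul, abs_of_nonneg (by positivity : 0 ≤ tangentKernel z σ / (2 * σ))]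
    have h3 : |inner ℝ z (e i)| ≤ ‖z‖ := by
      have := abs_real_inner_le_norm z (e i)
      rwa [e.norm_eq_one i, mul_one] at this
    calc _ ≤ tangentKernel z σ / (2 * σ) * ‖z‖ := by gcongr
      _ = ‖z‖ / (2 * σ) * tangentKernel z σ := by ring
      _ ≤ X := h₂
  have t2 : |Laplacian.laplacian θ η| ≤ m * c := by
    rw [laplacian_eq_sum_fderiv e hθ.contDiffAt]
    refine (Finset.abs_sum_le_sum_abs _ _).trans ?_
    refine (Finset.sum_le_card_nsmul _ _ c fun i _ => d₂ _ (ne i)).trans ?_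
    simp
  have t3 : |∑ i, tangentKernel z σ / (2 * σ) * inner ℝ z (e i) * fderiv ℝ θ η (e i)| ≤
      m * (X * c) := by
    refine (Finset.abs_sum_le_sum_abs _ _).trans ?_
    refine (Finset.sum_le_card_nsmul _ _ (X * c) fun i _ => t1 i).trans ?_
    simp
  unfold tangentResidual
  refine (abs_add_le _ _).trans ?_
  rw [abs_mul, abs_mul, abs_of_nonneg hk, abs_two]
  have t4 : tangentKernel z σ * |Laplacian.laplacian θ η| ≤ X * (m * c) :=
    mul_le_mul h₁ t2 (abs_nonneg _) hX
  linarith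

set_option maxHeartbeats 1000000 in
-- Green's identity with truncated kernels for the shifted solution, in the limit where cutoff and
-- shift are removed together. As `r < t`, the singularity of the kernel stays at a distance, and
-- one Gaussian dominates throughout.
theorem IsClassicalSolution.green_representation_interior (hu : IsClassicalSolution F h u)
    (hg : HasSubGaussianGrowth F u) (x : ℝ) (y : Tangent m) {s r t : ℝ} (hs : 0 < s) (hsr : s ≤ r)
    (hrt : r < t) :
    ∫ p in halfSpace m, (green x y t p.1 p.2 r * u p.1 p.2 r -
        green x y t p.1 p.2 s * u p.1 p.2 s) =
      -∫ q, green x y t q.1 q.2.1 q.2.2 * source F (boundaryFlux u) q.2.1 q.2.2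
        ∂(slab m s r) := by
  have ht : 0 < t := hs.trans_le (hsr.trans hrt.le)
  obtain ⟨C₁, hC₁, bg⟩ := exists_greenLine_bound hrt ht x
  obtain ⟨C₂, hC₂, bk⟩ := exists_tangentKernel_bound m ht (sub_pos.2 hrt) ‖y‖
  obtain ⟨B, hB, bu⟩ := hg.exists_shift_bound ht
  obtain ⟨G, hG, -, bf⟩ := hg.source_bound t ht (1 / (32 * t)) (by positivity)
  obtain ⟨ψ, P, hP, ψd, ψc, ψb, ψt, ψ1, ψ2⟩ := exists_cutoff ℝ
  obtain ⟨θ, Q, hQ, θd, θc, θb, θt, θ1, θ2⟩ := exists_cutoff (Tangent m)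
  -- One sequence serves as the shift and as the rate at which the derivatives of the cutoffs decay.
  obtain ⟨ε, hε⟩ : ∃ ε : ℕ → ℝ, ∀ n, ε n = 1 / ((n : ℝ) + 1) := ⟨_, fun n => rfl⟩
  have ε0 : ∀ n, 0 < ε n := fun n => by rw [hε]; positivity
  have ε1 : ∀ n, ε n ≤ 1 := fun n => by
    rw [hε, div_le_one (by positivity)]
    linarith [n.cast_nonneg (α := ℝ)]
  have εt : Tendsto ε atTop (𝓝 0) := by
    simpa only [← hε] using tendsto_one_div_add_atTop_nhds_zero_nat (𝕜 := ℝ)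
  have hκ : 0 < 1 / (32 * t) := by positivity
  have subτ : ∀ τ ∈ Icc s r, τ ∈ Icc 0 r ∧ t - τ ∈ Icc (t - r) t ∧ 0 < τ ∧ τ ≤ t ∧ 0 < t - τ :=
    fun τ hτ => ⟨⟨hs.le.trans hτ.1, hτ.2⟩, ⟨by linarith [hτ.2], by linarith [hτ.1]⟩,
      hs.trans_le hτ.1, by linarith [hτ.2], by linarith [hτ.2]⟩
  have Ta := fun n => isNormalTest_greenLine (s := s) hrt x (ψd n) (ψc n)
  have Tb := fun n => isTangentTest_tangentKernel (s := s) hrt y (θd n) (θc n)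
  have ident := fun n => hu.green_identity (ε0 n) hs hsr (Ta n) (Tb n)
  -- the initial and final terms
  have L : Tendsto (fun n => ∫ p : ℝ × Tangent m,
      (greenLine x t p.1 r * ψ n p.1 * (tangentKernel (y - p.2) (t - r) * θ n p.2) *
        u (p.1 + ε n) p.2 r - greenLine x t p.1 s * ψ n p.1 *
        (tangentKernel (y - p.2) (t - s) * θ n p.2) * u (p.1 + ε n) p.2 s)
        ∂((volume.restrict (Ioi 0)).prod volume)) atTop
      (𝓝 (∫ p in halfSpace m, (green x y t p.1 p.2 r * u p.1 p.2 r -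
        green x y t p.1 p.2 s * u p.1 p.2 s))) := by
    have Lm : ∀ n, ∀ τ ∈ Icc s r, AEStronglyMeasurable (fun p : ℝ × Tangent m =>
        greenLine x t p.1 τ * ψ n p.1 * (tangentKernel (y - p.2) (t - τ) * θ n p.2) *
        u (p.1 + ε n) p.2 τ) (volume.restrict (halfSpace m)) := by
      intro n τ hτ
      refine ContinuousOn.aestronglyMeasurable (ContinuousOn.mul (Continuous.continuousOn ?_)
        (hu.continuousOn_shift (ε0 n).le (subτ τ hτ).2.2.1)) (measurableSet_halfSpace m)
      exact (((continuous_greenLine x t τ).comp continuous_fst).mul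
        ((ψd n).continuous.comp continuous_fst)).mul
        (((contDiff_tangentKernel y (t - τ)).continuous.comp continuous_snd).mul
        ((θd n).continuous.comp continuous_snd))
    have Lb : ∀ n, ∀ τ ∈ Icc s r, ∀ p : ℝ × Tangent m, 0 < p.1 →
        |greenLine x t p.1 τ * ψ n p.1 * (tangentKernel (y - p.2) (t - τ) * θ n p.2) *
        u (p.1 + ε n) p.2 τ| ≤ C₁ * C₂ * B *
        (Real.exp (-(1 / (32 * t)) * p.1 ^ 2) * Real.exp (-(1 / (32 * t)) * ‖p.2‖ ^ 2)) := by
      intro n τ hτ p hp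
      obtain ⟨h1, h2, h3, h4, -⟩ := subτ τ hτ
      exact (abs_mul_cutoff_le (tangentKernel_nonneg _ _) (ψb n _) (θb n _)).trans
        (gaussian_mul_le (abs_nonneg _) (tangentKernel_nonneg _ _) (abs_nonneg _) (bg τ h1 p.1).1
          (bk _ h2 y le_rfl p.2).1 (bu p.1 (ε n) p.2 τ (add_pos hp (ε0 n)) (ε0 n).le (ε1 n) h3 h4))
    have Ll : ∀ τ ∈ Icc s r, ∀ p : ℝ × Tangent m, 0 < p.1 → Tendsto (fun n =>
        greenLine x t p.1 τ * ψ n p.1 * (tangentKernel (y - p.2) (t - τ) * θ n p.2) *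
        u (p.1 + ε n) p.2 τ) atTop (𝓝 (green x y t p.1 p.2 τ * u p.1 p.2 τ)) := by
      intro τ hτ p hp
      have := (((ψt p.1).const_mul (greenLine x t p.1 τ)).mul
        ((θt p.2).const_mul (tangentKernel (y - p.2) (t - τ)))).mul
        (hu.tendsto_shift ε0 εt hp.le p.2 (subτ τ hτ).2.2.1)
      rwa [mul_one, mul_one, mul_comm (greenLine x t p.1 τ), ← green_eq] at this
    have hrI : r ∈ Icc s r := right_mem_Icc.2 hsr
    have hsI : s ∈ Icc s r := left_mem_Icc.2 hsr
    rw [prod_eq_restrict_halfSpace]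
    refine tendsto_integral_of_dominated_convergence (fun p => C₁ * C₂ * B *
        (Real.exp (-(1 / (32 * t)) * p.1 ^ 2) * Real.exp (-(1 / (32 * t)) * ‖p.2‖ ^ 2)) +
        C₁ * C₂ * B *
        (Real.exp (-(1 / (32 * t)) * p.1 ^ 2) * Real.exp (-(1 / (32 * t)) * ‖p.2‖ ^ 2)))
      (fun n => (Lm n r hrI).sub (Lm n s hsI)) ?_ (fun n => ?_) ?_
    · have := (integrable_gaussian_halfSpace m hκ).const_mul (C₁ * C₂ * B)
      exact this.add this
    · filter_upwards [ae_restrict_mem (measurableSet_halfSpace m)] with p hp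
      exact (abs_sub _ _).trans (add_le_add (Lb n r hrI p hp.1) (Lb n s hsI p hp.1))
    · filter_upwards [ae_restrict_mem (measurableSet_halfSpace m)] with p hp
      exact (Ll r hrI p hp.1).sub (Ll s hsI p hp.1)
  -- The kernels solve the backward heat equation, so the integrand contains only derivatives of the
  -- cutoffs; it is at most `ε n` times a fixed integrable function.
  have A : Tendsto (fun n => ∫ q, ((-greenLineDerivDeriv x t q.1 q.2.2 * ψ n q.1 +
      (greenLineDerivDeriv x t q.1 q.2.2 * ψ n q.1 +
        2 * (greenLineDeriv x t q.1 q.2.2 * deriv (ψ n) q.1) +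
        greenLine x t q.1 q.2.2 * deriv (deriv (ψ n)) q.1)) *
      (tangentKernel (y - q.2.1) (t - q.2.2) * θ n q.2.1) + greenLine x t q.1 q.2.2 * ψ n q.1 *
      (-((‖y - q.2.1‖ ^ 2 / (4 * (t - q.2.2) ^ 2) - m / (2 * (t - q.2.2))) *
        tangentKernel (y - q.2.1) (t - q.2.2)) * θ n q.2.1 +
        Laplacian.laplacian (fun η : Tangent m => tangentKernel (y - η) (t - q.2.2) * θ n η)
          q.2.1)) * u (q.1 + ε n) q.2.1 q.2.2 ∂(slab m s r)) atTop (𝓝 0) := by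
    set D : ℝ := 3 * C₁ * P * C₂ * B + C₁ * (3 * m * C₂ * Q) * B with hD
    set dom : ℝ × Tangent m × ℝ → ℝ := fun q => Real.exp (-(1 / (32 * t)) * q.1 ^ 2) *
      (Real.exp (-(1 / (32 * t)) * ‖q.2.1‖ ^ 2) * 1) with hdom
    have hI : Integrable dom (slab m s r) :=
      integrable_gaussian_slab m hκ (G := fun _ => 1) (integrableOn_const (by simp))
    have lim : Tendsto (fun n => ε n * (D * ∫ q, dom q ∂(slab m s r))) atTop (𝓝 0) := by
      simpa using εt.mul_const (D * ∫ q, dom q ∂(slab m s r))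
    refine squeeze_zero_norm (fun n => ?_) lim
    rw [← integral_const_mul, ← integral_const_mul]
    refine norm_integral_le_of_norm_le ((hI.const_mul D).const_mul (ε n)) ?_
    filter_upwards [ae_slab m s r] with q hq
    obtain ⟨h1, h2, h3, h4, h5⟩ := subτ q.2.2 (Ioc_subset_Icc_self hq.2)
    have g0 := (bg _ h1 q.1).1
    have g1 := (bg _ h1 q.1).2
    have k0 := (bk _ h2 y le_rfl q.2.1).1
    have k1 := (bk _ h2 y le_rfl q.2.1).2
    have v := bu q.1 (ε n) q.2.1 q.2.2 (add_pos hq.1 (ε0 n)) (ε0 n).le (ε1 n) h3 h4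
    have p1 : |deriv (ψ n) q.1| ≤ P * ε n := by
      have := ψ1 n q.1 1 (by simp)
      rwa [fderiv_apply_one_eq_deriv, div_eq_mul_one_div, ← hε] at this
    have p2 : |deriv (deriv (ψ n)) q.1| ≤ P * ε n := by
      have := ψ2 n q.1 1 (by simp)
      simp only [fderiv_apply_one_eq_deriv] at this
      rwa [div_eq_mul_one_div, ← hε] at this
    have t1 : ∀ w, ‖w‖ ≤ 1 → |fderiv ℝ (θ n) q.2.1 w| ≤ Q * ε n := by
      intro w hw
      have := θ1 n q.2.1 w hw
      rwa [div_eq_mul_one_div, ← hε] at this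
    have t2 : ∀ w, ‖w‖ ≤ 1 → |fderiv ℝ (fun z => fderiv ℝ (θ n) z w) q.2.1 w| ≤ Q * ε n := by
      intro w hw
      have := θ2 n q.2.1 w hw
      rwa [div_eq_mul_one_div, ← hε] at this
    have res := abs_tangentResidual_le (θd n) h5 (by positivity) k0 k1 t1 t2
    set X := Real.exp (-(1 / (16 * t)) * q.1 ^ 2)
    set Z := Real.exp (-(1 / (16 * t)) * ‖q.2.1‖ ^ 2)
    have n1 : |2 * (greenLineDeriv x t q.1 q.2.2 * deriv (ψ n) q.1) +
        greenLine x t q.1 q.2.2 * deriv (deriv (ψ n)) q.1| ≤ (3 * C₁ * (P * ε n)) * X := by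
      have i1 : |greenLineDeriv x t q.1 q.2.2| * |deriv (ψ n) q.1| ≤ (C₁ * X) * (P * ε n) :=
        mul_le_mul g1 p1 (abs_nonneg _) (by positivity)
      have i2 : |greenLine x t q.1 q.2.2| * |deriv (deriv (ψ n)) q.1| ≤ (C₁ * X) * (P * ε n) :=
        mul_le_mul g0 p2 (abs_nonneg _) (by positivity)
      refine (abs_add_le _ _).trans ?_
      rw [abs_mul, abs_mul, abs_mul, abs_two]
      linarith
    have n2 : |tangentKernel (y - q.2.1) (t - q.2.2) * θ n q.2.1| ≤ C₂ * Z := by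
      rw [abs_mul, abs_of_nonneg (tangentKernel_nonneg _ _)]
      exact (mul_le_of_le_one_right (tangentKernel_nonneg _ _) (θb n _)).trans k0
    have n3 : |greenLine x t q.1 q.2.2 * ψ n q.1| ≤ C₁ * X := by
      rw [abs_mul]
      exact (mul_le_of_le_one_right (abs_nonneg _) (ψb n _)).trans g0
    have n4 : |tangentResidual (θ n) (y - q.2.1) (t - q.2.2) q.2.1| ≤
        (3 * m * C₂ * (Q * ε n)) * Z := res.trans (le_of_eq (by ring))
    have m1 := gaussian_mul_le (abs_nonneg _) (abs_nonneg _) (abs_nonneg _) n1 n2 v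
    have m2 := gaussian_mul_le (abs_nonneg _) (abs_nonneg _) (abs_nonneg _) n3 n4 v
    rw [laplacian_tangentKernel_mul (θd n) y q.2.1 h5, Real.norm_eq_abs]
    -- The cancellation of `∂_τ` against the second space derivatives, in the normal and in the
    -- tangential factor.
    have e1 : ∀ gDD p X1 X2 k g dd Rs v : ℝ, ((-gDD * p + (gDD * p + X1 + X2)) * k +
        g * (-dd * θ n q.2.1 + (dd * θ n q.2.1 + Rs))) * v = (X1 + X2) * k * v + g * Rs * v := by
      intros; ring
    rw [e1]
    refine (abs_add_le _ _).trans ?_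
    rw [abs_mul, abs_mul, abs_mul (_ * _) (u _ _ _), abs_mul (greenLine _ _ _ _ * _) _]
    calc _ ≤ _ := add_le_add m1 m2
      _ = _ := by simp only [hdom, hD]; ring
  -- Since `greenLine` vanishes at `ξ = 0`, the derivative of the cutoff drops out; the rest tends
  -- to zero with `u (ε n)`, by the boundary condition.
  have Bd : Tendsto (fun n => ∫ w : Tangent m × ℝ, (greenLineDeriv x t 0 w.2 * ψ n 0 +
      greenLine x t 0 w.2 * deriv (ψ n) 0) * (tangentKernel (y - w.1) (t - w.2) * θ n w.1) *
      u (ε n) w.1 w.2 ∂(volume.prod (volume.restrict (Ioc s r)))) atTop (𝓝 0) := by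
    have hμ : (volume : Measure (Tangent m)).prod (volume.restrict (Ioc s r)) =
        volume.restrict (univ ×ˢ Ioc s r) := by
      rw [Measure.volume_eq_prod, ← Measure.prod_restrict, Measure.restrict_univ]
    have hS : MeasurableSet (univ ×ˢ Ioc s r : Set (Tangent m × ℝ)) :=
      MeasurableSet.univ.prod measurableSet_Ioc
    have sub : (univ ×ˢ Ioc s r : Set (Tangent m × ℝ)) ⊆ univ ×ˢ Icc s r :=
      prod_mono_right Ioc_subset_Icc_self
    have bound : ∀ n, ∀ w ∈ (univ ×ˢ Ioc s r : Set (Tangent m × ℝ)),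
        |(greenLineDeriv x t 0 w.2 * ψ n 0 + greenLine x t 0 w.2 * deriv (ψ n) 0) *
        (tangentKernel (y - w.1) (t - w.2) * θ n w.1) * u (ε n) w.1 w.2| ≤
        |greenLineDeriv x t 0 w.2| * tangentKernel (y - w.1) (t - w.2) * |u (ε n) w.1 w.2| := by
      intro n w _
      rw [greenLine_zero_right, zero_mul, add_zero]
      exact abs_mul_cutoff_le (tangentKernel_nonneg _ _) (ψb n _) (θb n _)
    have hI : Integrable (fun w : Tangent m × ℝ => C₁ * C₂ * B *
        (Real.exp (-(1 / (32 * t)) * ‖w.1‖ ^ 2) * 1)) (volume.restrict (univ ×ˢ Ioc s r)) := by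
      rw [← hμ]
      exact ((integrable_exp_neg_mul_norm_sq m hκ).mul_prod (g := fun _ : ℝ => (1 : ℝ))
        (integrableOn_const (by simp))).const_mul _
    rw [hμ, show 𝓝 (0 : ℝ) = 𝓝 (∫ _ in (univ ×ˢ Ioc s r : Set (Tangent m × ℝ)), (0 : ℝ)) by
      rw [integral_zero]]
    refine tendsto_integral_of_dominated_convergence _ (fun n => ?_) hI (fun n => ?_) ?_
    · refine ContinuousOn.aestronglyMeasurable (ContinuousOn.mul (ContinuousOn.mul ?_ ?_) ?_) hS
      · exact (Ta n).continuousOn_deriv.comp (f := fun w : Tangent m × ℝ => ((0 : ℝ), w.2))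
          (by fun_prop) fun w hw => ⟨mem_univ _, (sub hw).2⟩
      · exact (Tb n).continuousOn.mono sub
      · exact hu.continuousOn.comp (f := fun w : Tangent m × ℝ => (ε n, w)) (by fun_prop)
          fun w hw => ⟨(ε0 n).le, hs.trans hw.2.1⟩
    · filter_upwards [ae_restrict_mem hS] with w hw
      obtain ⟨h1, h2, h3, h4, h5⟩ := subτ w.2 (sub hw).2
      have v := bu 0 (ε n) w.1 w.2 (by simpa using ε0 n) (ε0 n).le (ε1 n) h3 h4
      have := gaussian_mul_le (abs_nonneg _) (tangentKernel_nonneg _ _) (abs_nonneg _)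
        (bg _ h1 0).2 (bk _ h2 y le_rfl w.1).1 v
      rw [zero_add] at this
      refine (bound n w hw).trans (this.trans (le_of_eq ?_))
      simp
    · filter_upwards [ae_restrict_mem hS] with w hw
      have h3 := (subτ w.2 (sub hw).2).2.2.1
      have v := hu.tendsto_shift ε0 εt le_rfl w.1 h3
      simp only [zero_add, hu.boundary w.1 w.2 h3] at v
      have lim := (v.abs).const_mul (|greenLineDeriv x t 0 w.2| *
        tangentKernel (y - w.1) (t - w.2))
      rw [abs_zero, mul_zero] at lim
      exact squeeze_zero_norm (fun n => bound n w hw) lim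
  -- The source is not shifted; its dominating function `G` depends on time and is integrable on
  -- `(s, r]`.
  have S : Tendsto (fun n => ∫ q, greenLine x t q.1 q.2.2 * ψ n q.1 *
      (tangentKernel (y - q.2.1) (t - q.2.2) * θ n q.2.1) *
      source F (boundaryFlux u) q.2.1 q.2.2 ∂(slab m s r)) atTop
      (𝓝 (∫ q, green x y t q.1 q.2.1 q.2.2 * source F (boundaryFlux u) q.2.1 q.2.2
        ∂(slab m s r))) := by
    have hS : MeasurableSet (Ioi 0 ×ˢ (univ ×ˢ Ioc s r) : Set (ℝ × Tangent m × ℝ)) :=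
      measurableSet_Ioi.prod (MeasurableSet.univ.prod measurableSet_Ioc)
    have G0 : IntegrableOn G (Ioc s r) := hG.mono_set (Ioc_subset_Ioc hs.le hrt.le)
    refine tendsto_integral_of_dominated_convergence _ (fun n => ?_)
      ((integrable_gaussian_slab m hκ G0).const_mul (C₁ * C₂)) (fun n => ?_) ?_
    · rw [slab_eq_restrict]
      refine ContinuousOn.aestronglyMeasurable (ContinuousOn.mul (ContinuousOn.mul ?_ ?_) ?_) hS
      · exact (Ta n).continuousOn.comp (f := fun q : ℝ × Tangent m × ℝ => (q.1, q.2.2))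
          (by fun_prop) fun q hq => ⟨mem_univ _, Ioc_subset_Icc_self hq.2.2⟩
      · exact (Tb n).continuousOn.comp (f := fun q : ℝ × Tangent m × ℝ => q.2)
          (by fun_prop) fun q hq => ⟨mem_univ _, Ioc_subset_Icc_self hq.2.2⟩
      · exact hu.continuousOn_source.comp (f := fun q : ℝ × Tangent m × ℝ => q.2)
          (by fun_prop) fun q hq => hs.trans hq.2.2.1
    · filter_upwards [ae_slab m s r] with q hq
      obtain ⟨h1, h2, h3, h4, h5⟩ := subτ q.2.2 (Ioc_subset_Icc_self hq.2)
      have f0 := bf q.2.1 q.2.2 h3 h4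
      have hG0 : 0 ≤ G q.2.2 :=
        nonneg_of_mul_nonneg_left ((abs_nonneg _).trans f0) (Real.exp_pos _)
      -- The source has no growth in `ξ`; a factor at least `1` is inserted to match the form of
      -- `gaussian_mul_le`.
      have f1 : |source F (boundaryFlux u) q.2.1 q.2.2| ≤ G q.2.2 *
          (Real.exp (1 / (32 * t) * q.1 ^ 2) * Real.exp (1 / (32 * t) * ‖q.2.1‖ ^ 2)) := by
        refine f0.trans (mul_le_mul_of_nonneg_left ?_ hG0)
        exact le_mul_of_one_le_left (Real.exp_pos _).le (Real.one_le_exp (by positivity))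
      refine (abs_mul_cutoff_le (tangentKernel_nonneg _ _) (ψb n _) (θb n _)).trans ?_
      refine (gaussian_mul_le (abs_nonneg _) (tangentKernel_nonneg _ _) (abs_nonneg _)
        (bg _ h1 q.1).1 (bk _ h2 y le_rfl q.2.1).1 f1).trans (le_of_eq ?_)
      ring
    · filter_upwards with q
      have := (((ψt q.1).const_mul (greenLine x t q.1 q.2.2)).mul
        ((θt q.2.1).const_mul (tangentKernel (y - q.2.1) (t - q.2.2)))).mul_const
        (source F (boundaryFlux u) q.2.1 q.2.2)
      rwa [mul_one, mul_one, mul_comm (greenLine x t q.1 q.2.2), ← green_eq] at this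
  have R := (A.add Bd).sub S
  rw [add_zero, zero_sub] at R
  exact tendsto_nhds_unique (L.congr ident) R

end InteriorRepresentation

/-! ### The error function as a normal integral of the Green's function. -/

section ErrorFunction

lemma continuous_exp_neg_sq : Continuous (fun X : ℝ => Real.exp (-X ^ 2)) := by fun_prop

lemma integrable_exp_neg_sq : Integrable (fun X : ℝ => Real.exp (-X ^ 2)) := by
  simpa using integrable_exp_neg_mul_sq one_pos

lemma hasDerivAt_erf (z : ℝ) : HasDerivAt erf (2 / √Real.pi * Real.exp (-z ^ 2)) z :=
  (continuous_exp_neg_sq.integral_hasStrictDerivAt 0 z).hasDerivAt.const_mul _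

lemma continuous_erf : Continuous erf :=
  continuous_iff_continuousAt.2 fun z => (hasDerivAt_erf z).continuousAt

lemma erf_zero : erf 0 = 0 := by simp [erf]

lemma erf_neg (z : ℝ) : erf (-z) = -erf z := by
  have h1 := intervalIntegral.integral_comp_neg (a := 0) (b := z) fun X : ℝ => Real.exp (-X ^ 2)
  simp only [even_two, Even.neg_pow, neg_zero] at h1
  rw [erf, erf, intervalIntegral.integral_symm, ← h1]
  ring

/-- The value of the limit is immaterial: two copies of it cancel in `integral_greenLine`. -/
lemma tendsto_erf_atTop : ∃ l, Tendsto erf atTop (𝓝 l) :=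
  ⟨_, (intervalIntegral_tendsto_integral_Ioi 0 integrable_exp_neg_sq.integrableOn
    tendsto_id).const_mul _⟩

lemma exists_abs_erf_le : ∃ C, 0 ≤ C ∧ ∀ z, |erf z| ≤ C := by
  have key : ∀ z, |erf z| ≤ 2 / √Real.pi * ∫ X : ℝ, Real.exp (-X ^ 2) := by
    intro z
    rw [erf, abs_mul, abs_of_nonneg (by positivity)]
    gcongr
    refine (intervalIntegral.norm_integral_le_integral_norm_uIoc
      (f := fun X : ℝ => Real.exp (-X ^ 2))).trans ?_
    simp only [Real.norm_eq_abs, Real.abs_exp]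
    exact setIntegral_le_integral integrable_exp_neg_sq
      (Eventually.of_forall fun X => (Real.exp_pos _).le)
  exact ⟨_, (abs_nonneg _).trans (key 0), key⟩

lemma hasDerivAt_erf_comp {σ : ℝ} (hσ : 0 < σ) (x ξ : ℝ) :
    HasDerivAt (fun ξ => erf ((ξ + x) / (2 * √σ))) (2 * lineKernel (x + ξ) σ) ξ := by
  have h1 : HasDerivAt (fun ξ : ℝ => (ξ + x) / (2 * √σ)) (1 / (2 * √σ)) ξ :=
    ((hasDerivAt_id ξ).add_const x).div_const _
  refine ((hasDerivAt_erf _).comp ξ h1).congr_deriv ?_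
  have hs : 0 < √σ := Real.sqrt_pos.2 hσ
  have hp : 0 < √Real.pi := Real.sqrt_pos.2 Real.pi_pos
  rw [lineKernel, Real.sqrt_mul Real.pi_pos.le, div_pow, mul_pow, Real.sq_sqrt hσ.le,
    show -((ξ + x) ^ 2 / (2 ^ 2 * σ)) = -(x + ξ) ^ 2 / (4 * σ) by ring]
  field_simp

lemma lineKernel_neg (z σ : ℝ) : lineKernel (-z) σ = lineKernel z σ := by simp [lineKernel]

lemma integrable_lineKernel {σ : ℝ} (hσ : 0 < σ) : Integrable (fun z => lineKernel z σ) := by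
  refine ((integrable_exp_neg_mul_sq (b := 1 / (4 * σ)) (by positivity)).div_const
    (2 * √(Real.pi * σ))).congr (Eventually.of_forall fun z => ?_)
  simp only [lineKernel]
  congr 2
  ring

lemma integrableOn_greenLine (x : ℝ) {t τ : ℝ} (hτ : τ < t) :
    IntegrableOn (fun ξ => greenLine x t ξ τ) (Ioi 0) := by
  have h0 := integrable_lineKernel (sub_pos.2 hτ)
  simp_rw [greenLine_eq]
  exact ((h0.comp_sub_left x).sub (h0.comp_add_left x)).integrableOn

/-- An antiderivative in `ξ` is half the difference of error functions centred at `x` and at `-x`.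
It tends to zero at infinity, and at `ξ = 0` it equals `-erf(x / (2√(t - τ)))` because `erf` is odd.
-/
lemma integral_greenLine (x : ℝ) {t τ : ℝ} (hτ : τ < t) :
    ∫ ξ in Ioi 0, greenLine x t ξ τ = erf (x / (2 * √(t - τ))) := by
  have hσ : 0 < t - τ := sub_pos.2 hτ
  have hs : 0 < √(t - τ) := Real.sqrt_pos.2 hσ
  obtain ⟨l, hl⟩ := tendsto_erf_atTop
  have lim : ∀ x, Tendsto (fun ξ => erf ((ξ + x) / (2 * √(t - τ)))) atTop (𝓝 l) := fun x =>
    hl.comp ((tendsto_atTop_add_const_right _ x tendsto_id).atTop_div_const (by positivity))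
  have hd : ∀ ξ, HasDerivAt (fun ξ => (erf ((ξ + -x) / (2 * √(t - τ))) -
      erf ((ξ + x) / (2 * √(t - τ)))) / 2) (greenLine x t ξ τ) ξ := by
    intro ξ
    refine (((hasDerivAt_erf_comp hσ (-x) ξ).fun_sub (hasDerivAt_erf_comp hσ x
      ξ)).div_const 2).congr_deriv ?_
    rw [greenLine_eq, ← lineKernel_neg (x - ξ), show -(x - ξ) = -x + ξ by ring]
    ring
  rw [integral_Ioi_of_hasDerivAt_of_tendsto (hd 0).continuousAt.continuousWithinAt
    (fun ξ _ => hd ξ) (integrableOn_greenLine x hτ) (((lim (-x)).sub (lim x)).div_const 2)]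
  simp only [zero_add, neg_div, erf_neg]
  ring

end ErrorFunction

/-! ### The source smoothed by the tangential heat flow. -/

section SmoothedSource

variable {m : ℕ} {F : ℝ → ℝ} {h : ℝ → Tangent m → ℝ} {u : ℝ → Tangent m → ℝ → ℝ}

lemma integral_tangentKernel (y : Tangent m) {σ : ℝ} (hσ : 0 < σ) :
    ∫ η : Tangent m, tangentKernel (y - η) σ = 1 := by
  rw [integral_sub_left_eq_self (fun z => tangentKernel z σ) volume y]
  have h1 := GaussianFourier.integral_rexp_neg_mul_sq_norm (V := Tangent m) (b := 1 / (4 * σ))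
    (by positivity)
  have e : ∀ z : Tangent m, tangentKernel z σ =
      Real.exp (-(1 / (4 * σ)) * ‖z‖ ^ 2) / (2 * √(Real.pi * σ)) ^ m := by
    intro z
    rw [tangentKernel]
    congr 2
    ring
  have hp : 0 < Real.pi * σ := mul_pos Real.pi_pos hσ
  have e2 : (Real.pi / (1 / (4 * σ))) = (2 * √(Real.pi * σ)) ^ 2 := by
    rw [mul_pow, Real.sq_sqrt hp.le]
    field_simp
    norm_num
  have hS := two_mul_sqrt_pi_mul_pos hσ
  simp_rw [e]
  rw [integral_div, h1, e2, finrank_euclideanSpace_fin, ← Real.rpow_natCast _ 2,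
    ← Real.rpow_mul hS.le, Nat.cast_ofNat, mul_div_cancel₀ _ two_ne_zero, Real.rpow_natCast,
    div_self (pow_pos hS m).ne']

lemma integrable_tangentKernel (y : Tangent m) {σ : ℝ} (hσ : 0 < σ) :
    Integrable (fun η : Tangent m => tangentKernel (y - η) σ) := by
  -- The Bochner integral of a non-integrable function is zero, whereas this one equals `1`.
  by_contra hn
  have := integral_tangentKernel y hσ
  rw [integral_undef hn] at this
  exact zero_ne_one this

/-- The heat flow of the source, `∫ K(y - η, t - τ) f(η, τ) dη`. -/
def smoothedSource (F : ℝ → ℝ) (V : Tangent m → ℝ → ℝ) (y : Tangent m) (t τ : ℝ) : ℝ :=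
  ∫ η : Tangent m, tangentKernel (y - η) (t - τ) * source F V η τ

lemma smoothedSource_eq (F : ℝ → ℝ) (V : Tangent m → ℝ → ℝ) (y : Tangent m) (t τ : ℝ) :
    smoothedSource F V y t τ = sourceIntegral F V y t τ / (2 * √(Real.pi * (t - τ))) ^ m := by
  rw [smoothedSource, sourceIntegral, ← integral_div]
  congr 1
  ext η
  rw [tangentKernel]
  ring

/-- The bounds for times away from zero degenerate as `σ → 0`. Here the growth is absorbed by
doubling the time of the kernel, which still has mass `1`; hence the smoothed source is controlled
uniformly up to `τ = t`. -/
lemma tangentKernel_mul_exp_le (y η : Tangent m) {t σ : ℝ} (hσ : 0 < σ) (hσt : σ ≤ t) :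
    tangentKernel (y - η) σ * Real.exp (1 / (32 * t) * ‖η‖ ^ 2) ≤
      √2 ^ m * Real.exp (1 / (16 * t) * ‖y‖ ^ 2) * tangentKernel (y - η) (2 * σ) := by
  have ht : 0 < t := hσ.trans_le hσt
  have hS := two_mul_sqrt_pi_mul_pos hσ
  have e1 : √(Real.pi * (2 * σ)) = √2 * √(Real.pi * σ) := by
    rw [← Real.sqrt_mul (by norm_num)]
    congr 1
    ring
  have h1 : ‖η‖ ≤ ‖y‖ + ‖y - η‖ := by simpa using norm_sub_le y (y - η)
  have h2 : ‖η‖ ^ 2 ≤ 2 * ‖y‖ ^ 2 + 2 * ‖y - η‖ ^ 2 := by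
    have h3 : ‖η‖ ^ 2 ≤ (‖y‖ + ‖y - η‖) ^ 2 := by gcongr
    nlinarith [sq_nonneg (‖y‖ - ‖y - η‖)]
  have h3 : 1 / (32 * t) * ‖η‖ ^ 2 ≤ 1 / (16 * t) * ‖y‖ ^ 2 + ‖y - η‖ ^ 2 / (8 * σ) := by
    calc 1 / (32 * t) * ‖η‖ ^ 2 ≤ 1 / (32 * t) * (2 * ‖y‖ ^ 2 + 2 * ‖y - η‖ ^ 2) := by gcongr
      _ = 1 / (16 * t) * ‖y‖ ^ 2 + ‖y - η‖ ^ 2 / (16 * t) := by field_simp; ring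
      _ ≤ 1 / (16 * t) * ‖y‖ ^ 2 + ‖y - η‖ ^ 2 / (8 * σ) := by
        gcongr
        linarith
  have h4 : Real.exp (-‖y - η‖ ^ 2 / (4 * σ)) * Real.exp (1 / (32 * t) * ‖η‖ ^ 2) ≤
      Real.exp (1 / (16 * t) * ‖y‖ ^ 2) * Real.exp (-‖y - η‖ ^ 2 / (4 * (2 * σ))) := by
    rw [← Real.exp_add, ← Real.exp_add]
    apply Real.exp_le_exp.2
    have e : -‖y - η‖ ^ 2 / (4 * (2 * σ)) - -‖y - η‖ ^ 2 / (4 * σ) = ‖y - η‖ ^ 2 / (8 * σ) := by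
      field_simp
      ring
    linarith
  have h2' : 0 < √(2 : ℝ) := by positivity
  unfold tangentKernel
  rw [e1, show 2 * (√2 * √(Real.pi * σ)) = √2 * (2 * √(Real.pi * σ)) by ring, mul_pow √2]
  calc _ = (Real.exp (-‖y - η‖ ^ 2 / (4 * σ)) * Real.exp (1 / (32 * t) * ‖η‖ ^ 2)) /
        (2 * √(Real.pi * σ)) ^ m := by ring
    _ ≤ (Real.exp (1 / (16 * t) * ‖y‖ ^ 2) * Real.exp (-‖y - η‖ ^ 2 / (4 * (2 * σ)))) /
        (2 * √(Real.pi * σ)) ^ m := by gcongr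
    _ = _ := by
      have hS' := pow_pos hS m
      have h2m := pow_pos h2' m
      set S := (2 * √(Real.pi * σ)) ^ m
      set T := √(2 : ℝ) ^ m
      field_simp

lemma IsClassicalSolution.continuous_source (hu : IsClassicalSolution F h u) {τ : ℝ} (hτ : 0 < τ) :
    Continuous (fun η : Tangent m => source F (boundaryFlux u) η τ) := by
  rw [← continuousOn_univ]
  exact hu.continuousOn_source.comp (f := fun η : Tangent m => (η, τ)) (by fun_prop)
    fun η _ => hτ

lemma abs_tangentKernel_mul_le {t τ c : ℝ} (hτt : τ < t) (hτ : 0 < τ)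
    {f : Tangent m → ℝ} (y : Tangent m)
    (hf : ∀ η, |f η| ≤ c * Real.exp (1 / (32 * t) * ‖η‖ ^ 2)) (η : Tangent m) :
    |tangentKernel (y - η) (t - τ) * f η| ≤ √2 ^ m * Real.exp (1 / (16 * t) * ‖y‖ ^ 2) * c *
      tangentKernel (y - η) (2 * (t - τ)) := by
  have hc : 0 ≤ c := nonneg_of_mul_nonneg_left ((abs_nonneg _).trans (hf 0)) (Real.exp_pos _)
  rw [abs_mul, abs_of_nonneg (tangentKernel_nonneg _ _)]
  calc _ ≤ tangentKernel (y - η) (t - τ) * (c * Real.exp (1 / (32 * t) * ‖η‖ ^ 2)) :=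
        mul_le_mul_of_nonneg_left (hf η) (tangentKernel_nonneg _ _)
    _ = c * (tangentKernel (y - η) (t - τ) * Real.exp (1 / (32 * t) * ‖η‖ ^ 2)) := by ring
    _ ≤ c * (√2 ^ m * Real.exp (1 / (16 * t) * ‖y‖ ^ 2) *
        tangentKernel (y - η) (2 * (t - τ))) :=
        mul_le_mul_of_nonneg_left (tangentKernel_mul_exp_le y η (sub_pos.2 hτt) (by linarith)) hc
    _ = _ := by ring

lemma IsClassicalSolution.integrable_kernel_mul_source (hu : IsClassicalSolution F h u)
    (hg : HasSubGaussianGrowth F u) (y : Tangent m) {t τ : ℝ} (hτ : 0 < τ) (hτt : τ < t) :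
    Integrable (fun η : Tangent m =>
      tangentKernel (y - η) (t - τ) * source F (boundaryFlux u) η τ) := by
  have ht : 0 < t := hτ.trans hτt
  obtain ⟨G, hG, -, bf⟩ := hg.source_bound t ht (1 / (32 * t)) (by positivity)
  refine Integrable.mono' ((integrable_tangentKernel y (σ := 2 * (t - τ))
    (by linarith)).const_mul (√2 ^ m * Real.exp (1 / (16 * t) * ‖y‖ ^ 2) * G τ)) ?_ ?_
  · exact ((contDiff_tangentKernel y _).continuous.mul
      (hu.continuous_source hτ)).aestronglyMeasurable
  · exact Eventually.of_forall fun η =>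
      abs_tangentKernel_mul_le hτt hτ y (fun η => bf η τ hτ hτt.le) η

lemma IsClassicalSolution.integrable_exp_mul_source (hu : IsClassicalSolution F h u)
    (hg : HasSubGaussianGrowth F u) (y : Tangent m) {t τ : ℝ} (hτ : 0 < τ) (hτt : τ < t) :
    Integrable (fun η : Tangent m =>
      Real.exp (-‖y - η‖ ^ 2 / (4 * (t - τ))) * source F (boundaryFlux u) η τ) := by
  have hS := pow_pos (two_mul_sqrt_pi_mul_pos (sub_pos.2 hτt)) m
  refine ((hu.integrable_kernel_mul_source hg y hτ hτt).const_mul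
    ((2 * √(Real.pi * (t - τ))) ^ m)).congr (Eventually.of_forall fun η => ?_)
  simp only [tangentKernel]
  field_simp

lemma abs_smoothedSource_le {V : Tangent m → ℝ → ℝ} (y : Tangent m) {t τ c : ℝ} (hτ : 0 < τ)
    (hτt : τ < t) (hf : ∀ η, |source F V η τ| ≤ c * Real.exp (1 / (32 * t) * ‖η‖ ^ 2)) :
    |smoothedSource F V y t τ| ≤ √2 ^ m * Real.exp (1 / (16 * t) * ‖y‖ ^ 2) * c := by
  have hσ : 0 < 2 * (t - τ) := by linarith
  have h1 := norm_integral_le_of_norm_le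
    (f := fun η => tangentKernel (y - η) (t - τ) * source F V η τ) ((integrable_tangentKernel y hσ).const_mul
    (√2 ^ m * Real.exp (1 / (16 * t) * ‖y‖ ^ 2) * c)) (Eventually.of_forall fun η =>
      abs_tangentKernel_mul_le hτt hτ y hf η)
  rwa [integral_const_mul, integral_tangentKernel y hσ, mul_one] at h1

lemma IsClassicalSolution.aestronglyMeasurable_smoothedSource (hu : IsClassicalSolution F h u)
    (y : Tangent m) (t : ℝ) :
    AEStronglyMeasurable (fun τ => smoothedSource F (boundaryFlux u) y t τ)
      (volume.restrict (Ioc 0 t)) := by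
  -- Joint continuity of the integrand fails at `τ = t`, a null set.
  rw [← restrict_Ioo_eq_restrict_Ioc]
  have h1 : AEStronglyMeasurable (fun w : ℝ × Tangent m =>
      tangentKernel (y - w.2) (t - w.1) * source F (boundaryFlux u) w.2 w.1)
      ((volume.restrict (Ioo 0 t)).prod volume) := by
    have hμ : (volume.restrict (Ioo 0 t)).prod (volume : Measure (Tangent m)) =
        volume.restrict (Ioo 0 t ×ˢ univ) := by
      rw [Measure.volume_eq_prod, ← Measure.prod_restrict, Measure.restrict_univ]
    rw [hμ]
    refine ContinuousOn.aestronglyMeasurable (ContinuousOn.mul ?_ ?_)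
      (measurableSet_Ioo.prod MeasurableSet.univ)
    · exact (continuousOn_tangentKernel_sub y t).comp (f := fun w : ℝ × Tangent m => (w.2, w.1))
        (by fun_prop) fun w hw => hw.1.2
    · exact hu.continuousOn_source.comp (f := fun w : ℝ × Tangent m => (w.2, w.1))
        (by fun_prop) fun w hw => hw.1.1
  exact h1.integral_prod_right'

/-- The smoothed source is dominated by an integrable function of time, bounded away from
`τ = 0`. -/
lemma HasSubGaussianGrowth.exists_smoothedSource_bound (hg : HasSubGaussianGrowth F u)
    (y : Tangent m) {t : ℝ} (ht : 0 < t) :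
    ∃ G : ℝ → ℝ, IntegrableOn G (Ioc 0 t) ∧ (∃ M, 0 ≤ M ∧ ∀ τ ∈ Icc (t / 2) t, G τ ≤ M) ∧
      ∀ τ, 0 < τ → τ < t → |smoothedSource F (boundaryFlux u) y t τ| ≤ G τ := by
  obtain ⟨G, hG, hb, bf⟩ := hg.source_bound t ht (1 / (32 * t)) (by positivity)
  obtain ⟨M, hM⟩ := hb (t / 2) (by positivity)
  set c := √2 ^ m * Real.exp (1 / (16 * t) * ‖y‖ ^ 2)
  refine ⟨fun τ => c * G τ, hG.const_mul c, ⟨c * |M|, by positivity, fun τ hτ => ?_⟩,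
    fun τ hτ hτt => abs_smoothedSource_le y hτ hτt fun η => bf η τ hτ hτt.le⟩
  have : G τ ≤ M := hM (mem_image_of_mem G hτ)
  exact mul_le_mul_of_nonneg_left (this.trans (le_abs_self M)) (by positivity)

lemma IsClassicalSolution.intervalIntegrable_erf_mul (hu : IsClassicalSolution F h u)
    (hg : HasSubGaussianGrowth F u) (x : ℝ) (y : Tangent m) {t : ℝ} (ht : 0 < t) :
    IntervalIntegrable (fun τ => erf (x / (2 * √(t - τ))) *
      smoothedSource F (boundaryFlux u) y t τ) volume 0 t := by
  obtain ⟨G, hG, -, hb⟩ := hg.exists_smoothedSource_bound y ht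
  obtain ⟨C, hC, he⟩ := exists_abs_erf_le
  rw [intervalIntegrable_iff_integrableOn_Ioc_of_le ht.le]
  refine Integrable.mono' (hG.const_mul C) (AEStronglyMeasurable.mul ?_
    (hu.aestronglyMeasurable_smoothedSource y t)) ?_
  · exact (continuous_erf.measurable.comp (by fun_prop)).aestronglyMeasurable
  · rw [← restrict_Ioo_eq_restrict_Ioc]
    filter_upwards [ae_restrict_mem measurableSet_Ioo] with τ hτ
    rw [Real.norm_eq_abs, abs_mul]
    exact mul_le_mul (he _) (hb τ hτ.1 hτ.2) (abs_nonneg _) hC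

/-- The source does not depend on `ξ`, so by Fubini the normal integral falls on `greenLine` alone
and the tangential one gives the smoothed source. -/
lemma IsClassicalSolution.integral_slab_green_mul_source (hu : IsClassicalSolution F h u)
    (hg : HasSubGaussianGrowth F u) (x : ℝ) (y : Tangent m) {s r t : ℝ} (hs : 0 < s) (hsr : s ≤ r)
    (hrt : r < t) :
    ∫ q, green x y t q.1 q.2.1 q.2.2 * source F (boundaryFlux u) q.2.1 q.2.2 ∂(slab m s r) =
      ∫ τ in s..r, erf (x / (2 * √(t - τ))) * smoothedSource F (boundaryFlux u) y t τ := by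
  have ht : 0 < t := hs.trans_le (hsr.trans hrt.le)
  obtain ⟨C₁, hC₁, bg⟩ := exists_greenLine_bound hrt ht x
  obtain ⟨C₂, hC₂, bk⟩ := exists_tangentKernel_bound m ht (sub_pos.2 hrt) ‖y‖
  obtain ⟨G, hG, -, bf⟩ := hg.source_bound t ht (1 / (32 * t)) (by positivity)
  have G0 : IntegrableOn G (Ioc s r) := hG.mono_set (Ioc_subset_Ioc hs.le hrt.le)
  have hI : Integrable (fun q : ℝ × Tangent m × ℝ => green x y t q.1 q.2.1 q.2.2 *
      source F (boundaryFlux u) q.2.1 q.2.2) (slab m s r) := by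
    refine Integrable.mono' ((integrable_gaussian_slab m (κ := 1 / (32 * t)) (by positivity)
      G0).const_mul (C₁ * C₂)) ?_ ?_
    · rw [slab_eq_restrict]
      refine ContinuousOn.aestronglyMeasurable (ContinuousOn.mul (ContinuousOn.mul ?_ ?_) ?_)
        (measurableSet_Ioi.prod (MeasurableSet.univ.prod measurableSet_Ioc))
      · exact (continuousOn_tangentKernel_sub y t).comp (f := fun q : ℝ × Tangent m × ℝ => q.2)
          (by fun_prop) fun q hq => hq.2.2.2.trans_lt hrt
      · exact (continuousOn_greenLine x t).comp
          (f := fun q : ℝ × Tangent m × ℝ => (q.1, q.2.2)) (by fun_prop)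
          fun q hq => hq.2.2.2.trans_lt hrt
      · exact hu.continuousOn_source.comp (f := fun q : ℝ × Tangent m × ℝ => q.2)
          (by fun_prop) fun q hq => hs.trans hq.2.2.1
    · filter_upwards [ae_slab m s r] with q hq
      have h3 : 0 < q.2.2 := hs.trans hq.2.1
      have h4 : q.2.2 ≤ r := hq.2.2
      have f0 := bf q.2.1 q.2.2 h3 (by linarith)
      have hG0 : 0 ≤ G q.2.2 :=
        nonneg_of_mul_nonneg_left ((abs_nonneg _).trans f0) (Real.exp_pos _)
      have f1 : |source F (boundaryFlux u) q.2.1 q.2.2| ≤ G q.2.2 *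
          (Real.exp (1 / (32 * t) * q.1 ^ 2) * Real.exp (1 / (32 * t) * ‖q.2.1‖ ^ 2)) := by
        refine f0.trans (mul_le_mul_of_nonneg_left ?_ hG0)
        exact le_mul_of_one_le_left (Real.exp_pos _).le (Real.one_le_exp (by positivity))
      have := gaussian_mul_le (abs_nonneg _) (tangentKernel_nonneg _ _) (abs_nonneg _)
        (bg _ ⟨h3.le, h4⟩ q.1).1 (bk (t - q.2.2) ⟨by linarith, by linarith⟩ y le_rfl q.2.1).1 f1
      rw [Real.norm_eq_abs, green_eq, abs_mul, abs_mul, abs_of_nonneg (tangentKernel_nonneg _ _)]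
      calc _ = |greenLine x t q.1 q.2.2| * tangentKernel (y - q.2.1) (t - q.2.2) *
            |source F (boundaryFlux u) q.2.1 q.2.2| := by ring
        _ ≤ _ := this
        _ = _ := by ring
  unfold slab at hI ⊢
  have e1 : ∀ᵐ w : Tangent m × ℝ ∂(volume.prod (volume.restrict (Ioc s r))),
      ∫ ξ in Ioi 0, green x y t ξ w.1 w.2 * source F (boundaryFlux u) w.1 w.2 =
        erf (x / (2 * √(t - w.2))) *
          (tangentKernel (y - w.1) (t - w.2) * source F (boundaryFlux u) w.1 w.2) := by
    have hτ : ∀ᵐ w : Tangent m × ℝ ∂(volume.prod (volume.restrict (Ioc s r))), w.2 ∈ Ioc s r :=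
      Measure.quasiMeasurePreserving_snd.ae (ae_restrict_mem measurableSet_Ioc)
    filter_upwards [hτ] with w hw
    rw [← integral_greenLine x (hw.2.trans_lt hrt), ← integral_mul_const]
    congr 1
    ext ξ
    rw [green_eq]
    ring
  rw [integral_prod_symm _ hI, integral_congr_ae e1,
    integral_prod_symm _ (hI.integral_prod_right.congr e1), intervalIntegral.integral_of_le hsr]
  refine setIntegral_congr_fun measurableSet_Ioc fun τ hτ => ?_
  simp only [smoothedSource, integral_const_mul]

end SmoothedSource

/-! ### The limit at the initial time. -/

section InitialTime

variable {m : ℕ} {F : ℝ → ℝ} {h : ℝ → Tangent m → ℝ} {u : ℝ → Tangent m → ℝ → ℝ}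

lemma exists_green_mul_bound {r t : ℝ} (hr : r < t) (ht : 0 < t) (x : ℝ) (y : Tangent m) :
    ∃ C, 0 ≤ C ∧ ∀ τ ∈ Icc 0 r, ∀ (ξ : ℝ) (η : Tangent m) (v B : ℝ),
      |v| ≤ B * (Real.exp (1 / (32 * t) * ξ ^ 2) * Real.exp (1 / (32 * t) * ‖η‖ ^ 2)) →
      |green x y t ξ η τ * v| ≤ C * B *
        (Real.exp (-(1 / (32 * t)) * ξ ^ 2) * Real.exp (-(1 / (32 * t)) * ‖η‖ ^ 2)) := by
  obtain ⟨C₁, hC₁, bg⟩ := exists_greenLine_bound hr ht x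
  obtain ⟨C₂, hC₂, bk⟩ := exists_tangentKernel_bound m ht (sub_pos.2 hr) ‖y‖
  refine ⟨C₁ * C₂, by positivity, fun τ hτ ξ η v B hv => ?_⟩
  have := gaussian_mul_le (abs_nonneg _) (tangentKernel_nonneg _ _) (abs_nonneg _) (bg τ hτ ξ).1
    (bk (t - τ) ⟨by linarith [hτ.2], by linarith [hτ.1]⟩ y le_rfl η).1 hv
  rwa [green_eq, abs_mul, abs_mul, abs_of_nonneg (tangentKernel_nonneg _ _),
    mul_comm (tangentKernel _ _)]

lemma HasSubGaussianGrowth.exists_bound (hg : HasSubGaussianGrowth F u) {t : ℝ} (ht : 0 < t) :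
    ∃ B : ℝ, 0 ≤ B ∧ ∀ (ξ : ℝ) (η : Tangent m) (τ : ℝ), 0 < ξ → 0 < τ → τ ≤ t → |u ξ η τ| ≤
        B * (Real.exp (1 / (32 * t) * ξ ^ 2) * Real.exp (1 / (32 * t) * ‖η‖ ^ 2)) := by
  obtain ⟨B, hB, bu⟩ := hg.exists_shift_bound ht
  refine ⟨B, hB, fun ξ η τ hξ hτ hτt => ?_⟩
  simpa using bu ξ 0 η τ (by simpa using hξ) le_rfl zero_le_one hτ hτt

/-- The growth bound on `u` is uniform down to time zero, so `h` inherits it in the limit. -/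
lemma IsClassicalSolution.exists_initial_bound (hu : IsClassicalSolution F h u)
    (hg : HasSubGaussianGrowth F u) {t : ℝ} (ht : 0 < t) :
    ∃ B : ℝ, 0 ≤ B ∧ ∀ (ξ : ℝ) (η : Tangent m), 0 < ξ → |h ξ η| ≤
        B * (Real.exp (1 / (32 * t) * ξ ^ 2) * Real.exp (1 / (32 * t) * ‖η‖ ^ 2)) := by
  obtain ⟨B, hB, bu⟩ := hg.exists_bound ht
  refine ⟨B, hB, fun ξ η hξ => le_of_tendsto (hu.initial_tendsto ξ η hξ).abs ?_⟩
  filter_upwards [Ioc_mem_nhdsGT ht] with τ hτ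
  exact bu ξ η τ hξ hτ.1 hτ.2

lemma IsClassicalSolution.continuousOn_slice (hu : IsClassicalSolution F h u) {τ : ℝ}
    (hτ : 0 < τ) : ContinuousOn (fun p : ℝ × Tangent m => u p.1 p.2 τ) (halfSpace m) := by
  simpa using hu.continuousOn_shift le_rfl hτ

/-- No regularity of `h` is assumed; it is a pointwise limit of the continuous slices of `u`. -/
lemma IsClassicalSolution.aestronglyMeasurable_initial (hu : IsClassicalSolution F h u) :
    AEStronglyMeasurable (fun p : ℝ × Tangent m => h p.1 p.2) (volume.restrict (halfSpace m)) := by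
  refine aestronglyMeasurable_of_tendsto_ae (atTop : Filter ℕ)
    (f := fun n p => u p.1 p.2 (1 / ((n : ℝ) + 1))) (fun n => ?_) ?_
  · exact (hu.continuousOn_slice (by positivity)).aestronglyMeasurable (measurableSet_halfSpace m)
  · filter_upwards [ae_restrict_mem (measurableSet_halfSpace m)] with p hp
    refine (hu.initial_tendsto p.1 p.2 hp.1).comp (tendsto_nhdsWithin_iff.2
      ⟨tendsto_one_div_add_atTop_nhds_zero_nat, Eventually.of_forall fun n => ?_⟩)
    simp only [mem_Ioi]
    positivity

lemma continuous_green (x : ℝ) (y : Tangent m) (t τ : ℝ) :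
    Continuous (fun p : ℝ × Tangent m => green x y t p.1 p.2 τ) :=
  ((contDiff_tangentKernel y (t - τ)).continuous.comp continuous_snd).mul
    ((continuous_greenLine x t τ).comp continuous_fst)

lemma continuousAt_green_time (x : ℝ) (y : Tangent m) {t τ : ℝ} (hτ : τ < t) (ξ : ℝ)
    (η : Tangent m) : ContinuousAt (fun τ => green x y t ξ η τ) τ :=
  ((hasDerivAt_tangentKernel_time (y - η) (sub_pos.2 hτ)).comp_const_sub t τ).continuousAt.mul
    (hasDerivAt_greenLine_time x ξ hτ).continuousAt

lemma IsClassicalSolution.integrableOn_green_mul_initial (hu : IsClassicalSolution F h u)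
    (hg : HasSubGaussianGrowth F u) (x : ℝ) (y : Tangent m) {t : ℝ} (ht : 0 < t) :
    IntegrableOn (fun p : ℝ × Tangent m => green x y t p.1 p.2 0 * h p.1 p.2) (halfSpace m) := by
  obtain ⟨C, hC, bg⟩ := exists_green_mul_bound ht ht x y
  obtain ⟨B, hB, bh⟩ := hu.exists_initial_bound hg ht
  refine Integrable.mono' ((integrable_gaussian_halfSpace m (κ := 1 / (32 * t))
    (by positivity)).const_mul (C * B)) ((continuous_green x y t 0).aestronglyMeasurable.mul
    hu.aestronglyMeasurable_initial) ?_
  filter_upwards [ae_restrict_mem (measurableSet_halfSpace m)] with p hp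
  exact bg 0 (left_mem_Icc.2 le_rfl) p.1 p.2 _ B (bh p.1 p.2 hp.1)

lemma IsClassicalSolution.integrableOn_green_mul (hu : IsClassicalSolution F h u)
    (hg : HasSubGaussianGrowth F u) (x : ℝ) (y : Tangent m) {t τ : ℝ} (hτ : 0 < τ) (hτt : τ < t) :
    IntegrableOn (fun p : ℝ × Tangent m => green x y t p.1 p.2 τ * u p.1 p.2 τ)
      (halfSpace m) := by
  have ht := hτ.trans hτt
  obtain ⟨C, hC, bg⟩ := exists_green_mul_bound hτt ht x y
  obtain ⟨B, hB, bu⟩ := hg.exists_bound ht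
  refine Integrable.mono' ((integrable_gaussian_halfSpace m (κ := 1 / (32 * t))
    (by positivity)).const_mul (C * B)) ((continuous_green x y t τ).aestronglyMeasurable.mul
    ((hu.continuousOn_slice hτ).aestronglyMeasurable (measurableSet_halfSpace m))) ?_
  filter_upwards [ae_restrict_mem (measurableSet_halfSpace m)] with p hp
  exact bg τ ⟨hτ.le, le_rfl⟩ p.1 p.2 _ B (bu p.1 p.2 τ hp.1 hτ hτt.le)

/-- For `s ≤ t / 2` the kernel is regular, so pointwise convergence of `u` to `h` and a Gaussian
majorant suffice. -/
lemma IsClassicalSolution.tendsto_integral_green_zero (hu : IsClassicalSolution F h u)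
    (hg : HasSubGaussianGrowth F u) (x : ℝ) (y : Tangent m) {t : ℝ} (ht : 0 < t) :
    Tendsto (fun s => ∫ p in halfSpace m, green x y t p.1 p.2 s * u p.1 p.2 s) (𝓝[>] 0)
      (𝓝 (initialPart h x y t)) := by
  have ht2 : t / 2 < t := by linarith
  obtain ⟨C, hC, bg⟩ := exists_green_mul_bound ht2 ht x y
  obtain ⟨B, hB, bu⟩ := hg.exists_bound ht
  have ev : ∀ᶠ s : ℝ in 𝓝[>] 0, s ∈ Ioc 0 (t / 2) := Ioc_mem_nhdsGT (by positivity)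
  refine tendsto_integral_filter_of_dominated_convergence (fun p => C * B *
    (Real.exp (-(1 / (32 * t)) * p.1 ^ 2) * Real.exp (-(1 / (32 * t)) * ‖p.2‖ ^ 2))) ?_ ?_
    ((integrable_gaussian_halfSpace m (by positivity)).const_mul (C * B)) ?_
  · filter_upwards [ev] with s hs
    exact (hu.integrableOn_green_mul hg x y hs.1 (hs.2.trans_lt ht2)).1
  · filter_upwards [ev] with s hs
    filter_upwards [ae_restrict_mem (measurableSet_halfSpace m)] with p hp
    exact bg s ⟨hs.1.le, hs.2⟩ p.1 p.2 _ B (bu p.1 p.2 s hp.1 hs.1 (hs.2.trans ht2.le))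
  · filter_upwards [ae_restrict_mem (measurableSet_halfSpace m)] with p hp
    exact ((continuousAt_green_time x y ht p.1 p.2).tendsto.mono_left nhdsWithin_le_nhds).mul
      (hu.initial_tendsto p.1 p.2 hp.1)

end InitialTime

/-! ### The limit at the final time: the kernel as an approximate identity. -/

section FinalTime

variable {m : ℕ} {F : ℝ → ℝ} {h : ℝ → Tangent m → ℝ} {u : ℝ → Tangent m → ℝ → ℝ}

lemma integral_lineKernel_one : ∫ z : ℝ, lineKernel z 1 = 1 := by
  have h1 := integral_gaussian (1 / 4)
  have e : ∀ z : ℝ, lineKernel z 1 = Real.exp (-(1 / 4) * z ^ 2) / (2 * √Real.pi) := by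
    intro z
    rw [lineKernel, mul_one, mul_one]
    congr 2
    ring
  have hp : 0 < √Real.pi := Real.sqrt_pos.2 Real.pi_pos
  simp_rw [e]
  rw [integral_div, h1, show Real.pi / (1 / 4) = 2 ^ 2 * Real.pi by ring,
    Real.sqrt_mul (by norm_num), Real.sqrt_sq (by norm_num)]
  field_simp

lemma lineKernel_scale (z : ℝ) {c : ℝ} (hc : 0 < c) :
    lineKernel (c * z) (c ^ 2) = lineKernel z 1 / c := by
  have hp : 0 < √Real.pi := Real.sqrt_pos.2 Real.pi_pos
  rw [lineKernel, lineKernel, Real.sqrt_mul Real.pi_pos.le, Real.sqrt_sq hc.le, mul_one, mul_one,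
    show -(c * z) ^ 2 / (4 * c ^ 2) = -z ^ 2 / 4 by field_simp]
  field_simp

lemma tangentKernel_scale (z : Tangent m) {c : ℝ} (hc : 0 < c) :
    tangentKernel (c • z) (c ^ 2) = tangentKernel z 1 / c ^ m := by
  have hp : 0 < √Real.pi := Real.sqrt_pos.2 Real.pi_pos
  rw [tangentKernel, tangentKernel, Real.sqrt_mul Real.pi_pos.le, Real.sqrt_sq hc.le, mul_one,
    mul_one, norm_smul, Real.norm_of_nonneg hc.le,
    show -(c * ‖z‖) ^ 2 / (4 * c ^ 2) = -‖z‖ ^ 2 / 4 by field_simp,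
    show 2 * (√Real.pi * c) = 2 * √Real.pi * c by ring, mul_pow (2 * √Real.pi) c, div_div]

/-- The substitution `p = (x, y) - c z`; its Jacobian `c ^ (m + 1)` cancels the factors from
`lineKernel_scale` and `tangentKernel_scale`. -/
lemma integral_kernel_scale (x : ℝ) (y : Tangent m) {c : ℝ} (hc : 0 < c)
    (W : ℝ × Tangent m → ℝ) :
    ∫ p : ℝ × Tangent m, lineKernel (x - p.1) (c ^ 2) * tangentKernel (y - p.2) (c ^ 2) * W p =
      ∫ z : ℝ × Tangent m, lineKernel z.1 1 * tangentKernel z.2 1 * W ((x, y) - c • z) := by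
  have : (volume : Measure (ℝ × Tangent m)).IsAddHaarMeasure := by
    rw [Measure.volume_eq_prod]
    infer_instance
  rw [← integral_add_left_eq_self _ (x, y)]
  have h1 := Measure.integral_comp_smul (volume : Measure (ℝ × Tangent m)) (fun p =>
    lineKernel (x - ((x, y) + p).1) (c ^ 2) * tangentKernel (y - ((x, y) + p).2) (c ^ 2) *
      W ((x, y) + p)) (-c)
  have hd : Module.finrank ℝ (ℝ × Tangent m) = m + 1 := by
    simp [Module.finrank_prod, add_comm]
  have hcm : 0 < c ^ (m + 1) := pow_pos hc _
  rw [hd, abs_inv, abs_pow, abs_neg, abs_of_pos hc, smul_eq_mul, eq_inv_mul_iff_mul_eq₀ hcm.ne'] at h1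
  rw [← h1, ← integral_const_mul]
  congr 1
  ext z
  simp only [neg_smul, ← sub_eq_add_neg, Prod.fst_sub, Prod.snd_sub, sub_sub_cancel,
    Prod.smul_fst, Prod.smul_snd, smul_eq_mul, lineKernel_scale _ hc, tangentKernel_scale _ hc]
  field_simp
  ring

/-- The heat kernel is an approximate identity, also for functions that depend on time. -/
lemma tendsto_integral_kernel {W : ℝ × Tangent m → ℝ → ℝ} {t B w : ℝ} (ht : 0 < t) (hB : 0 ≤ B)
    (x : ℝ) (y : Tangent m) (hm : ∀ r ∈ Ioo 0 t, Continuous (fun p => W p r))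
    (hb : ∀ r ∈ Ioo 0 t, ∀ p, |W p r| ≤
      B * (Real.exp (1 / (32 * t) * p.1 ^ 2) * Real.exp (1 / (32 * t) * ‖p.2‖ ^ 2)))
    (hl : Tendsto (fun q : (ℝ × Tangent m) × ℝ => W q.1 q.2) (𝓝 ((x, y), t)) (𝓝 w)) :
    Tendsto (fun r => ∫ p : ℝ × Tangent m,
      lineKernel (x - p.1) (t - r) * tangentKernel (y - p.2) (t - r) * W p r) (𝓝[<] t) (𝓝 w) := by
  have ev : ∀ᶠ r : ℝ in 𝓝[<] t, r ∈ Ioo 0 t := Ioo_mem_nhdsLT ht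
  have unit : ∫ z : ℝ × Tangent m, lineKernel z.1 1 * tangentKernel z.2 1 = 1 := by
    rw [Measure.volume_eq_prod, integral_prod_mul (fun z => lineKernel z 1)
      (fun z : Tangent m => tangentKernel z 1), integral_lineKernel_one, one_mul]
    have := integral_tangentKernel (0 : Tangent m) one_pos
    rw [integral_sub_left_eq_self (fun z => tangentKernel z 1) volume (0 : Tangent m)] at this
    exact this
  -- After rescaling the kernel is fixed and only the argument of `W` moves, so dominated
  -- convergence applies.
  have main : Tendsto (fun r => ∫ z : ℝ × Tangent m, lineKernel z.1 1 * tangentKernel z.2 1 *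
      W ((x, y) - √(t - r) • z) r) (𝓝[<] t)
      (𝓝 (∫ z : ℝ × Tangent m, lineKernel z.1 1 * tangentKernel z.2 1 * w)) := by
    set E := Real.exp (1 / (16 * t) * x ^ 2) * Real.exp (1 / (16 * t) * ‖y‖ ^ 2)
    set K := B * E / ((2 * √Real.pi) * (2 * √Real.pi) ^ m)
    refine tendsto_integral_filter_of_dominated_convergence (fun z =>
      K * (Real.exp (-(3 / 16) * z.1 ^ 2) * Real.exp (-(3 / 16) * ‖z.2‖ ^ 2))) ?_ ?_ ?_ ?_
    · filter_upwards [ev] with r hr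
      have c1 : Continuous (fun z : ℝ => lineKernel z 1) := by unfold lineKernel; fun_prop
      have c2 : Continuous (fun z : Tangent m => tangentKernel z 1) := by
        unfold tangentKernel; fun_prop
      exact (((c1.comp continuous_fst).mul (c2.comp continuous_snd)).mul
        ((hm r hr).comp (by fun_prop))).aestronglyMeasurable
    · filter_upwards [ev] with r hr
      refine Eventually.of_forall fun z => ?_
      have hσ : 0 < t - r := sub_pos.2 hr.2
      -- As `t - r ≤ t`, the growth of `W` costs at most the rate `1 / 16` in the rescaled variable;
      -- the kernel at time `1` decays at rate `1 / 4`, which leaves `3 / 16`.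
      have q : ∀ ρ₀ ρ ρ₁ : ℝ, 0 ≤ ρ₁ → ρ₁ ≤ ρ₀ + √(t - r) * ρ → Real.exp (1 / (32 * t) * ρ₁ ^ 2) ≤
          Real.exp (1 / (16 * t) * ρ₀ ^ 2) * Real.exp (1 / 16 * ρ ^ 2) := by
        intro ρ₀ ρ ρ₁ h0 h1
        rw [← Real.exp_add]
        apply Real.exp_le_exp.2
        have h2 : ρ₁ ^ 2 ≤ 2 * ρ₀ ^ 2 + 2 * (t * ρ ^ 2) := by
          have h3 : ρ₁ ^ 2 ≤ (ρ₀ + √(t - r) * ρ) ^ 2 := by gcongr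
          have h4 : (√(t - r) * ρ) ^ 2 ≤ t * ρ ^ 2 := by
            rw [mul_pow, Real.sq_sqrt hσ.le]
            have := hr.1
            gcongr
            linarith
          nlinarith [sq_nonneg (ρ₀ - √(t - r) * ρ)]
        calc 1 / (32 * t) * ρ₁ ^ 2 ≤ 1 / (32 * t) * (2 * ρ₀ ^ 2 + 2 * (t * ρ ^ 2)) := by gcongr
          _ = _ := by field_simp; ring
      have q1 := q |x| |z.1| |x - √(t - r) * z.1| (abs_nonneg _) (by
        refine (abs_sub _ _).trans ?_
        rw [abs_mul, abs_of_nonneg (Real.sqrt_nonneg _)])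
      have q2 := q ‖y‖ ‖z.2‖ ‖y - √(t - r) • z.2‖ (norm_nonneg _) (by
        refine (norm_sub_le _ _).trans ?_
        rw [norm_smul, Real.norm_of_nonneg (Real.sqrt_nonneg _)])
      simp only [sq_abs] at q1
      have b := hb r hr ((x, y) - √(t - r) • z)
      simp only [Prod.fst_sub, Prod.snd_sub, Prod.smul_fst, Prod.smul_snd, smul_eq_mul] at b
      have b2 : |W ((x, y) - √(t - r) • z) r| ≤ B * (E * (Real.exp (1 / 16 * z.1 ^ 2) *
          Real.exp (1 / 16 * ‖z.2‖ ^ 2))) := by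
        refine b.trans (mul_le_mul_of_nonneg_left ?_ hB)
        calc _ ≤ _ := mul_le_mul q1 q2 (Real.exp_pos _).le (by positivity)
          _ = _ := by ring
      rw [Real.norm_eq_abs, abs_mul, abs_mul, abs_of_nonneg (lineKernel_nonneg _ _),
        abs_of_nonneg (tangentKernel_nonneg _ _)]
      have e : ∀ ρ : ℝ, Real.exp (-(3 / 16) * ρ ^ 2) =
          Real.exp (-ρ ^ 2 / (4 * 1)) * Real.exp (1 / 16 * ρ ^ 2) := by
        intro ρ
        rw [← Real.exp_add]
        congr 1
        ring
      calc _ ≤ lineKernel z.1 1 * tangentKernel z.2 1 * (B * (E * (Real.exp (1 / 16 * z.1 ^ 2) *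
          Real.exp (1 / 16 * ‖z.2‖ ^ 2)))) := mul_le_mul_of_nonneg_left b2
            (mul_nonneg (lineKernel_nonneg _ _) (tangentKernel_nonneg _ _))
        _ = _ := by
          rw [e, e, lineKernel, tangentKernel, mul_one Real.pi]
          ring
    · exact ((integrable_exp_neg_mul_sq (by norm_num)).mul_prod
        (integrable_exp_neg_mul_norm_sq m (by norm_num))).const_mul K
    · refine Eventually.of_forall fun z => (hl.comp (g := fun q : (ℝ × Tangent m) × ℝ =>
        W q.1 q.2) (f := fun r => ((x, y) - √(t - r) • z, r)) ?_).const_mul _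
      refine Tendsto.mono_left ?_ nhdsWithin_le_nhds
      have c : Continuous (fun r => (((x, y) - √(t - r) • z, r) : (ℝ × Tangent m) × ℝ)) := by
        fun_prop
      have := c.tendsto t
      simpa using this
  rw [integral_mul_const, unit, one_mul] at main
  refine main.congr' ?_
  filter_upwards [ev] with r hr
  have hσ : 0 < t - r := sub_pos.2 hr.2
  have := integral_kernel_scale x y (Real.sqrt_pos.2 hσ) (fun p => W p r)
  rw [Real.sq_sqrt hσ.le] at this
  exact this.symm

/-- As `lineKernel` is even, the Green's function is the difference of the heat kernels centred at
`x` and at `-x`. Applied to `u` extended by zero, they tend to `u x y t` and to `0`. -/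
lemma IsClassicalSolution.tendsto_integral_green_final (hu : IsClassicalSolution F h u)
    (hg : HasSubGaussianGrowth F u) {x : ℝ} (hx : 0 < x) (y : Tangent m) {t : ℝ} (ht : 0 < t) :
    Tendsto (fun r => ∫ p in halfSpace m, green x y t p.1 p.2 r * u p.1 p.2 r) (𝓝[<] t)
      (𝓝 (u x y t)) := by
  obtain ⟨B, hB, bu⟩ := hg.exists_bound ht
  -- The extension by zero, written with `max`: continuity across `ξ = 0` comes from the boundary
  -- condition.
  set W : ℝ × Tangent m → ℝ → ℝ := fun p r => u (max p.1 0) p.2 r with hW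
  have W0 : ∀ p r, 0 < r → p.1 ≤ 0 → W p r = 0 := fun p r hr hp => by
    simp only [hW, max_eq_right hp, hu.boundary p.2 r hr]
  have W1 : ∀ p r, 0 < p.1 → W p r = u p.1 p.2 r := fun p r hp => by
    simp only [hW, max_eq_left hp.le]
  have Wc : ∀ r, 0 < r → Continuous (fun p => W p r) := by
    intro r hr
    rw [← continuousOn_univ]
    exact hu.continuousOn.comp (f := fun p : ℝ × Tangent m => (max p.1 0, p.2, r)) (by fun_prop)
      fun p _ => ⟨le_max_right _ _, hr⟩
  have Wj : ∀ x : ℝ, Tendsto (fun q : (ℝ × Tangent m) × ℝ => W q.1 q.2) (𝓝 ((x, y), t))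
      (𝓝 (W (x, y) t)) := by
    intro x
    have hc : ContinuousOn (fun q : (ℝ × Tangent m) × ℝ => W q.1 q.2) {q | 0 < q.2} :=
      hu.continuousOn.comp (f := fun q : (ℝ × Tangent m) × ℝ => (max q.1.1 0, q.1.2, q.2))
        (by fun_prop) fun q hq => ⟨le_max_right _ _, hq⟩
    exact (hc.continuousAt ((isOpen_lt continuous_const continuous_snd).mem_nhds ht)).tendsto
  have Wb : ∀ r ∈ Ioo 0 t, ∀ p, |W p r| ≤
      B * (Real.exp (1 / (32 * t) * p.1 ^ 2) * Real.exp (1 / (32 * t) * ‖p.2‖ ^ 2)) := by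
    intro r hr p
    rcases le_or_gt p.1 0 with hp | hp
    · rw [W0 p r hr.1 hp, abs_zero]
      positivity
    · rw [W1 p r hp]
      exact bu p.1 p.2 r hp hr.1 hr.2.le
  have A1 := tendsto_integral_kernel ht hB x y (fun r hr => Wc r hr.1) Wb (Wj x)
  have A2 := tendsto_integral_kernel ht hB (-x) y (fun r hr => Wc r hr.1) Wb (Wj (-x))
  rw [W1 (x, y) t hx] at A1
  rw [W0 (-x, y) t ht (by simpa using hx.le)] at A2
  have A := A1.sub A2
  rw [sub_zero] at A
  refine A.congr' ?_
  filter_upwards [Ioo_mem_nhdsLT ht] with r hr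
  obtain ⟨C₁, hC₁, bl⟩ := exists_lineKernel_bound ht (sub_pos.2 hr.2) |x|
  obtain ⟨C₂, hC₂, bk⟩ := exists_tangentKernel_bound m ht (sub_pos.2 hr.2) ‖y‖
  have hσ : t - r ∈ Icc (t - r) t := ⟨le_rfl, by linarith [hr.1]⟩
  have I : ∀ x' : ℝ, |x'| ≤ |x| → Integrable (fun p : ℝ × Tangent m =>
      lineKernel (x' - p.1) (t - r) * tangentKernel (y - p.2) (t - r) * W p r) := by
    intro x' hx'
    refine Integrable.mono' (((integrable_exp_neg_mul_sq (b := 1 / (32 * t))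
      (by positivity)).mul_prod (integrable_exp_neg_mul_norm_sq m (κ := 1 / (32 * t))
      (by positivity))).const_mul (C₁ * C₂ * B)) ?_ (Eventually.of_forall fun p => ?_)
    · have c1 : Continuous (fun p : ℝ × Tangent m => lineKernel (x' - p.1) (t - r)) := by
        unfold lineKernel; fun_prop
      exact ((c1.mul ((contDiff_tangentKernel y (t - r)).continuous.comp continuous_snd)).mul
        (Wc r hr.1)).aestronglyMeasurable
    · rw [Real.norm_eq_abs, abs_mul, abs_mul, abs_of_nonneg (lineKernel_nonneg _ _),
        abs_of_nonneg (tangentKernel_nonneg _ _)]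
      exact gaussian_mul_le (lineKernel_nonneg _ _) (tangentKernel_nonneg _ _) (abs_nonneg _)
        (bl _ hσ x' hx' p.1).1 (bk _ hσ y le_rfl p.2).1 (Wb r hr p)
  rw [← integral_sub (I x le_rfl) (I (-x) (abs_neg x).le),
    ← setIntegral_eq_integral_of_forall_compl_eq_zero (s := halfSpace m)]
  · refine setIntegral_congr_fun (measurableSet_halfSpace m) fun p hp => ?_
    rw [W1 p r hp.1, green_eq, greenLine_eq, ← lineKernel_neg (x + p.1),
      show -(x + p.1) = -x - p.1 by ring]
    ring
  · intro p hp
    have hp' : p.1 ≤ 0 := by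
      by_contra hc
      exact hp ⟨not_le.1 hc, mem_univ _⟩
    rw [W0 p r hr.1 hp', mul_zero, mul_zero, sub_zero]

end FinalTime

/-! ### The integral representation of the solution. -/

section Representation

variable {m : ℕ} {F : ℝ → ℝ} {h : ℝ → Tangent m → ℝ} {u : ℝ → Tangent m → ℝ → ℝ}

/-- The integral representation of the solution, in the interior of the half-space. -/
theorem IsClassicalSolution.eq_initialPart_sub (hu : IsClassicalSolution F h u)
    (hg : HasSubGaussianGrowth F u) {x : ℝ} (hx : 0 < x) (y : Tangent m) {t : ℝ} (ht : 0 < t) :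
    u x y t = initialPart h x y t - ∫ τ in (0 : ℝ)..t,
      erf (x / (2 * √(t - τ))) * smoothedSource F (boundaryFlux u) y t τ := by
  set Q : ℝ → ℝ := fun τ => erf (x / (2 * √(t - τ))) * smoothedSource F (boundaryFlux u) y t τ
  set I : ℝ → ℝ := fun τ => ∫ p in halfSpace m, green x y t p.1 p.2 τ * u p.1 p.2 τ
  set P : ℝ → ℝ := fun τ => ∫ s in (0 : ℝ)..τ, Q s
  have hQ : IntervalIntegrable Q volume 0 t := hu.intervalIntegrable_erf_mul hg x y ht
  have hP : ContinuousOn P (Icc 0 t) := by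
    have := intervalIntegral.continuousOn_primitive_interval' hQ left_mem_uIcc
    rwa [uIcc_of_le ht.le] at this
  -- The quantity `I + P` is constant in time; its limits at `0` and at `t` are then compared.
  have step : ∀ s r, 0 < s → s ≤ r → r < t → I s + P s = I r + P r := by
    intro s r hs hsr hrt
    have h1 := hu.green_representation_interior hg x y hs hsr hrt
    rw [hu.integral_slab_green_mul_source hg x y hs hsr hrt,
      integral_sub (hu.integrableOn_green_mul hg x y (hs.trans_le hsr) hrt)
        (hu.integrableOn_green_mul hg x y hs (hsr.trans_lt hrt))] at h1
    have i1 : IntervalIntegrable Q volume 0 s := hQ.mono_set (by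
      rw [uIcc_of_le hs.le, uIcc_of_le ht.le]
      exact Icc_subset_Icc le_rfl (hsr.trans hrt.le))
    have i2 : IntervalIntegrable Q volume s r := hQ.mono_set (by
      rw [uIcc_of_le hsr, uIcc_of_le ht.le]
      exact Icc_subset_Icc hs.le hrt.le)
    have h2 : P s + ∫ τ in s..r, Q τ = P r := intervalIntegral.integral_add_adjacent_intervals i1 i2
    change I r - I s = -∫ τ in s..r, Q τ at h1
    linarith
  have start : ∀ r, 0 < r → r < t → I r + P r = initialPart h x y t := by
    intro r hr hrt
    have P0 : Tendsto P (𝓝[>] 0) (𝓝 0) := by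
      have h1 := (hP 0 (left_mem_Icc.2 ht.le)).tendsto
      rw [show P 0 = 0 from intervalIntegral.integral_same] at h1
      exact h1.mono_left (nhdsWithin_le_of_mem (Icc_mem_nhdsGT ht))
    have h2 := (hu.tendsto_integral_green_zero hg x y ht).add P0
    rw [add_zero] at h2
    refine tendsto_nhds_unique (tendsto_const_nhds.congr' ?_) h2
    filter_upwards [Ioc_mem_nhdsGT hr] with s hs
    exact (step s r hs.1 hs.2 hrt).symm
  have Pt : Tendsto P (𝓝[<] t) (𝓝 (P t)) :=
    (hP t (right_mem_Icc.2 ht.le)).tendsto.mono_left (nhdsWithin_le_of_mem (Icc_mem_nhdsLT ht))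
  have h3 := (hu.tendsto_integral_green_final hg hx y ht).add Pt
  have h4 : u x y t + P t = initialPart h x y t := by
    refine tendsto_nhds_unique h3 (tendsto_const_nhds.congr' ?_)
    filter_upwards [Ioo_mem_nhdsLT ht] with r hr
    exact (start r hr.1 hr.2).symm
  exact eq_sub_of_add_eq h4

lemma greenLine_zero_left (t ξ τ : ℝ) : greenLine 0 t ξ τ = 0 := by simp [greenLine]

theorem IsClassicalSolution.eq_initialPart_sub_of_nonneg (hu : IsClassicalSolution F h u)
    (hg : HasSubGaussianGrowth F u) {x : ℝ} (hx : 0 ≤ x) (y : Tangent m) {t : ℝ} (ht : 0 < t) :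
    u x y t = initialPart h x y t - ∫ τ in (0 : ℝ)..t,
      erf (x / (2 * √(t - τ))) * smoothedSource F (boundaryFlux u) y t τ := by
  rcases hx.eq_or_lt with rfl | hx
  · simp [hu.boundary y t ht, initialPart, green_eq, greenLine_zero_left, erf_zero]
  · exact hu.eq_initialPart_sub hg hx y ht

end Representation

/-! ### The boundary flux and its Volterra equation. -/

section Flux

variable {m : ℕ} {F : ℝ → ℝ} {h : ℝ → Tangent m → ℝ} {u : ℝ → Tangent m → ℝ → ℝ}

/-- By this symmetry derivatives in `x` are derivatives in `ξ` with the two variables exchanged. -/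
lemma greenLine_symm (x t ξ τ : ℝ) : greenLine x t ξ τ = greenLine ξ t x τ := by
  rw [greenLine_eq, greenLine_eq, ← lineKernel_neg (x - ξ), neg_sub, add_comm]

lemma hasDerivAt_green_left (x : ℝ) (y : Tangent m) (t ξ : ℝ) (η : Tangent m) (τ : ℝ) :
    HasDerivAt (fun x => green x y t ξ η τ)
      (tangentKernel (y - η) (t - τ) * greenLineDeriv ξ t x τ) x := by
  simp_rw [green_eq, greenLine_symm _ t ξ τ]
  exact (hasDerivAt_greenLine ξ t x τ).const_mul _

lemma greenX_eq (x : ℝ) (y : Tangent m) (t ξ : ℝ) (η : Tangent m) (τ : ℝ) :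
    greenX x y t ξ η τ = tangentKernel (y - η) (t - τ) * greenLineDeriv ξ t x τ :=
  (hasDerivAt_green_left x y t ξ η τ).deriv

/-- Differentiation under the integral: for `|x| < 1` the differentiated kernel has one Gaussian
bound, which absorbs the growth of `h`. -/
lemma IsClassicalSolution.hasDerivAt_initialPart (hu : IsClassicalSolution F h u)
    (hg : HasSubGaussianGrowth F u) (y : Tangent m) {t : ℝ} (ht : 0 < t) :
    IntegrableOn (fun p : ℝ × Tangent m => greenX 0 y t p.1 p.2 0 * h p.1 p.2) (halfSpace m) ∧
      HasDerivAt (fun x => initialPart h x y t) (initialFlux h y t) 0 := by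
  obtain ⟨C₁, hC₁, bl⟩ := exists_lineKernel_bound ht ht 1
  obtain ⟨C₂, hC₂, bk⟩ := exists_tangentKernel_bound m ht ht ‖y‖
  obtain ⟨B, hB, bh⟩ := hu.exists_initial_bound hg ht
  have ht' : t ∈ Icc t t := ⟨le_rfl, le_rfl⟩
  have bd : ∀ x ∈ Metric.ball (0 : ℝ) 1, ∀ ξ,
      |greenLineDeriv ξ t x 0| ≤ (2 * C₁) * Real.exp (-(1 / (16 * t)) * ξ ^ 2) := by
    intro x hx ξ
    have hx' : |x| ≤ 1 := by simpa using (mem_ball_zero_iff.1 hx).le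
    have h1 := (bl t ht' x hx' ξ).2
    have h2 := (bl t ht' x hx' (-ξ)).2
    simp only [sub_neg_eq_add, even_two, Even.neg_pow] at h2
    unfold greenLineDeriv
    rw [sub_zero, ← lineKernel_neg (ξ - x), neg_sub, add_comm ξ x]
    refine (abs_add_le _ _).trans ?_
    rw [abs_mul, abs_mul, abs_div, abs_div, abs_of_nonneg (lineKernel_nonneg _ _),
      abs_of_nonneg (lineKernel_nonneg _ _), abs_of_pos (by positivity : 0 < 2 * t),
      abs_sub_comm ξ x]
    linarith
  have main := hasDerivAt_integral_of_dominated_loc_of_deriv_le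
    (μ := volume.restrict (halfSpace m)) (x₀ := (0 : ℝ)) (s := Metric.ball 0 1)
    (F := fun x (p : ℝ × Tangent m) => green x y t p.1 p.2 0 * h p.1 p.2)
    (F' := fun x p => greenX x y t p.1 p.2 0 * h p.1 p.2)
    (bound := fun p => (2 * C₁) * C₂ * B *
      (Real.exp (-(1 / (32 * t)) * p.1 ^ 2) * Real.exp (-(1 / (32 * t)) * ‖p.2‖ ^ 2)))
    (Metric.ball_mem_nhds 0 one_pos)
    (Eventually.of_forall fun x => (hu.integrableOn_green_mul_initial hg x y ht).1)
    (hu.integrableOn_green_mul_initial hg 0 y ht) ?_ ?_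
    ((integrable_gaussian_halfSpace m (by positivity)).const_mul _) ?_
  · exact main
  · refine AEStronglyMeasurable.mul ?_ hu.aestronglyMeasurable_initial
    simp_rw [greenX_eq]
    have c : Continuous (fun ξ => greenLineDeriv ξ t 0 0) := by
      unfold greenLineDeriv lineKernel
      fun_prop
    exact (((contDiff_tangentKernel y (t - 0)).continuous.comp continuous_snd).mul
      (c.comp continuous_fst)).aestronglyMeasurable
  · filter_upwards [ae_restrict_mem (measurableSet_halfSpace m)] with p hp x hx
    have := gaussian_mul_le (abs_nonneg _) (tangentKernel_nonneg _ _) (abs_nonneg _)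
      (bd x hx p.1) (bk t ht' y le_rfl p.2).1 (bh p.1 p.2 hp.1)
    rw [Real.norm_eq_abs, greenX_eq, sub_zero, abs_mul, abs_mul,
      abs_of_nonneg (tangentKernel_nonneg _ _), mul_comm (tangentKernel _ _)]
    exact this
  · refine Eventually.of_forall fun p x _ => ?_
    rw [greenX_eq]
    exact (hasDerivAt_green_left x y t p.1 p.2 0).mul_const _

lemma hasDerivAt_erf_div {σ : ℝ} (hσ : 0 < σ) (x : ℝ) :
    HasDerivAt (fun x => erf (x / (2 * √σ))) (2 * lineKernel x σ) x := by
  simpa using hasDerivAt_erf_comp hσ 0 x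

lemma lineKernel_le (x : ℝ) {σ : ℝ} (hσ : 0 < σ) :
    lineKernel x σ ≤ lineKernel 0 σ := by
  unfold lineKernel
  have : -x ^ 2 / (4 * σ) ≤ -0 ^ 2 / (4 * σ) := by
    apply div_le_div_of_nonneg_right _ (by positivity)
    nlinarith [sq_nonneg x]
  gcongr

lemma lineKernel_zero (σ : ℝ) : lineKernel 0 σ = 1 / (2 * √(Real.pi * σ)) := by
  simp [lineKernel]

/-- Up to a constant the integrand is `(t - τ)^(-1/2)`. -/
lemma integrableOn_lineKernel_zero {t : ℝ} (ht : 0 < t) :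
    IntegrableOn (fun τ => lineKernel 0 (t - τ)) (Ioc 0 t) := by
  rw [← intervalIntegrable_iff_integrableOn_Ioc_of_le ht.le]
  have h1 : IntervalIntegrable (fun σ : ℝ => 1 / (2 * √Real.pi) * σ ^ (-(1 / 2) : ℝ)) volume t 0 :=
    (intervalIntegral.intervalIntegrable_rpow' (by norm_num)).const_mul _
  have h2 := h1.comp_sub_left t
  simp only [sub_self, sub_zero] at h2
  refine h2.congr fun τ hτ => ?_
  rw [uIoc_of_le ht.le] at hτ
  have hσ : 0 ≤ t - τ := sub_nonneg.2 hτ.2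
  simp only [lineKernel_zero]
  rw [Real.rpow_neg hσ, ← Real.sqrt_eq_rpow, Real.sqrt_mul Real.pi_pos.le]
  ring

/-- The single-layer kernel is integrable against the smoothed source. -/
lemma IsClassicalSolution.integrableOn_lineKernel_mul (hu : IsClassicalSolution F h u)
    (hg : HasSubGaussianGrowth F u) (y : Tangent m) {t : ℝ} (ht : 0 < t) :
    IntegrableOn (fun τ => lineKernel 0 (t - τ) * |smoothedSource F (boundaryFlux u) y t τ|)
      (Ioc 0 t) := by
  obtain ⟨G, hG, ⟨M, hM, hGM⟩, hb⟩ := hg.exists_smoothedSource_bound y ht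
  have dom : IntegrableOn (fun τ => lineKernel 0 (t / 2) * G τ + M * lineKernel 0 (t - τ))
      (Ioc 0 t) := (hG.const_mul _).add ((integrableOn_lineKernel_zero ht).const_mul M)
  refine Integrable.mono' dom ((integrableOn_lineKernel_zero ht).1.mul
    (hu.aestronglyMeasurable_smoothedSource y t).norm) ?_
  rw [← restrict_Ioo_eq_restrict_Ioc]
  filter_upwards [ae_restrict_mem measurableSet_Ioo] with τ hτ
  have b := hb τ hτ.1 hτ.2
  have hG0 : 0 ≤ G τ := (abs_nonneg _).trans b
  have hk := lineKernel_nonneg 0 (t - τ)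
  rw [Real.norm_eq_abs, abs_mul, abs_abs, abs_of_nonneg hk]
  -- The time `t / 2` separates the singularity of the source at `0` from that of the kernel at `t`:
  -- in each half one factor is bounded and the other integrable.
  rcases le_or_gt τ (t / 2) with hle | hlt
  · have h1 : lineKernel 0 (t - τ) ≤ lineKernel 0 (t / 2) := by
      rw [lineKernel_zero, lineKernel_zero]
      have := two_mul_sqrt_pi_mul_pos (half_pos ht)
      have := Real.pi_pos.le
      gcongr
      linarith
    have h2 := mul_le_mul h1 b (abs_nonneg _) (lineKernel_nonneg 0 (t / 2))
    linarith [mul_nonneg hM hk]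
  · have h2 := mul_le_mul_of_nonneg_left (b.trans (hGM τ ⟨hlt.le, hτ.2.le⟩)) hk
    linarith [mul_nonneg (lineKernel_nonneg 0 (t / 2)) hG0]

/-- The derivative of the error function is twice a Gaussian in `x`, largest at `x = 0`; this
maximum, times the smoothed source, is an integrable majorant for all `x`. -/
lemma IsClassicalSolution.hasDerivAt_source_term (hu : IsClassicalSolution F h u)
    (hg : HasSubGaussianGrowth F u) (y : Tangent m) {t : ℝ} (ht : 0 < t) :
    IntervalIntegrable (fun τ => lineKernel 0 (t - τ) *
      smoothedSource F (boundaryFlux u) y t τ) volume 0 t ∧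
    HasDerivAt (fun x => ∫ τ in (0 : ℝ)..t, erf (x / (2 * √(t - τ))) *
      smoothedSource F (boundaryFlux u) y t τ)
      (2 * ∫ τ in (0 : ℝ)..t, lineKernel 0 (t - τ) * smoothedSource F (boundaryFlux u) y t τ)
      0 := by
  have meas := hu.aestronglyMeasurable_smoothedSource y t
  have dom := hu.integrableOn_lineKernel_mul hg y ht
  have int : IntervalIntegrable (fun τ => lineKernel 0 (t - τ) *
      smoothedSource F (boundaryFlux u) y t τ) volume 0 t := by
    rw [intervalIntegrable_iff_integrableOn_Ioc_of_le ht.le]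
    refine Integrable.mono' dom ((integrableOn_lineKernel_zero ht).1.mul meas)
      (Eventually.of_forall fun τ => ?_)
    rw [Real.norm_eq_abs, abs_mul, abs_of_nonneg (lineKernel_nonneg _ _)]
  refine ⟨int, ?_⟩
  rw [← intervalIntegral.integral_const_mul]
  have main := intervalIntegral.hasDerivAt_integral_of_dominated_loc_of_deriv_le
    (μ := volume) (a := 0) (b := t) (x₀ := (0 : ℝ)) (s := Metric.ball 0 1)
    (F := fun x τ => erf (x / (2 * √(t - τ))) * smoothedSource F (boundaryFlux u) y t τ)
    (F' := fun x τ => 2 * lineKernel x (t - τ) * smoothedSource F (boundaryFlux u) y t τ)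
    (bound := fun τ => 2 * (lineKernel 0 (t - τ) * |smoothedSource F (boundaryFlux u) y t τ|))
    (Metric.ball_mem_nhds 0 one_pos)
    (Eventually.of_forall fun x => ?_) (hu.intervalIntegrable_erf_mul hg 0 y ht) ?_ ?_ ?_ ?_
  · refine main.2.congr_deriv (intervalIntegral.integral_congr fun τ _ => ?_)
    simp only [mul_assoc]
  · rw [uIoc_of_le ht.le]
    have := hu.intervalIntegrable_erf_mul hg x y ht
    exact ((intervalIntegrable_iff_integrableOn_Ioc_of_le ht.le).1 this).1
  · rw [uIoc_of_le ht.le]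
    exact ((integrableOn_lineKernel_zero ht).1.const_mul 2).mul meas
  · have hne : ∀ᵐ τ : ℝ, τ ≠ t := by simp [ae_iff]
    filter_upwards [hne] with τ hτt hτ x _
    rw [uIoc_of_le ht.le] at hτ
    have hσ : 0 < t - τ := sub_pos.2 (lt_of_le_of_ne hτ.2 hτt)
    rw [Real.norm_eq_abs, abs_mul, abs_mul, abs_two, abs_of_nonneg (lineKernel_nonneg _ _),
      mul_assoc]
    have := lineKernel_le x hσ
    gcongr
  · rw [intervalIntegrable_iff_integrableOn_Ioc_of_le ht.le]
    exact dom.const_mul 2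
  · have hne : ∀ᵐ τ : ℝ, τ ≠ t := by simp [ae_iff]
    filter_upwards [hne] with τ hτt hτ x _
    rw [uIoc_of_le ht.le] at hτ
    exact (hasDerivAt_erf_div (sub_pos.2 (lt_of_le_of_ne hτ.2 hτt)) x).mul_const _

/-- The Volterra equation for the boundary flux. -/
theorem IsClassicalSolution.boundaryFlux_eq (hu : IsClassicalSolution F h u)
    (hg : HasSubGaussianGrowth F u) (y : Tangent m) {t : ℝ} (ht : 0 < t) :
    boundaryFlux u y t = initialFlux h y t - 2 * ∫ τ in (0 : ℝ)..t,
      lineKernel 0 (t - τ) * smoothedSource F (boundaryFlux u) y t τ := by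
  -- The right-hand side of the representation is differentiable at `0` from both sides, though it
  -- equals `u` only for `x ≥ 0`; restricted to `Ici 0` it gives the one-sided derivative.
  have h1 := ((hu.hasDerivAt_initialPart hg y ht).2.sub
    (hu.hasDerivAt_source_term hg y ht).2).hasDerivWithinAt (s := Ici 0)
  have h2 : HasDerivWithinAt (fun x => u x y t) _ (Ici 0) 0 := h1.congr
    (fun x hx => hu.eq_initialPart_sub_of_nonneg hg hx y ht)
    (hu.eq_initialPart_sub_of_nonneg hg le_rfl y ht)
  exact h2.derivWithin (uniqueDiffOn_Ici 0 0 self_mem_Ici)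

end Flux

end HalfSpaceHeat

end

/-- Every classical solution of sub-Gaussian growth is given by the integral representation, and
its boundary flux solves the Volterra equation; all the integrals converge absolutely.
The space dimension is `n = m + 1`. -/
theorem theorem2p1 (m : ℕ) (F : ℝ → ℝ) (h : ℝ → HalfSpaceHeat.Tangent m → ℝ)
    (u : ℝ → HalfSpaceHeat.Tangent m → ℝ → ℝ)
    (hu : HalfSpaceHeat.IsClassicalSolution F h u)
    (hgrowth : HalfSpaceHeat.HasSubGaussianGrowth F u)
    (V : HalfSpaceHeat.Tangent m → ℝ → ℝ) (hV : V = HalfSpaceHeat.boundaryFlux u) :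
    -- the spatial source integrals converge
    (∀ (y : HalfSpaceHeat.Tangent m) (t τ : ℝ), 0 < τ → τ < t →
      MeasureTheory.Integrable (fun η : HalfSpaceHeat.Tangent m =>
        Real.exp (-‖y - η‖ ^ 2 / (4 * (t - τ))) * HalfSpaceHeat.source F V η τ)) ∧
    -- the integral representation of `u`
    (∀ (x : ℝ) (y : HalfSpaceHeat.Tangent m) (t : ℝ), 0 ≤ x → 0 < t →
      MeasureTheory.IntegrableOn (fun p : ℝ × HalfSpaceHeat.Tangent m =>
        HalfSpaceHeat.green x y t p.1 p.2 0 * h p.1 p.2) (HalfSpaceHeat.halfSpace m) ∧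
      IntervalIntegrable (fun τ : ℝ =>
        HalfSpaceHeat.erf (x / (2 * √(t - τ))) / (2 * √(Real.pi * (t - τ))) ^ m *
          HalfSpaceHeat.sourceIntegral F V y t τ) MeasureTheory.volume 0 t ∧
      u x y t = HalfSpaceHeat.initialPart h x y t -
        ∫ τ in (0 : ℝ)..t,
          HalfSpaceHeat.erf (x / (2 * √(t - τ))) / (2 * √(Real.pi * (t - τ))) ^ m *
            HalfSpaceHeat.sourceIntegral F V y t τ) ∧
    -- the Volterra integral equation for the boundary flux
    (∀ (y : HalfSpaceHeat.Tangent m) (t : ℝ), 0 < t →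
      MeasureTheory.IntegrableOn (fun p : ℝ × HalfSpaceHeat.Tangent m =>
        HalfSpaceHeat.greenX 0 y t p.1 p.2 0 * h p.1 p.2) (HalfSpaceHeat.halfSpace m) ∧
      IntervalIntegrable (fun τ : ℝ =>
        1 / (2 * √(Real.pi * (t - τ))) ^ (m + 1) *
          HalfSpaceHeat.sourceIntegral F V y t τ) MeasureTheory.volume 0 t ∧
      V y t = HalfSpaceHeat.initialFlux h y t -
        2 * ∫ τ in (0 : ℝ)..t,
          1 / (2 * √(Real.pi * (t - τ))) ^ (m + 1) *
            HalfSpaceHeat.sourceIntegral F V y t τ) := by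
  subst hV
  have e1 : ∀ (x : ℝ) (y : HalfSpaceHeat.Tangent m) (t τ : ℝ),
      HalfSpaceHeat.erf (x / (2 * √(t - τ))) / (2 * √(Real.pi * (t - τ))) ^ m *
        HalfSpaceHeat.sourceIntegral F (HalfSpaceHeat.boundaryFlux u) y t τ =
      HalfSpaceHeat.erf (x / (2 * √(t - τ))) *
        HalfSpaceHeat.smoothedSource F (HalfSpaceHeat.boundaryFlux u) y t τ := by
    intro x y t τ
    rw [HalfSpaceHeat.smoothedSource_eq]
    ring
  -- Of the `m + 1` normalising factors, `m` belong to the tangential kernel and one is `lineKernel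
  -- 0 (t - τ)`.
  have e2 : ∀ (y : HalfSpaceHeat.Tangent m) (t τ : ℝ),
      1 / (2 * √(Real.pi * (t - τ))) ^ (m + 1) *
        HalfSpaceHeat.sourceIntegral F (HalfSpaceHeat.boundaryFlux u) y t τ =
      HalfSpaceHeat.lineKernel 0 (t - τ) *
        HalfSpaceHeat.smoothedSource F (HalfSpaceHeat.boundaryFlux u) y t τ := by
    intro y t τ
    rw [HalfSpaceHeat.smoothedSource_eq, HalfSpaceHeat.lineKernel_zero, pow_succ, one_div_mul_eq_div,
      one_div_mul_eq_div, div_div]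
  simp only [e1, e2]
  exact ⟨fun y t τ hτ hτt => hu.integrable_exp_mul_source hgrowth y hτ hτt,
    fun x y t hx ht => ⟨hu.integrableOn_green_mul_initial hgrowth x y ht,
      hu.intervalIntegrable_erf_mul hgrowth x y ht,
      hu.eq_initialPart_sub_of_nonneg hgrowth hx y ht⟩,
    fun y t ht => ⟨(hu.hasDerivAt_initialPart hgrowth y ht).1,
      (hu.hasDerivAt_source_term hgrowth y ht).1, hu.boundaryFlux_eq hgrowth y ht⟩⟩
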